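/- **High-friction limit, Euler–Korteweg case.** Let $\Omega$ be $\mathbb R^3$ or a flat torus $(\mathbb R/\ell\mathbb Z)^3$, $\ell>0$, let $n$ be the number of components, $T>0$, $K>\kappa>0$ and $M\in\mathbb R$. *Structural assumptions.* (N) $(b_{ij})\in\mathbb R^{n\times n}$ is symmetric with $b_{ij}\ge 0$, and for all $\rho_1,\dots,\rho_n>0$ the solutions $v\in\mathbb R^n$ of $\sum_j b_{ij}\rho_i\rho_j(v_i-v_j)=0$ $(i=1,\dots,n)$ are exactly the multiples of $(1,\dots,1)$. (E) $F_i(\rho,q)=h_i(\rho)+\frac12\kappa_i(\rho)|q|^2$ with $h_i,\kappa_i\in C^3((0,\infty))$, and for some $\alpha>0$, for all $i$ and $\rho>0$: $h_i''(\rho)\ge\alpha$, $\kappa_i(\rho)\kappa_i''(\rho)-2\kappa_i'(\rho)^2\ge 0$, $\kappa_i(\rho)>0$. Put $$s_i(\rho,q)=\rho h_i'(\rho)-h_i(\rho)+\tfrac12\big(\rho\kappa_i'(\rho)+\kappa_i(\rho)\big)|q|^2,\quad r_i(\rho,q)=\rho\kappa_i(\rho)q,\quad H_i(\rho,q)=\kappa_i(\rho)\,q\otimes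 q,$$ $$S_i(\rho_i)=\big(-s_i(\rho_i,\nabla\rho_i)+\operatorname{div} r_i(\rho_i,\nabla\rho_i)\big)\mathbb I-H_i(\rho_i,\nabla\rho_i).$$ *Friction system.* For $\varepsilon>0$ consider on $\Omega\times(0,\infty)$ $$\partial_t\rho_i+\operatorname{div}(\rho_iv_i)=0,\qquad \partial_t(\rho_iv_i)+\operatorname{div}(\rho_iv_i\otimes v_i)=\operatorname{div}S_i(\rho_i)-\frac1\varepsilon\sum_{j=1}^nb_{ij}\rho_i\rho_j(v_i-v_j).$$ A weak solution consists of $0\le\rho_i\in C^0([0,\infty);L^1(\Omega))$, having weak gradients $\nabla\rho_i$, and velocities $v_i$ with $\rho_iv_i\in C^0([0,\infty);L^1(\Omega))$ and $\rho_iv_i\otimes v_i$, $s_i,r_i,H_i$ (evaluated at $(\rho_i,\nabla\rho_i)$) and the friction forces $\sum_jb_{ij}\rho_i\rho_j(v_i-v_j)$ in $L^1_{\rm loc}([0,\infty)\times\Omega)$, such that for all $i$ and all smooth compactly supported $\psi,\phi$ on $[0,\infty)\times\Omega$ (scalar and $\mathbb R^3$-valued) $$-\int_0^\infty\!\!\int_\Omega(\rho_i\partial_t\psi+\rho_iv_i\cdot\nabla\psi)\,dxdt=\int_\Omega\rho_i(x,0)\psi(x,0)\,dx,$$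 $$-\int_0^\infty\!\!\int_\Omega\big(\rho_iv_i\cdot\partial_t\phi+\rho_iv_i\otimes v_i:\nabla\phi+s_i\operatorname{div}\phi+r_i\cdot\nabla\operatorname{div}\phi+H_i:\nabla\phi\big)dxdt=\int_\Omega(\rho_iv_i\cdot\phi)(x,0)\,dx-\frac1\varepsilon\int_0^\infty\!\!\int_\Omega\sum_jb_{ij}\rho_i\rho_j(v_i-v_j)\cdot\phi\,dxdt.$$ It is *dissipative* if $e=\sum_i(F_i(\rho_i,\nabla\rho_i)+\frac12\rho_i|v_i|^2)\in C^0([0,\infty);L^1(\Omega))$, the dissipation $\sum_{i,j}b_{ij}\rho_i\rho_j|v_i-v_j|^2$ is integrable on $(0,R)\times\Omega$ for all $R$, and, with $\mathcal E_{\rm tot}(t)=\int_\Omega e(t)\,dx$, $$-\int_0^\infty\mathcal E_{\rm tot}(t)\theta'(t)\,dt+\frac1{2\varepsilon}\int_0^\infty\!\!\int_\Omega\sum_{i,j}b_{ij}\rho_i\rho_j|v_i-v_j|^2\theta\,dxdt\le\mathcal E_{\rm tot}(0)\theta(0)$$ for all nonnegative $\theta\in W^{1,\infty}([0,\infty))$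 with compact support in $[0,\infty)$. Let $\mathcal A_\varepsilon$ be the set of dissipative weak solutions $(\rho_i,v_i)_i$ with parameter $\varepsilon$ such that $\int_\Omega\sum_i\rho_i\,dx\le M$, $\mathcal E_{\rm tot}(t)\le M$ and $\kappa\le\rho_i\le K$ a.e. in $\Omega$, for all $t\in(0,T)$ and all $i$. *Limit system.* Let $(\bar\rho_1,\dots,\bar\rho_n,\bar v)$ be a $C^\infty$ solution on $\Omega\times[0,T)$ of $$\partial_t\bar\rho_i+\operatorname{div}(\bar\rho_i\bar v)=0,\qquad\partial_t(\bar\rho\bar v)+\operatorname{div}(\bar\rho\bar v\otimes\bar v)=\operatorname{div}\sum_{i=1}^nS_i(\bar\rho_i),\qquad\bar\rho=\sum_{i=1}^n\bar\rho_i,$$ with $\bar\rho_i\ge\kappa$ and such that $\bar u=(\bar\rho_1,\dots,\bar\rho_n,\bar\rho\bar v)$, $\partial_t\bar u$, $\nabla\bar u$, $D^2\bar u$ and $D^3\bar\rho_i$ are bounded on $\Omega\times(0,T)$. For $(\rho_i,v_i)_i\in\mathcal A_\varepsilon$ and $t\in[0,T)$ let $$\chi(t)=\int_\Omega\sum_{i=1}^n\Big(\tfrac12\rho_i|v_i-\bar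 v|^2+(\rho_i-\bar\rho_i)^2+\frac1{2\kappa_i(\rho_i)}\big|\kappa_i(\rho_i)\nabla\rho_i-\kappa_i(\bar\rho_i)\nabla\bar\rho_i\big|^2\Big)(t)\,dx\in[0,\infty].$$ Then there is a constant $C>0$, independent of $\varepsilon$ and of the solution in $\mathcal A_\varepsilon$, such that for all $\varepsilon>0$ and all $(\rho_i,v_i)_i\in\mathcal A_\varepsilon$ $$\chi(t)\le C(\chi(0)+\varepsilon)\qquad\text{for all }t\in(0,T).$$ In particular, if $(\rho_i^\varepsilon,v_i^\varepsilon)_i\in\mathcal A_\varepsilon$ for all $\varepsilon>0$ and the corresponding $\chi^\varepsilon$ satisfy $\chi^\varepsilon(0)\to0$ as $\varepsilon\to0$, then $\sup_{t\in(0,T)}\chi^\varepsilon(t)\to0$ as $\varepsilon\to0$. (For $\Omega=\mathbb R^3$ and $n\ge 1$ the bound $\rho_i\ge\kappa>0$ and $\rho_i\in L^1$ exclude each other, so the content of the theorem lies in the case of the torus.) -/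

import Mathlib

open MeasureTheory Set Filter Topology
open scoped ENNReal ContDiff

noncomputable section

namespace EulerKorteweg

/-- Physical space, with its Euclidean norm. -/
abbrev E3 : Type := EuclideanSpace ℝ (Fin 3)

/-- The spatial domain: the whole space, or the flat torus of side length `ℓ`. Functions on the
torus are functions on `E3` that are `ℓ`-periodic in each coordinate. -/
inductive Domain : Type
  | space : Domain
  | torus (ℓ : ℝ) (hℓ : 0 < ℓ) : Domain

/-- The set over which spatial integrals are taken: everything, or one periodicity cell. -/
def Domain.cell : Domain → Set E3
  | .space => univ
  | .torus ℓ _ => {x | ∀ k, x k ∈ Ico 0 ℓ}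

/-- `f` is a function on the domain (no condition on the whole space, periodicity on the torus). -/
def Domain.IsFunctionOn {V : Type*} : Domain → (E3 → V) → Prop
  | .space, _ => True
  | .torus ℓ _, f => ∀ (k : Fin 3) (x : E3), f (x + EuclideanSpace.single k ℓ) = f x

/-- `f` is a function on the domain with compact support (automatic on the torus). -/
def Domain.IsCompactlySupported {V : Type*} [Zero V] : Domain → (E3 → V) → Prop
  | .space, f => HasCompactSupport f
  | .torus ℓ hℓ, f => (Domain.torus ℓ hℓ).IsFunctionOn f

/-! ### Differential operators in space -/

/-- The `k`-th partial derivative of a scalar function. -/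
def pderiv (k : Fin 3) (f : E3 → ℝ) (x : E3) : ℝ :=
  fderiv ℝ f x (EuclideanSpace.single k 1)

/-- The divergence of a vector field. -/
def divergence (X : E3 → E3) (x : E3) : ℝ :=
  ∑ k : Fin 3, pderiv k (fun y => X y k) x

/-- `A : ∇φ` at the point `x`, for a matrix `A`; the `(k, j)` entry of `∇φ` is `∂_j φ_k`. -/
def contractGrad (A : Matrix (Fin 3) (Fin 3) ℝ) (φ : E3 → E3) (x : E3) : ℝ :=
  ∑ k : Fin 3, ∑ j : Fin 3, A k j * pderiv j (fun y => φ y k) x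

/-- The tensor product `a ⊗ a`. -/
def tensorSq (a : E3) : Matrix (Fin 3) (Fin 3) ℝ :=
  Matrix.of fun k j => a k * a j

/-- `g` is the weak gradient of `f` on the domain. -/
def HasWeakGradient (D : Domain) (f : E3 → ℝ) (g : E3 → E3) : Prop :=
  LocallyIntegrable f ∧ LocallyIntegrable g ∧
    ∀ ζ : E3 → ℝ, ContDiff ℝ ∞ ζ → D.IsCompactlySupported ζ → ∀ k : Fin 3,
      ∫ x in D.cell, f x * pderiv k ζ x = -∫ x in D.cell, g x k * ζ x

/-- `f ∈ C⁰([0,∞); L¹)`. -/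
def ContinuousInL1 {V : Type*} [NormedAddCommGroup V] (D : Domain) (f : ℝ → E3 → V) : Prop :=
  (∀ t, 0 ≤ t → IntegrableOn (f t) D.cell) ∧
    ∀ t₀, 0 ≤ t₀ →
      Tendsto (fun t => ∫⁻ x in D.cell, ‖f t x - f t₀ x‖ₑ) (𝓝[Ici 0] t₀) (𝓝 0)

/-- `f ∈ L¹_loc` on the closed half space-time `[0,∞) × ℝ³`. -/
def LocL1 {V : Type*} [NormedAddCommGroup V] (f : ℝ → E3 → V) : Prop :=
  LocallyIntegrableOn (fun p : ℝ × E3 => f p.1 p.2) (Ici 0 ×ˢ univ) volume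

/-! ### Energy and stresses of one component

`h` is the internal energy function and `c` is the capillarity function of the component. -/

/-- The potential energy density `F(ρ,q) = h(ρ) + ½ c(ρ) |q|²`. -/
def energyF (h c : ℝ → ℝ) (ρ : ℝ) (q : E3) : ℝ :=
  h ρ + 1 / 2 * c ρ * ‖q‖ ^ 2

/-- `s(ρ,q) = ρ ∂F/∂ρ + q · ∂F/∂q - F = p(ρ) + ½ (ρ c'(ρ) + c(ρ)) |q|²`
with the pressure `p(ρ) = ρ h'(ρ) - h(ρ)`. -/
def stressS (h c : ℝ → ℝ) (ρ : ℝ) (q : E3) : ℝ :=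
  (ρ * deriv h ρ - h ρ) + 1 / 2 * (ρ * deriv c ρ + c ρ) * ‖q‖ ^ 2

/-- `r(ρ,q) = ρ ∂F/∂q = ρ c(ρ) q`. -/
def stressR (c : ℝ → ℝ) (ρ : ℝ) (q : E3) : E3 :=
  (ρ * c ρ) • q

/-- `H(ρ,q) = q ⊗ ∂F/∂q = c(ρ) q ⊗ q`. -/
def stressH (c : ℝ → ℝ) (ρ : ℝ) (q : E3) : Matrix (Fin 3) (Fin 3) ℝ :=
  c ρ • tensorSq q

/-- The Korteweg stress tensor `S = (-s + div r) I - H` of a smooth density `f`. -/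
def stressTensor (h c : ℝ → ℝ) (f : E3 → ℝ) (x : E3) : Matrix (Fin 3) (Fin 3) ℝ :=
  (-stressS h c (f x) (gradient f x)
      + divergence (fun y => stressR c (f y) (gradient f y)) x) • (1 : Matrix (Fin 3) (Fin 3) ℝ)
    - stressH c (f x) (gradient f x)

/-! ### Structural hypotheses -/

/-- The friction coefficients form a symmetric nonnegative matrix, and for all positive densities
the null space of the friction operator consists of the constant vectors. -/
def FrictionHypothesis {n : ℕ} (b : Fin n → Fin n → ℝ) : Prop :=
  (∀ i j, b i j = b j i) ∧ (∀ i j, 0 ≤ b i j) ∧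
    ∀ ρ : Fin n → ℝ, (∀ i, 0 < ρ i) → ∀ v : Fin n → ℝ,
      (∀ i, ∑ j, b i j * ρ i * ρ j * (v i - v j) = 0) ↔ ∃ a : ℝ, ∀ i, v i = a

/-- `h_i`, `c_i` are `C³` on `(0,∞)`, with `h_i'' ≥ α > 0`, `c_i c_i'' - 2 (c_i')² ≥ 0`, `c_i > 0`. -/
def EnergyHypothesis {n : ℕ} (h c : Fin n → ℝ → ℝ) : Prop :=
  (∀ i, ContDiffOn ℝ 3 (h i) (Ioi 0)) ∧ (∀ i, ContDiffOn ℝ 3 (c i) (Ioi 0)) ∧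
    ∃ α : ℝ, 0 < α ∧ ∀ i, ∀ r : ℝ, 0 < r →
      α ≤ deriv (deriv (h i)) r ∧
      0 ≤ c i r * deriv (deriv (c i)) r - 2 * (deriv (c i) r) ^ 2 ∧
      0 < c i r

/-! ### Dissipative weak solutions of the system with friction -/

/-- Test functions on `[0,∞) × Ω`: restrictions of smooth functions, of compact support in time
and (on the whole space) in space, periodic on the torus. -/
structure IsTestFunction {V : Type*} [NormedAddCommGroup V] [NormedSpace ℝ V]
    (D : Domain) (ψ : ℝ → E3 → V) : Prop where
  smooth : ContDiff ℝ ∞ (fun p : ℝ × E3 => ψ p.1 p.2)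
  time_support : ∃ R : ℝ, ∀ t, R ≤ t → ∀ x, ψ t x = 0
  space_support : match D with
    | .space => ∃ R : ℝ, ∀ t x, R ≤ ‖x‖ → ψ t x = 0
    | .torus ℓ hℓ => ∀ t, (Domain.torus ℓ hℓ).IsFunctionOn (ψ t)

/-- The total energy density `∑ᵢ (F_i(ρ_i,∇ρ_i) + ½ ρ_i |v_i|²)`; `q_i` stands for `∇ρ_i`. -/
def energyDensity {n : ℕ} (h c : Fin n → ℝ → ℝ) (ρ : Fin n → ℝ → E3 → ℝ)
    (q v : Fin n → ℝ → E3 → E3) (t : ℝ) (x : E3) : ℝ :=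
  ∑ i, (energyF (h i) (c i) (ρ i t x) (q i t x) + 1 / 2 * ρ i t x * ‖v i t x‖ ^ 2)

/-- The total energy at time `t`. -/
def totalEnergy {n : ℕ} (D : Domain) (h c : Fin n → ℝ → ℝ) (ρ : Fin n → ℝ → E3 → ℝ)
    (q v : Fin n → ℝ → E3 → E3) (t : ℝ) : ℝ :=
  ∫ x in D.cell, energyDensity h c ρ q v t x

/-- The friction force `∑ⱼ b_ij ρ_i ρ_j (v_i - v_j)` on component `i` (without the factor `-1/ε`). -/
def frictionForce {n : ℕ} (b : Fin n → Fin n → ℝ) (ρ : Fin n → ℝ → E3 → ℝ)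
    (v : Fin n → ℝ → E3 → E3) (i : Fin n) (t : ℝ) (x : E3) : E3 :=
  ∑ j, (b i j * ρ i t x * ρ j t x) • (v i t x - v j t x)

/-- The frictional dissipation density `∑ᵢⱼ b_ij ρ_i ρ_j |v_i - v_j|²`. -/
def dissipation {n : ℕ} (b : Fin n → Fin n → ℝ) (ρ : Fin n → ℝ → E3 → ℝ)
    (v : Fin n → ℝ → E3 → E3) (t : ℝ) (x : E3) : ℝ :=
  ∑ i, ∑ j, b i j * ρ i t x * ρ j t x * ‖v i t x - v j t x‖ ^ 2

/-- `(ρ, v)` is a weak solution of the Euler-Korteweg system with friction, with parameter `ε`;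
`q i t` is the (weak) gradient of `ρ i t`. -/
structure IsWeakSolution {n : ℕ} (D : Domain) (b : Fin n → Fin n → ℝ) (h c : Fin n → ℝ → ℝ)
    (ε : ℝ) (ρ : Fin n → ℝ → E3 → ℝ) (q v : Fin n → ℝ → E3 → E3) : Prop where
  on_domain : ∀ i t, 0 ≤ t →
    D.IsFunctionOn (ρ i t) ∧ D.IsFunctionOn (q i t) ∧ D.IsFunctionOn (v i t)
  measurable_density : ∀ i, AEStronglyMeasurable (fun p : ℝ × E3 => ρ i p.1 p.2)
    (volume.restrict (Ici 0 ×ˢ univ))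
  measurable_gradient : ∀ i, AEStronglyMeasurable (fun p : ℝ × E3 => q i p.1 p.2)
    (volume.restrict (Ici 0 ×ˢ univ))
  measurable_velocity : ∀ i, AEStronglyMeasurable (fun p : ℝ × E3 => v i p.1 p.2)
    (volume.restrict (Ici 0 ×ˢ univ))
  gradient_eq : ∀ i t, 0 ≤ t → HasWeakGradient D (ρ i t) (q i t)
  density_nonneg : ∀ i t, 0 ≤ t → ∀ᵐ x, 0 ≤ ρ i t x
  density_cont : ∀ i, ContinuousInL1 D (ρ i)
  momentum_cont : ∀ i, ContinuousInL1 D (fun t x => ρ i t x • v i t x)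
  convection_loc : ∀ i k j, LocL1 (fun t x => ρ i t x * tensorSq (v i t x) k j)
  stressH_loc : ∀ i k j, LocL1 (fun t x => stressH (c i) (ρ i t x) (q i t x) k j)
  stressS_loc : ∀ i, LocL1 (fun t x => stressS (h i) (c i) (ρ i t x) (q i t x))
  stressR_loc : ∀ i, LocL1 (fun t x => stressR (c i) (ρ i t x) (q i t x))
  friction_loc : ∀ i, LocL1 (frictionForce b ρ v i)
  mass : ∀ i, ∀ ψ : ℝ → E3 → ℝ, IsTestFunction D ψ →
    (-∫ t in Ioi 0, ∫ x in D.cell,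
        (ρ i t x * deriv (fun s => ψ s x) t
          + inner ℝ (ρ i t x • v i t x) (gradient (ψ t) x)))
      = ∫ x in D.cell, ρ i 0 x * ψ 0 x
  momentum : ∀ i, ∀ φ : ℝ → E3 → E3, IsTestFunction D φ →
    (-∫ t in Ioi 0, ∫ x in D.cell,
        (inner ℝ (ρ i t x • v i t x) (deriv (fun s => φ s x) t)
          + contractGrad (ρ i t x • tensorSq (v i t x)) (φ t) x
          + stressS (h i) (c i) (ρ i t x) (q i t x) * divergence (φ t) x
          + inner ℝ (stressR (c i) (ρ i t x) (q i t x)) (gradient (divergence (φ t)) x)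
          + contractGrad (stressH (c i) (ρ i t x) (q i t x)) (φ t) x))
      = (∫ x in D.cell, inner ℝ (ρ i 0 x • v i 0 x) (φ 0 x))
        - 1 / ε * ∫ t in Ioi 0, ∫ x in D.cell, inner ℝ (frictionForce b ρ v i t x) (φ t x)

/-- A dissipative weak solution: the total energy density is in `C⁰([0,∞); L¹)` and the
integrated energy inequality holds for all nonnegative Lipschitz `θ` of compact support
in `[0,∞)`. -/
structure IsDissipativeWeakSolution {n : ℕ} (D : Domain) (b : Fin n → Fin n → ℝ)
    (h c : Fin n → ℝ → ℝ) (ε : ℝ) (ρ : Fin n → ℝ → E3 → ℝ) (q v : Fin n → ℝ → E3 → E3) : Prop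
    extends IsWeakSolution D b h c ε ρ q v where
  energy_cont : ContinuousInL1 D (energyDensity h c ρ q v)
  dissipation_integrable : ∀ R : ℝ,
    IntegrableOn (fun p : ℝ × E3 => dissipation b ρ v p.1 p.2) (Icc 0 R ×ˢ D.cell)
  energy_ineq : ∀ θ : ℝ → ℝ, (∃ L, LipschitzWith L θ) → (∀ t, 0 ≤ θ t) →
    (∃ R : ℝ, ∀ t, R ≤ t → θ t = 0) →
    (-∫ t in Ioi 0, totalEnergy D h c ρ q v t * deriv θ t)
        + 1 / (2 * ε) * ∫ t in Ioi 0, ∫ x in D.cell, dissipation b ρ v t x * θ t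
      ≤ totalEnergy D h c ρ q v 0 * θ 0

/-- Total mass and total energy are bounded by `M` on `(0,T)`. -/
def FiniteMassEnergy {n : ℕ} (D : Domain) (h c : Fin n → ℝ → ℝ) (T M : ℝ)
    (ρ : Fin n → ℝ → E3 → ℝ) (q v : Fin n → ℝ → E3 → E3) : Prop :=
  ∀ t ∈ Ioo 0 T, (∫ x in D.cell, ∑ i, ρ i t x) ≤ M ∧ totalEnergy D h c ρ q v t ≤ M

/-- The densities take values in `[κ, K]` on `(0,T)`. -/
def DensityBounds {n : ℕ} (T κ K : ℝ) (ρ : Fin n → ℝ → E3 → ℝ) : Prop :=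
  ∀ i, ∀ t ∈ Ioo 0 T, ∀ᵐ x, κ ≤ ρ i t x ∧ ρ i t x ≤ K

/-! ### The limit system -/

/-- `(ρb_1, …, ρb_n, w)` is a smooth solution on `[0,T)` of
`∂ₜρb_i + div(ρb_i w) = 0`, `∂ₜ(ρtot w) + div(ρtot w ⊗ w) = div (∑ᵢ S_i(ρb_i))`,
`ρtot = ∑ᵢ ρb_i`. -/
structure IsSmoothLimitSolution {n : ℕ} (D : Domain) (h c : Fin n → ℝ → ℝ) (T : ℝ)
    (ρb : Fin n → ℝ → E3 → ℝ) (w : ℝ → E3 → E3) : Prop where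
  on_domain_density : ∀ i, ∀ t ∈ Ico 0 T, D.IsFunctionOn (ρb i t)
  on_domain_velocity : ∀ t ∈ Ico 0 T, D.IsFunctionOn (w t)
  smooth_density : ∀ i, ContDiffOn ℝ ∞ (fun p : ℝ × E3 => ρb i p.1 p.2) (Ico 0 T ×ˢ univ)
  smooth_velocity : ContDiffOn ℝ ∞ (fun p : ℝ × E3 => w p.1 p.2) (Ico 0 T ×ˢ univ)
  mass : ∀ i, ∀ t ∈ Ioo 0 T, ∀ x,
    deriv (fun s => ρb i s x) t + divergence (fun y => ρb i t y • w t y) x = 0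
  momentum : ∀ t ∈ Ioo 0 T, ∀ x, ∀ k : Fin 3,
    deriv (fun s => (∑ i, ρb i s x) * w s x k) t
        + ∑ j : Fin 3, pderiv j (fun y => (∑ i, ρb i t y) * w t y k * w t y j) x
      = ∑ j : Fin 3, pderiv j (fun y => (∑ i, stressTensor (h i) (c i) (ρb i t) y) k j) x

/-- With `u = (ρb_1, …, ρb_n, ρtot w)`: `u`, `∂ₜu`, `∇u`, `D²u` and all `D³ρb_i` are bounded
on `(0,T) × Ω`. -/
def LimitBounds {n : ℕ} (T : ℝ) (ρb : Fin n → ℝ → E3 → ℝ) (w : ℝ → E3 → E3) : Prop :=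
  ∃ B : ℝ, ∀ t ∈ Ioo 0 T, ∀ x,
    (∀ i, |deriv (fun s => ρb i s x) t| ≤ B ∧
      ∀ m : ℕ, m ≤ 3 → ‖iteratedFDeriv ℝ m (ρb i t) x‖ ≤ B) ∧
    ‖deriv (fun s => (∑ i, ρb i s x) • w s x) t‖ ≤ B ∧
    ∀ m : ℕ, m ≤ 2 → ‖iteratedFDeriv ℝ m (fun y => (∑ i, ρb i t y) • w t y) x‖ ≤ B

/-- The quantity `χ(t)`, with values in `[0,∞]`:
`∫ ∑ᵢ (½ ρ_i |v_i - w|² + (ρ_i - ρb_i)² + |c_i(ρ_i) ∇ρ_i - c_i(ρb_i) ∇ρb_i|² / (2 c_i(ρ_i))) dx`. -/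
def chi {n : ℕ} (D : Domain) (c : Fin n → ℝ → ℝ)
    (ρ : Fin n → ℝ → E3 → ℝ) (q v : Fin n → ℝ → E3 → E3)
    (ρb : Fin n → ℝ → E3 → ℝ) (w : ℝ → E3 → E3) (t : ℝ) : ℝ≥0∞ :=
  ∫⁻ x in D.cell, ENNReal.ofReal (∑ i,
    (1 / 2 * ρ i t x * ‖v i t x - w t x‖ ^ 2
      + (ρ i t x - ρb i t x) ^ 2
      + 1 / (2 * c i (ρ i t x))
          * ‖c i (ρ i t x) • q i t x - c i (ρb i t x) • gradient (ρb i t) x‖ ^ 2))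

end EulerKorteweg

end

open EulerKorteweg

noncomputable section

namespace EulerKorteweg

/-! ### Mollification of `C¹` functions -/

/-! The proof is the relative energy method. Write `f_i` for the limit densities, `w` for the limit
velocity, and let `μ_i = h_i'(f_i) - ½ c_i'(f_i) |∇f_i|² - c_i(f_i) Δf_i` be the chemical
potentials. The relative energy is the energy of the weak solution minus its first order expansion
at the limit solution. Since `μ_i = h_i' + ½ c_i' |∇f_i|² - div (c_i ∇f_i)`, integrating by parts
against the weak gradient turns its integral into that of `½ ρ_i |v_i - w|²` plus the Bregman
distance of `F_i`. Completing the square splits this distance into the Bregman distance of `h_i`,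
the capillary square occurring in `χ`, and a nonnegative multiple of the amount by which `1/c_i`
lies below its tangent. The condition `c c'' ≥ 2 c'²` says exactly that `1/c` is concave, and `h'' ≥
α` makes the first part coercive. Hence the relative energy is comparable to `χ`
(`relativePotential_eq`, `exists_relativeEnergy_comparison`).

To bound its growth, combine the energy inequality, the mass equations tested with `μ_i - ½ |w|²`
and the sum of the momentum equations tested with `w`
(`IsDissipativeWeakSolution.relativeEnergy_cutoff`). By symmetry of `b` the friction forces cancel
in that sum, so friction survives only as the good term `-1/(2ε)` times the dissipation. A pointwise
identity (`component_identity`) rewrites the rest, up to terms of zero integral, as three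
contributions. The convective one is quadratic in `v_i - w`, and the second order Taylor remainder
of the stress power is quadratic in the differences of densities and gradients; both are bounded by
`χ`. The third is `-∑ ρ_i (v_i - w) · R_i` with the defect `R_i = ∂ₜw + (w·∇)w + ∇μ_i`.

The defects need not vanish, but `div S_i = -f_i ∇μ_i` and the limit momentum equation give `∑ f_i
R_i = 0`. Therefore the last term equals `-∑ ρ_i (v_i - v_{i₀}) · R_i - ∑ (ρ_i - f_i) (v_{i₀} - w) ·
R_i` for any fixed component `i₀`. The second sum is bounded by `χ`. In the first, the null space
hypothesis makes the dissipation control all differences `v_i - v_{i₀}`, and Young's inequality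
absorbs the sum into the dissipation at the price `Cε` (`exists_friction_coercivity`,
`exists_friction_estimate`). This is the source of the `ε` in the theorem.

Together these facts give `E' ≤ C E + C ε` in the sense of distributions on `(0,T)`. As `E` is
continuous up to time zero, a distributional Gronwall lemma concludes (`exists_rate_estimate`,
`le_exp_mul_of_distributional`). Mollification enters because `h_i` and `c_i` have limited
regularity: the test functions built from them are used as `C¹` functions only, while the weak
formulations allow smooth ones. On the whole space with `n ≥ 1` no solution satisfies the density
bounds, so the analysis takes place on the torus. -/

theorem hasFDerivAt_normed_convolution {E : Type*} [NormedAddCommGroup E] [NormedSpace ℝ E]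
    [FiniteDimensional ℝ E] [MeasurableSpace E] [BorelSpace E] (μ : Measure E)
    [μ.IsAddHaarMeasure] (φ : ContDiffBump (0 : E)) {f : E → ℝ} (hf : ContDiff ℝ 1 f) (x₀ : E) :
    HasFDerivAt (fun x => ∫ y, φ.normed μ y • f (x - y) ∂μ)
      (∫ y, φ.normed μ y • fderiv ℝ f (x₀ - y) ∂μ) x₀ := by
  have hcont : Continuous (fderiv ℝ f) := hf.continuous_fderiv one_ne_zero
  have hφ : Continuous (φ.normed μ) := φ.continuous_normed
  have hcs : HasCompactSupport (φ.normed μ) := φ.hasCompactSupport_normed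
  obtain ⟨M, hM⟩ := (isCompact_closedBall x₀ (1 + φ.rOut)).exists_bound_of_continuousOn
    hcont.continuousOn
  refine hasFDerivAt_integral_of_dominated_of_fderiv_le (s := Metric.ball x₀ 1)
    (bound := fun y => φ.normed μ y * M)
    (F' := fun x y => φ.normed μ y • fderiv ℝ f (x - y))
    (Metric.ball_mem_nhds x₀ one_pos) ?_ ?_ ?_ ?_ ?_ ?_
  · refine Eventually.of_forall fun x => Continuous.aestronglyMeasurable ?_
    exact hφ.smul (hf.continuous.comp (continuous_const.sub continuous_id))
  · refine Continuous.integrable_of_hasCompactSupport ?_ ?_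
    · exact hφ.smul (hf.continuous.comp (continuous_const.sub continuous_id))
    · exact hcs.smul_right
  · refine Continuous.aestronglyMeasurable ?_
    exact hφ.smul (hcont.comp (continuous_const.sub continuous_id))
  · refine Eventually.of_forall fun y x hx => ?_
    rw [norm_smul, Real.norm_of_nonneg (φ.nonneg_normed y)]
    -- Only `y` in the support of the bump contributes, and then `x - y` stays in the ball of radius
    -- `1 + rOut` about `x₀` on which `M` bounds the derivative.
    by_cases hy : y ∈ Metric.ball (0 : E) φ.rOut
    · refine mul_le_mul_of_nonneg_left (hM _ ?_) (φ.nonneg_normed y)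
      rw [mem_closedBall_iff_norm]
      have h1 : ‖x - x₀‖ < 1 := by simpa [dist_eq_norm] using hx
      have h2 : ‖y‖ < φ.rOut := by simpa using hy
      calc ‖x - y - x₀‖ = ‖(x - x₀) - y‖ := by congr 1; abel
        _ ≤ ‖x - x₀‖ + ‖y‖ := norm_sub_le _ _
        _ ≤ 1 + φ.rOut := by linarith
    · have : φ.normed μ y = 0 := by
        rw [← Function.notMem_support, φ.support_normed_eq]; exact hy
      simp [this]
  · exact φ.integrable_normed.mul_const M
  · refine Eventually.of_forall fun y x _ => ?_
    have h1 : HasFDerivAt f (fderiv ℝ f (x - y)) (x - y) :=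
      (hf.differentiable one_ne_zero _).hasFDerivAt
    have h2 : HasFDerivAt (fun x => f (x - y)) (fderiv ℝ f (x - y)) x :=
      h1.comp x ((hasFDerivAt_id x).sub_const y)
    exact h2.const_smul (φ.normed μ y)

theorem norm_normed_convolution_le {E V : Type*} [NormedAddCommGroup E] [NormedSpace ℝ E]
    [FiniteDimensional ℝ E] [MeasurableSpace E] [BorelSpace E] (μ : Measure E)
    [μ.IsAddHaarMeasure] [NormedAddCommGroup V] [NormedSpace ℝ V] (φ : ContDiffBump (0 : E))
    {g : E → V} {C : ℝ} (hC : ∀ x, ‖g x‖ ≤ C) (x : E) :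
    ‖∫ y, φ.normed μ y • g (x - y) ∂μ‖ ≤ C := by
  calc ‖∫ y, φ.normed μ y • g (x - y) ∂μ‖
      ≤ ∫ y, φ.normed μ y * C ∂μ := by
        refine norm_integral_le_of_norm_le (φ.integrable_normed.mul_const C) ?_
        refine Eventually.of_forall fun y => ?_
        rw [norm_smul, Real.norm_of_nonneg (φ.nonneg_normed y)]
        exact mul_le_mul_of_nonneg_left (hC _) (φ.nonneg_normed y)
    _ = C := by rw [integral_mul_const, φ.integral_normed, one_mul]

/-- A `C¹` function is a limit of smooth functions, with convergence of the derivative; bounds,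
periods and, up to a small enlargement, the support are preserved. -/
theorem exists_smooth_approximation {E : Type*} [NormedAddCommGroup E] [NormedSpace ℝ E]
    [FiniteDimensional ℝ E] [MeasurableSpace E] [BorelSpace E] (μ : Measure E)
    [μ.IsAddHaarMeasure] {f : E → ℝ} (hf : ContDiff ℝ 1 f) :
    ∃ F : ℕ → E → ℝ, (∀ n, ContDiff ℝ ∞ (F n)) ∧
      (∀ x, Tendsto (fun n => F n x) atTop (𝓝 (f x))) ∧
      (∀ x, Tendsto (fun n => fderiv ℝ (F n) x) atTop (𝓝 (fderiv ℝ f x))) ∧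
      (∀ C, (∀ x, ‖f x‖ ≤ C) → ∀ n x, ‖F n x‖ ≤ C) ∧
      (∀ C, (∀ x, ‖fderiv ℝ f x‖ ≤ C) → ∀ n x, ‖fderiv ℝ (F n) x‖ ≤ C) ∧
      (∀ v, (∀ x, f (x + v) = f x) → ∀ n x, F n (x + v) = F n x) ∧
      (∀ (n : ℕ) x, (∀ y, ‖y‖ < 1 / ((n : ℝ) + 1) → f (x - y) = 0) → F n x = 0) := by
  -- The outer radius is the `1 / (n + 1)` of the support statement; any smaller inner radius would
  -- do.
  let φ : ℕ → ContDiffBump (0 : E) := fun n =>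
    ⟨1 / (2 * ((n : ℝ) + 1)), 1 / ((n : ℝ) + 1), by positivity, by
      apply one_div_lt_one_div_of_lt <;> [positivity; linarith [n.cast_nonneg (α := ℝ)]]⟩
  have hφr : Tendsto (fun n => (φ n).rOut) atTop (𝓝 0) := tendsto_one_div_add_atTop_nhds_zero_nat
  have hcont : Continuous (fderiv ℝ f) := hf.continuous_fderiv one_ne_zero
  have hder : ∀ n x, fderiv ℝ (fun x => ∫ y, (φ n).normed μ y • f (x - y) ∂μ) x
      = ∫ y, (φ n).normed μ y • fderiv ℝ f (x - y) ∂μ := fun n x =>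
    (hasFDerivAt_normed_convolution μ (φ n) hf x).fderiv
  refine ⟨fun n x => ∫ y, (φ n).normed μ y • f (x - y) ∂μ, ?_, ?_, ?_, ?_, ?_, ?_, ?_⟩
  · intro n
    exact (φ n).hasCompactSupport_normed.contDiff_convolution_left
      (ContinuousLinearMap.lsmul ℝ ℝ) (n := ⊤) (φ n).contDiff_normed hf.continuous.locallyIntegrable
  · exact fun x => ContDiffBump.convolution_tendsto_right_of_continuous hφr hf.continuous x
  · intro x
    simp_rw [hder]
    exact ContDiffBump.convolution_tendsto_right_of_continuous hφr hcont x
  · exact fun C hC n x => norm_normed_convolution_le μ (φ n) hC x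
  · intro C hC n x
    rw [hder]
    exact norm_normed_convolution_le μ (φ n) hC x
  · intro v hv n x
    refine integral_congr_ae (Eventually.of_forall fun y => ?_)
    have : x + v - y = x - y + v := by abel
    simp only [this, hv]
  · intro n x hx
    refine integral_eq_zero_of_ae (Eventually.of_forall fun y => ?_)
    by_cases hy : ‖y‖ < 1 / ((n : ℝ) + 1)
    · simp [hx y hy]
    · have : (φ n).normed μ y = 0 := by
        rw [← Function.notMem_support, (φ n).support_normed_eq]
        simpa [φ] using hy
      simp [this]

/-! ### Integration over a periodicity cell -/

theorem cell_eq_preimage (ℓ : ℝ) (hℓ : 0 < ℓ) :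
    (Domain.torus ℓ hℓ).cell
      = (WithLp.ofLp : E3 → Fin 3 → ℝ) ⁻¹' (pi univ fun _ => Ico 0 ℓ) := by
  ext x; simp [Domain.cell]

theorem measurableSet_cell (D : Domain) : MeasurableSet D.cell := by
  cases D with
  | space => exact MeasurableSet.univ
  | torus ℓ hℓ =>
    rw [cell_eq_preimage]
    exact (MeasurableSet.univ_pi fun _ => measurableSet_Ico).preimage
      (PiLp.volume_preserving_ofLp (Fin 3)).measurable

/-- The closed periodicity cell. -/
def closedCell (ℓ : ℝ) : Set E3 := {x | ∀ k, x k ∈ Icc 0 ℓ}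

theorem isCompact_closedCell (ℓ : ℝ) : IsCompact (closedCell ℓ) := by
  have h : closedCell ℓ
      = (PiLp.homeomorph 2 (fun _ : Fin 3 => ℝ)) ⁻¹' (pi univ fun _ => Icc 0 ℓ) := by
    ext x; simp [closedCell, PiLp.homeomorph, Pi.le_def, forall_and]
  rw [h, Homeomorph.isCompact_preimage]
  exact isCompact_univ_pi fun _ => isCompact_Icc

theorem cell_subset_closedCell (ℓ : ℝ) (hℓ : 0 < ℓ) :
    (Domain.torus ℓ hℓ).cell ⊆ closedCell ℓ := fun _ hx k => Ico_subset_Icc_self (hx k)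

theorem volume_cell_lt_top (ℓ : ℝ) (hℓ : 0 < ℓ) : volume (Domain.torus ℓ hℓ).cell < (⊤ : ℝ≥0∞) :=
  (measure_mono (cell_subset_closedCell ℓ hℓ)).trans_lt (isCompact_closedCell ℓ).measure_lt_top

theorem integrableOn_cell_of_continuous {V : Type*} [NormedAddCommGroup V] {ℓ : ℝ} (hℓ : 0 < ℓ)
    {f : E3 → V} (hf : Continuous f) : IntegrableOn f (Domain.torus ℓ hℓ).cell :=
  (hf.continuousOn.integrableOn_compact (isCompact_closedCell ℓ)).mono_set
    (cell_subset_closedCell ℓ hℓ)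

/-- The half-open cell and the closed box differ by a null set. This form is the one to which the
divergence theorem applies. -/
theorem integral_cell_eq_integral_Icc {ℓ : ℝ} (hℓ : 0 < ℓ) (f : E3 → ℝ) :
    ∫ x in (Domain.torus ℓ hℓ).cell, f x
      = ∫ y in Icc (fun _ => 0 : Fin 3 → ℝ) (fun _ => ℓ), f (WithLp.toLp 2 y) := by
  rw [cell_eq_preimage]
  have h := (PiLp.volume_preserving_ofLp (Fin 3)).setIntegral_preimage_emb
    (MeasurableEquiv.toLp 2 (Fin 3 → ℝ)).symm.measurableEmbedding
    (fun y => f (WithLp.toLp 2 y)) (pi univ fun _ => Ico 0 ℓ)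
  rw [volume_pi, ← setIntegral_congr_set Measure.univ_pi_Ico_ae_eq_Icc, ← volume_pi]
  exact h

/-- The divergence theorem for the field whose only nonzero component is the `k`-th, equal to `f`:
periodicity makes the two opposite faces cancel. All smooth fluxes are discarded through this lemma.
-/
theorem integral_cell_pderiv_eq_zero {ℓ : ℝ} (hℓ : 0 < ℓ) {f : E3 → ℝ} (hf : ContDiff ℝ 1 f)
    (hper : (Domain.torus ℓ hℓ).IsFunctionOn f) (k : Fin 3) :
    ∫ x in (Domain.torus ℓ hℓ).cell, pderiv k f x = 0 := by
  rw [integral_cell_eq_integral_Icc]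
  let e : (Fin 3 → ℝ) ≃L[ℝ] E3 := (EuclideanSpace.equiv (Fin 3) ℝ).symm
  have he : ∀ y, e y = WithLp.toLp 2 y := fun y => rfl
  let g : Fin 3 → (Fin 3 → ℝ) → ℝ := fun i y => if i = k then f (WithLp.toLp 2 y) else 0
  let g' : Fin 3 → (Fin 3 → ℝ) → (Fin 3 → ℝ) →L[ℝ] ℝ := fun i y =>
    if i = k then (fderiv ℝ f (WithLp.toLp 2 y)).comp (e : (Fin 3 → ℝ) →L[ℝ] E3) else 0
  have hg : ∀ i y, HasFDerivAt (g i) (g' i y) y := by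
    intro i y
    by_cases hi : i = k
    · simp only [g, g', hi, if_true]
      exact HasFDerivAt.comp y (hf.differentiable one_ne_zero _).hasFDerivAt e.hasFDerivAt
    · simp only [g, g', hi, if_false]
      exact hasFDerivAt_const _ _
  have hsum : ∀ y, ∑ i, g' i y (Pi.single i 1) = pderiv k f (WithLp.toLp 2 y) := by
    intro y
    rw [Finset.sum_eq_single k]
    · simp only [g', if_true, pderiv]
      rfl
    · intro i _ hi
      simp [g', hi]
    · simp
  have hdiv := integral_divergence_of_hasFDerivAt_off_countable' (E := ℝ)
    (fun _ => 0 : Fin 3 → ℝ) (fun _ => ℓ) (fun _ => hℓ.le) g g' ∅ countable_empty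
    (fun i => (continuous_iff_continuousAt.2 fun y => (hg i y).continuousAt).continuousOn)
    (fun y _ i => hg i y) ?_
  · simp_rw [hsum] at hdiv
    rw [hdiv]
    refine Finset.sum_eq_zero fun i _ => ?_
    rw [sub_eq_zero]
    refine setIntegral_congr_fun measurableSet_Icc fun y _ => ?_
    by_cases hi : i = k
    · subst hi
      simp only [g, if_true]
      -- The point with `i`-th coordinate `ℓ` is the point with `i`-th coordinate `0` shifted by one
      -- period.
      rw [← hper i (WithLp.toLp 2 (i.insertNth 0 y))]
      congr 1
      ext j
      by_cases hj : j = i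
      · subst hj; simp
      · obtain ⟨j', rfl⟩ := Fin.exists_succAbove_eq hj
        simp
    · simp [g, hi]
  · simp_rw [hsum]
    refine Continuous.integrableOn_Icc ?_
    unfold pderiv
    exact ((hf.continuous_fderiv one_ne_zero).comp e.continuous).clm_apply continuous_const

/-! ### Functions of one variable -/

/-- A convex function lies above its tangents. It serves for `h - α/2 y²` and for `-1/c`, which are
convex by the two structural inequalities. -/
theorem add_deriv_mul_sub_le_of_deriv2_nonneg {f : ℝ → ℝ} (hf : ContDiffOn ℝ 2 f (Ioi 0))
    (h2 : ∀ x, 0 < x → 0 ≤ deriv (deriv f) x) {x y : ℝ} (hx : 0 < x) (hy : 0 < y) :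
    f y + deriv f y * (x - y) ≤ f x := by
  have hd : DifferentiableOn ℝ f (Ioi 0) := hf.differentiableOn (by norm_num)
  have hd' : DifferentiableOn ℝ (deriv f) (Ioi 0) :=
    (hf.deriv_of_isOpen isOpen_Ioi (m := 1) (by norm_num)).differentiableOn (by norm_num)
  have hc : ConvexOn ℝ (Ioi 0) f :=
    convexOn_of_deriv2_nonneg' (convex_Ioi 0) hd hd' fun x hx => h2 x hx
  have hder : HasDerivAt f (deriv f y) y := (hd.differentiableAt (Ioi_mem_nhds hy)).hasDerivAt
  rcases lt_trichotomy x y with h | h | h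
  · have := hc.slope_le_of_hasDerivAt (mem_Ioi.2 hx) (mem_Ioi.2 hy) h hder
    rw [slope_def_field, div_le_iff₀ (by linarith)] at this
    linarith
  · simp [h]
  · have := hc.le_slope_of_hasDerivAt (mem_Ioi.2 hy) (mem_Ioi.2 hx) h hder
    rw [slope_def_field, le_div_iff₀ (by linarith)] at this
    linarith

/-- Two mean value estimates: the second is for `z ↦ f z - f'(y) (z - y)`, whose derivative `f' z -
f' y` is at most a constant times `|x - y|` between `y` and `x`. A common constant keeps later
bookkeeping short. -/
theorem exists_taylor_bound {f : ℝ → ℝ} (hf : ContDiffOn ℝ 2 f (Ioi 0)) {κ : ℝ} (hκ : 0 < κ)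
    (K : ℝ) : ∃ C : ℝ, 0 ≤ C ∧ ∀ x ∈ Icc κ K, ∀ y ∈ Icc κ K,
      |f x - f y| ≤ C * |x - y| ∧ |f x - f y - deriv f y * (x - y)| ≤ C * (x - y) ^ 2 := by
  have hsub : Icc κ K ⊆ Ioi 0 := fun x hx => hκ.trans_le hx.1
  have hd : DifferentiableOn ℝ f (Ioi 0) := hf.differentiableOn (by norm_num)
  have hf1 : ContDiffOn ℝ 1 (deriv f) (Ioi 0) := hf.deriv_of_isOpen isOpen_Ioi (by norm_num)
  have hf2 : ContDiffOn ℝ 0 (deriv (deriv f)) (Ioi 0) :=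
    hf1.deriv_of_isOpen isOpen_Ioi (by norm_num)
  have hd' : DifferentiableOn ℝ (deriv f) (Ioi 0) := hf1.differentiableOn (by norm_num)
  obtain ⟨C₁, hC₁⟩ := (isCompact_Icc (a := κ) (b := K)).exists_bound_of_continuousOn
    (hf1.continuousOn.mono hsub)
  obtain ⟨C₂, hC₂⟩ := (isCompact_Icc (a := κ) (b := K)).exists_bound_of_continuousOn
    (hf2.continuousOn.mono hsub)
  have hat : ∀ x ∈ Icc κ K, DifferentiableAt ℝ f x := fun x hx =>
    hd.differentiableAt (Ioi_mem_nhds (hsub hx))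
  have hat' : ∀ x ∈ Icc κ K, DifferentiableAt ℝ (deriv f) x := fun x hx =>
    hd'.differentiableAt (Ioi_mem_nhds (hsub hx))
  refine ⟨max (max C₁ C₂) 0, le_max_right _ _, fun x hx y hy => ⟨?_, ?_⟩⟩
  · refine ((convex_Icc κ K).norm_image_sub_le_of_norm_deriv_le hat hC₁ hy hx).trans ?_
    exact mul_le_mul_of_nonneg_right ((le_max_left _ _).trans (le_max_left _ _)) (norm_nonneg _)
  · have huy : uIcc y x ⊆ Icc κ K := (ordConnected_Icc.uIcc_subset hy hx)
    have hg : ∀ z, HasDerivAt (fun z => deriv f y * (z - y)) (deriv f y) z := fun z => by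
      simpa using ((hasDerivAt_id z).sub_const y).const_mul (deriv f y)
    have hder : ∀ z ∈ uIcc y x,
        HasDerivAt (fun z => f z - deriv f y * (z - y)) (deriv f z - deriv f y) z := fun z hz =>
      (hat z (huy hz)).hasDerivAt.sub (hg z)
    have hbd : ∀ z ∈ uIcc y x,
        ‖deriv (fun z => f z - deriv f y * (z - y)) z‖ ≤ max (max C₁ C₂) 0 * |x - y| := by
      intro z hz
      rw [(hder z hz).deriv]
      refine ((convex_Icc κ K).norm_image_sub_le_of_norm_deriv_le hat' hC₂ hy (huy hz)).trans ?_
      rw [Real.norm_eq_abs]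
      refine mul_le_mul ((le_max_right _ _).trans (le_max_left _ _)) ?_ (abs_nonneg _)
        (le_max_right _ _)
      have := abs_sub_left_of_mem_uIcc hz
      simpa using this
    have := (convex_uIcc y x).norm_image_sub_le_of_norm_deriv_le
      (fun z hz => (hder z hz).differentiableAt) hbd left_mem_uIcc right_mem_uIcc
    rw [Real.norm_eq_abs, Real.norm_eq_abs] at this
    calc |f x - f y - deriv f y * (x - y)|
        = |f x - deriv f y * (x - y) - (f y - deriv f y * (y - y))| := by congr 1; ring
      _ ≤ _ := this
      _ = _ := by rw [mul_assoc, abs_mul_abs_self, sq]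

/-- A continuous function on `[0,T)` whose distributional derivative on `(0,T)` is nonpositive
does not exceed its initial value. -/
theorem le_initial_of_distributional_deriv_nonpos {f : ℝ → ℝ} {T : ℝ}
    (hf : ContinuousOn f (Ico 0 T))
    (H : ∀ θ : ℝ → ℝ, ContDiff ℝ ∞ θ → (∀ t, 0 ≤ θ t) → ∀ a b, 0 < a → b < T →
      (∀ t, t ∉ Icc a b → θ t = 0) → 0 ≤ ∫ t in Icc a b, deriv θ t * f t) :
    ∀ t ∈ Ioo 0 T, f t ≤ f 0 := by
  have key : ∀ s t, 0 < s → s < t → t < T → f t ≤ f s := by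
    intro s t hs hst htT
    -- Bumps of radius at most `δ` centred at `s` and at `t` stay inside `(0,T)`.
    set δ : ℝ := min s (T - t) / 2 with hδ
    have hδ0 : 0 < δ := by
      have : 0 < min s (T - t) := lt_min hs (by linarith)
      positivity
    have hδs : δ < s := by
      have : min s (T - t) ≤ s := min_le_left _ _
      have : 0 < min s (T - t) := lt_min hs (by linarith)
      rw [hδ]; linarith
    have hδt : δ < T - t := by
      have : min s (T - t) ≤ T - t := min_le_right _ _
      have : 0 < min s (T - t) := lt_min hs (by linarith)
      rw [hδ]; linarith
    set a := s - δ
    set b := t + δ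
    have ha : 0 < a := by simp only [a]; linarith
    have hb : b < T := by simp only [b]; linarith
    have hab : a ≤ b := by simp only [a, b]; linarith
    have hfab : ContinuousOn f (Icc a b) :=
      hf.mono fun x hx => ⟨ha.le.trans hx.1, hx.2.trans_lt hb⟩
    -- A globally continuous extension, so that convolutions with bumps are defined and converge
    -- everywhere.
    let g : ℝ → ℝ := IccExtend hab ((Icc a b).domRestrict f)
    have hg : Continuous g := Continuous.Icc_extend' hfab.domRestrict
    have hgf : ∀ x ∈ Icc a b, g x = f x := fun x hx => by
      simp [g, IccExtend_of_mem hab _ hx]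
    let φ : ℕ → ContDiffBump (0 : ℝ) := fun n =>
      ⟨δ / (2 * ((n : ℝ) + 1)), δ / ((n : ℝ) + 1), by positivity, by
        apply div_lt_div_of_pos_left hδ0 (by positivity); linarith [n.cast_nonneg (α := ℝ)]⟩
    have hφr : Tendsto (fun n => (φ n).rOut) atTop (𝓝 0) := by
      have := (tendsto_one_div_add_atTop_nhds_zero_nat (𝕜 := ℝ)).const_mul δ
      simpa [φ, div_eq_mul_inv] using this
    have hφδ : ∀ n, (φ n).rOut ≤ δ := fun n =>
      div_le_self hδ0.le (by linarith [n.cast_nonneg (α := ℝ)])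
    have hzero : ∀ n x, δ ≤ |x| → (φ n).normed volume x = 0 := by
      intro n x hx
      rw [← Function.notMem_support, (φ n).support_normed_eq]
      simpa using (hφδ n).trans hx
    have hcφ : ∀ n, Continuous ((φ n).normed volume) := fun n => (φ n).continuous_normed
    -- The mollified indicator function of `[s,t]`. Its derivative is a bump at `s` minus a bump at
    -- `t`, so testing with it yields `f s - f t ≥ 0` in the limit.
    let θ : ℕ → ℝ → ℝ := fun n x => ∫ y in (x - t)..(x - s), (φ n).normed volume y
    have hint : ∀ n u v, IntervalIntegrable ((φ n).normed volume) volume u v := fun n u v =>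
      (hcφ n).intervalIntegrable u v
    have hθd : ∀ n x, HasDerivAt (θ n)
        ((φ n).normed volume (x - s) - (φ n).normed volume (x - t)) x := by
      intro n x
      have h0 : θ n = fun x => (∫ y in (0 : ℝ)..(x - s), (φ n).normed volume y)
          - ∫ y in (0 : ℝ)..(x - t), (φ n).normed volume y := by
        funext x
        exact (intervalIntegral.integral_interval_sub_left (hint n _ _) (hint n _ _)).symm
      rw [h0]
      have h1 : ∀ u z, HasDerivAt (fun x => ∫ y in (0 : ℝ)..(x - u), (φ n).normed volume y)
          ((φ n).normed volume (z - u)) z := by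
        intro u z
        have := (intervalIntegral.integral_hasDerivAt_right (hint n 0 (z - u))
          ((hcφ n).stronglyMeasurableAtFilter _ _) (hcφ n).continuousAt)
        have h2 := this.comp z ((hasDerivAt_id z).sub_const u)
        rw [mul_one] at h2
        exact h2
      exact (h1 s x).sub (h1 t x)
    have hθ' : ∀ n, deriv (θ n) = fun x =>
        (φ n).normed volume (x - s) - (φ n).normed volume (x - t) := fun n =>
      funext fun x => (hθd n x).deriv
    have hφsmooth : ∀ n, ContDiff ℝ ∞ ((φ n).normed volume) := fun n =>
      (φ n).contDiff_normed (n := ⊤)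
    have hθs : ∀ n, ContDiff ℝ ∞ (θ n) := by
      intro n
      rw [contDiff_infty_iff_deriv]
      refine ⟨fun x => (hθd n x).differentiableAt, ?_⟩
      rw [hθ']
      exact ((hφsmooth n).comp (contDiff_id.sub contDiff_const)).sub
        ((hφsmooth n).comp (contDiff_id.sub contDiff_const))
    have hθ0 : ∀ n x, 0 ≤ θ n x := fun n x =>
      intervalIntegral.integral_nonneg (by linarith) fun y _ => (φ n).nonneg_normed y
    have hθz : ∀ n x, x ∉ Icc a b → θ n x = 0 := by
      intro n x hx
      refine intervalIntegral.integral_zero_ae (Eventually.of_forall fun y hy => ?_)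
      rw [uIoc_of_le (by linarith)] at hy
      refine hzero n y ?_
      rw [mem_Icc, not_and_or, not_le, not_le] at hx
      rcases hx with hx | hx
      · have h1 : y ≤ x - s := hy.2
        simp only [a] at hx
        rw [abs_of_neg (by linarith)]; linarith
      · have h1 : x - t < y := hy.1
        simp only [b] at hx
        rw [abs_of_pos (by linarith)]; linarith
    have hlim : ∀ u, Tendsto (fun n => ∫ x, (φ n).normed volume (x - u) * g x) atTop
        (𝓝 (g u)) := by
      intro u
      have := ContDiffBump.convolution_tendsto_right_of_continuous (μ := volume) hφr hg u
      refine this.congr fun n => ?_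
      simp only [convolution, ContinuousLinearMap.lsmul_apply, smul_eq_mul]
      -- The substitution `y ↦ u - y`, followed by the evenness of the bump, turns the convolution
      -- at `u` into an integral against the bump centred at `u`.
      rw [← integral_sub_left_eq_self (fun y => (φ n).normed volume y * g (u - y)) volume u]
      refine integral_congr_ae (Eventually.of_forall fun x => ?_)
      simp only [sub_sub_cancel]
      rw [← (φ n).normed_neg, neg_sub]
    have hI : ∀ n, 0 ≤ (∫ x, (φ n).normed volume (x - s) * g x)
        - ∫ x, (φ n).normed volume (x - t) * g x := by
      intro n
      have h1 : ∀ u, Integrable (fun x => (φ n).normed volume (x - u) * g x) := by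
        intro u
        refine Continuous.integrable_of_hasCompactSupport ?_ ?_
        · exact ((hcφ n).comp (continuous_id.sub continuous_const)).mul hg
        · refine HasCompactSupport.mul_right ?_
          exact (φ n).hasCompactSupport_normed.comp_homeomorph (Homeomorph.subRight u)
      rw [← integral_sub (h1 s) (h1 t)]
      have h2 := H (θ n) (hθs n) (hθ0 n) a b ha hb (hθz n)
      rw [hθ'] at h2
      convert h2 using 1
      rw [← setIntegral_eq_integral_of_forall_compl_eq_zero (s := Icc a b)]
      · refine setIntegral_congr_fun measurableSet_Icc fun x hx => ?_
        simp only [hgf x hx]; ring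
      · intro x hx
        have h3 : (φ n).normed volume (x - s) = 0 ∧ (φ n).normed volume (x - t) = 0 := by
          rw [mem_Icc, not_and_or, not_le, not_le] at hx
          simp only [a, b] at hx
          constructor <;> apply hzero <;> rcases hx with hx | hx
          · rw [abs_of_neg (by linarith)]; linarith
          · rw [abs_of_pos (by linarith)]; linarith
          · rw [abs_of_neg (by linarith)]; linarith
          · rw [abs_of_pos (by linarith)]; linarith
        simp [h3.1, h3.2]
    have hfin : 0 ≤ g s - g t :=
      ge_of_tendsto' ((hlim s).sub (hlim t)) hI
    rw [hgf s ⟨by simp only [a]; linarith, by simp only [b]; linarith⟩,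
      hgf t ⟨by simp only [a]; linarith, by simp only [b]; linarith⟩] at hfin
    linarith
  intro t ht
  have h0 : Tendsto f (𝓝[Ioo 0 T] 0) (𝓝 (f 0)) :=
    (hf 0 ⟨le_rfl, ht.1.trans ht.2⟩).mono_left (nhdsWithin_mono _ Ioo_subset_Ico_self)
  have : (𝓝[Ioo 0 T] (0 : ℝ)).NeBot := by
    rw [nhdsWithin_Ioo_eq_nhdsGT (ht.1.trans ht.2)]; infer_instance
  refine ge_of_tendsto h0 ?_
  have : Iio t ∈ 𝓝 (0 : ℝ) := Iio_mem_nhds ht.1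
  filter_upwards [self_mem_nhdsWithin, mem_nhdsWithin_of_mem_nhds this] with s hs hst
  exact key s t hs.1 hst ht.2

/-! ### Coercivity of the friction -/

/-- The linear map sending `v` to `v i₀` together with all `√(b i j) (v i - v j)` is injective by
the null space hypothesis, hence bounded below, as the dimension is finite. Apply the lower bound to
`v - v i₀`, for which the extra entry vanishes. Vector-valued velocities are treated one coordinate
at a time. -/
theorem exists_friction_coercivity {n : ℕ} {b : Fin n → Fin n → ℝ} (hN : FrictionHypothesis b) :
    ∃ c₀ : ℝ, 0 < c₀ ∧ ∀ (v : Fin n → E3) (i i₀ : Fin n),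
      c₀ * ‖v i - v i₀‖ ^ 2 ≤ ∑ i, ∑ j, b i j * ‖v i - v j‖ ^ 2 := by
  obtain ⟨-, hb, hker⟩ := hN
  have hone : ∀ i₀ : Fin n, ∃ c₀ : ℝ, 0 < c₀ ∧ ∀ (v : Fin n → ℝ) (i : Fin n),
      c₀ * (v i - v i₀) ^ 2 ≤ ∑ i, ∑ j, b i j * (v i - v j) ^ 2 := by
    intro i₀
    let L : (Fin n → ℝ) →ₗ[ℝ] (EuclideanSpace ℝ (Option (Fin n × Fin n))) :=
      { toFun := fun v => WithLp.toLp 2 fun o =>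
          o.elim (v i₀) fun p => √(b p.1 p.2) * (v p.1 - v p.2)
        map_add' := fun u v => by
          ext o; cases o <;> (simp; try ring)
        map_smul' := fun a v => by
          ext o; cases o <;> (simp; try ring) }
    have hL : L.ker = ⊥ := by
      rw [LinearMap.ker_eq_bot']
      intro v hv
      have h0 : v i₀ = 0 := by
        have := congrArg (fun z : EuclideanSpace ℝ (Option (Fin n × Fin n)) => z none) hv
        simpa [L] using this
      have h1 : ∀ i j, b i j * (v i - v j) = 0 := by
        intro i j
        have := congrArg (fun z : EuclideanSpace ℝ (Option (Fin n × Fin n)) => z (some (i, j))) hv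
        have h2 : √(b i j) * (v i - v j) = 0 := by simpa [L] using this
        rw [← Real.mul_self_sqrt (hb i j), mul_assoc, h2, mul_zero]
      -- Unit densities suffice here: the actual densities are later bounded below by `κ`.
      obtain ⟨a, ha⟩ := (hker (fun _ => 1) (fun _ => one_pos) v).1 fun i => by simp [h1]
      funext i
      rw [ha i, ← ha i₀, h0]; rfl
    obtain ⟨K, hK, hanti⟩ := L.exists_antilipschitzWith hL
    refine ⟨((K : ℝ) ^ 2)⁻¹, by positivity, fun v i => ?_⟩
    have h1 := hanti.le_mul_dist (fun i => v i - v i₀) 0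
    rw [map_zero, dist_zero_right, dist_zero_right] at h1
    have h2 : |v i - v i₀| ≤ ‖fun i => v i - v i₀‖ :=
      norm_le_pi_norm (fun i => v i - v i₀) i
    have h3 : ‖L fun i => v i - v i₀‖ ^ 2 = ∑ i, ∑ j, b i j * (v i - v j) ^ 2 := by
      rw [EuclideanSpace.norm_sq_eq, Fintype.sum_option, Fintype.sum_prod_type]
      simp only [L, LinearMap.coe_mk, AddHom.coe_mk, Option.elim, sub_self, norm_zero,
        sub_sub_sub_cancel_right]
      rw [sq (0 : ℝ), zero_mul, zero_add]
      refine Finset.sum_congr rfl fun i _ => Finset.sum_congr rfl fun j _ => ?_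
      rw [Real.norm_eq_abs, sq_abs, mul_pow, Real.sq_sqrt (hb i j)]
    rw [← h3, inv_mul_le_iff₀ (by positivity), ← mul_pow, ← sq_abs]
    exact pow_le_pow_left₀ (abs_nonneg _) (h2.trans h1) 2
  choose c hc hcv using hone
  rcases isEmpty_or_nonempty (Fin n) with hn | hn
  · exact ⟨1, one_pos, fun v i => hn.elim i⟩
  -- The smallest of the finitely many constants works for every reference component.
  obtain ⟨j₀, hj₀⟩ := Finite.exists_min c
  refine ⟨c j₀, hc j₀, fun v i i₀ => ?_⟩
  have hcomp : ∀ k : Fin 3, c j₀ * (v i k - v i₀ k) ^ 2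
      ≤ ∑ i, ∑ j, b i j * (v i k - v j k) ^ 2 := fun k =>
    (mul_le_mul_of_nonneg_right (hj₀ i₀) (sq_nonneg _)).trans (hcv i₀ (fun i => v i k) i)
  have hns : ∀ u : E3, ‖u‖ ^ 2 = ∑ k, u k ^ 2 := fun u => by
    simp [EuclideanSpace.norm_sq_eq]
  simp only [hns, PiLp.sub_apply, Finset.mul_sum]
  calc ∑ k, c j₀ * (v i k - v i₀ k) ^ 2
      ≤ ∑ k, ∑ i, ∑ j, b i j * (v i k - v j k) ^ 2 := Finset.sum_le_sum fun k _ => hcomp k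
    _ = ∑ i, ∑ j, ∑ k, b i j * (v i k - v j k) ^ 2 := by
      rw [Finset.sum_comm]
      exact Finset.sum_congr rfl fun i _ => Finset.sum_comm

/-! ### Periodic functions -/

theorem isFunctionOn_torus_iff {V : Type*} {ℓ : ℝ} {hℓ : 0 < ℓ} {f : E3 → V} :
    (Domain.torus ℓ hℓ).IsFunctionOn f ↔
      ∀ k, Function.Periodic f (EuclideanSpace.single k ℓ) := Iff.rfl

/-- Subtract the integer part of `x k / ℓ` in each coordinate. The representative depends on `x`
only, not on the periodic function. -/
theorem exists_mem_closedCell_eq {V : Type*} {ℓ : ℝ} (hℓ : 0 < ℓ) (x : E3) :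
    ∃ y ∈ closedCell ℓ, ∀ f : E3 → V, (Domain.torus ℓ hℓ).IsFunctionOn f → f x = f y := by
  let m : Fin 3 → ℤ := fun k => ⌊x k / ℓ⌋
  refine ⟨x - m 0 • EuclideanSpace.single 0 ℓ - m 1 • EuclideanSpace.single 1 ℓ
    - m 2 • EuclideanSpace.single 2 ℓ, ?_, fun f hf => ?_⟩
  · have key : ∀ k, x k - m k * ℓ ∈ Icc 0 ℓ := by
      intro k
      have h1 : (m k : ℝ) ≤ x k / ℓ := Int.floor_le _
      have h2 : x k / ℓ < m k + 1 := Int.lt_floor_add_one _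
      rw [le_div_iff₀ hℓ] at h1
      rw [div_lt_iff₀ hℓ] at h2
      constructor <;> linarith
    intro k
    convert key k using 1
    fin_cases k <;> simp
  · have hp : ∀ k, Function.Periodic f (EuclideanSpace.single k ℓ) := hf
    rw [(hp 2).sub_zsmul_eq, (hp 1).sub_zsmul_eq, (hp 0).sub_zsmul_eq]

theorem exists_bound_of_periodic {V : Type*} [NormedAddCommGroup V] {ℓ : ℝ} {hℓ : 0 < ℓ}
    {f : E3 → V} (hf : Continuous f) (hper : (Domain.torus ℓ hℓ).IsFunctionOn f) :
    ∃ C, ∀ x, ‖f x‖ ≤ C := by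
  obtain ⟨C, hC⟩ := (isCompact_closedCell ℓ).exists_bound_of_continuousOn hf.continuousOn
  refine ⟨C, fun x => ?_⟩
  obtain ⟨y, hy, hxy⟩ := exists_mem_closedCell_eq (V := V) hℓ x
  rw [hxy f hper]
  exact hC y hy

theorem Domain.IsFunctionOn.fderiv {V : Type*} [NormedAddCommGroup V] [NormedSpace ℝ V]
    {D : Domain} {f : E3 → V} (hper : D.IsFunctionOn f) : D.IsFunctionOn (fderiv ℝ f) := by
  cases D with
  | space => trivial
  | torus ℓ hℓ =>
    intro k x
    rw [← fderiv_comp_add_right]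
    congr 1
    exact funext fun y => hper k y

theorem Domain.IsFunctionOn.pderiv {D : Domain} {f : E3 → ℝ} (hper : D.IsFunctionOn f)
    (k : Fin 3) : D.IsFunctionOn (pderiv k f) := by
  cases D with
  | space => trivial
  | torus ℓ hℓ =>
    intro j x
    simp only [EulerKorteweg.pderiv]
    rw [hper.fderiv j x]

/-! ### Calculus of partial derivatives -/

theorem pderiv_add {k : Fin 3} {f g : E3 → ℝ} {x : E3} (hf : DifferentiableAt ℝ f x)
    (hg : DifferentiableAt ℝ g x) :
    pderiv k (fun y => f y + g y) x = pderiv k f x + pderiv k g x := by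
  simp [pderiv, fderiv_fun_add hf hg]

theorem pderiv_sub {k : Fin 3} {f g : E3 → ℝ} {x : E3} (hf : DifferentiableAt ℝ f x)
    (hg : DifferentiableAt ℝ g x) :
    pderiv k (fun y => f y - g y) x = pderiv k f x - pderiv k g x := by
  simp [pderiv, fderiv_fun_sub hf hg]

theorem pderiv_neg {k : Fin 3} {f : E3 → ℝ} {x : E3} :
    pderiv k (fun y => -f y) x = -pderiv k f x := by
  simp [pderiv, fderiv_fun_neg]

theorem pderiv_mul {k : Fin 3} {f g : E3 → ℝ} {x : E3} (hf : DifferentiableAt ℝ f x)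
    (hg : DifferentiableAt ℝ g x) :
    pderiv k (fun y => f y * g y) x = f x * pderiv k g x + g x * pderiv k f x := by
  simp [pderiv, fderiv_fun_mul hf hg]

theorem pderiv_pow_two {k : Fin 3} {f : E3 → ℝ} {x : E3} (hf : DifferentiableAt ℝ f x) :
    pderiv k (fun y => f y ^ 2) x = 2 * f x * pderiv k f x := by
  simp_rw [sq]
  rw [pderiv_mul hf hf]; ring

theorem pderiv_const {k : Fin 3} {a : ℝ} {x : E3} : pderiv k (fun _ => a) x = 0 := by
  simp [pderiv]

theorem pderiv_const_mul {k : Fin 3} {a : ℝ} {f : E3 → ℝ} {x : E3}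
    (hf : DifferentiableAt ℝ f x) : pderiv k (fun y => a * f y) x = a * pderiv k f x := by
  rw [pderiv_mul (differentiableAt_const a) hf, pderiv_const]; ring

theorem pderiv_sum {ι : Type*} {s : Finset ι} {k : Fin 3} {f : ι → E3 → ℝ} {x : E3}
    (hf : ∀ i ∈ s, DifferentiableAt ℝ (f i) x) :
    pderiv k (fun y => ∑ i ∈ s, f i y) x = ∑ i ∈ s, pderiv k (f i) x := by
  simp [pderiv, fderiv_fun_sum hf]

theorem pderiv_comp {k : Fin 3} {g : ℝ → ℝ} {f : E3 → ℝ} {x : E3}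
    (hg : DifferentiableAt ℝ g (f x)) (hf : DifferentiableAt ℝ f x) :
    pderiv k (fun y => g (f y)) x = deriv g (f x) * pderiv k f x := by
  have := (hg.hasDerivAt.comp_hasFDerivAt x hf.hasFDerivAt).fderiv
  simp only [pderiv]
  change (fderiv ℝ (g ∘ f) x) _ = _
  rw [this]; simp

theorem _root_.ContDiff.pderiv {f : E3 → ℝ} {m n : WithTop ℕ∞} (hf : ContDiff ℝ n f)
    (hmn : m + 1 ≤ n) (k : Fin 3) : ContDiff ℝ m (pderiv k f) :=
  (hf.fderiv_right hmn).clm_apply contDiff_const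

theorem pderiv_comm {f : E3 → ℝ} (hf : ContDiff ℝ 2 f) (j k : Fin 3) (x : E3) :
    pderiv j (pderiv k f) x = pderiv k (pderiv j f) x := by
  have hsymm : IsSymmSndFDerivAt ℝ f x := hf.contDiffAt.isSymmSndFDerivAt (by simp)
  have hd : DifferentiableAt ℝ (fderiv ℝ f) x :=
    (hf.fderiv_right (m := 1) (by norm_num)).differentiable (by norm_num) x
  have h : ∀ i l, pderiv i (pderiv l f) x
      = fderiv ℝ (fderiv ℝ f) x (EuclideanSpace.single i 1) (EuclideanSpace.single l 1) := by
    intro i l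
    change fderiv ℝ (fun y => fderiv ℝ f y (EuclideanSpace.single l 1)) x _ = _
    rw [fderiv_clm_apply hd (differentiableAt_const _)]
    simp
  rw [h, h]
  exact hsymm _ _

theorem gradient_apply (f : E3 → ℝ) (x : E3) (k : Fin 3) : gradient f x k = pderiv k f x := by
  have h : inner ℝ (gradient f x) (EuclideanSpace.single k (1 : ℝ)) = pderiv k f x := by
    rw [gradient, InnerProductSpace.toDual_symm_apply, pderiv]
  rw [← h, EuclideanSpace.inner_single_right]
  simp

theorem norm_sq_eq_sum (u : E3) : ‖u‖ ^ 2 = ∑ k, u k ^ 2 := by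
  simp [EuclideanSpace.norm_sq_eq]

theorem inner_eq_sum (u v : E3) : inner ℝ u v = ∑ k, u k * v k := by
  simp [PiLp.inner_apply, mul_comm]

/-- The defining property of a weak gradient holds for `C¹` test functions on the torus. -/
theorem HasWeakGradient.integral_mul_pderiv {ℓ : ℝ} {hℓ : 0 < ℓ} {f : E3 → ℝ} {g : E3 → E3}
    (hfg : HasWeakGradient (Domain.torus ℓ hℓ) f g) {ζ : E3 → ℝ} (hζ : ContDiff ℝ 1 ζ)
    (hper : (Domain.torus ℓ hℓ).IsFunctionOn ζ) (k : Fin 3) :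
    ∫ x in (Domain.torus ℓ hℓ).cell, f x * pderiv k ζ x
      = -∫ x in (Domain.torus ℓ hℓ).cell, g x k * ζ x := by
  -- Mollification keeps the period, so the approximations are admissible test functions. The
  -- uniform bounds on them and on their derivatives give the dominating functions.
  obtain ⟨F, hFs, hFlim, hFdlim, hFb, hFdb, hFper, -⟩ := exists_smooth_approximation volume hζ
  obtain ⟨C, hC⟩ := exists_bound_of_periodic hζ.continuous hper
  obtain ⟨C', hC'⟩ := exists_bound_of_periodic (hζ.continuous_fderiv one_ne_zero) hper.fderiv
  have hf : IntegrableOn f (Domain.torus ℓ hℓ).cell :=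
    (hfg.1.integrableOn_isCompact (isCompact_closedCell ℓ)).mono_set (cell_subset_closedCell ℓ hℓ)
  have hg : IntegrableOn g (Domain.torus ℓ hℓ).cell :=
    (hfg.2.1.integrableOn_isCompact (isCompact_closedCell ℓ)).mono_set
      (cell_subset_closedCell ℓ hℓ)
  have hgk : IntegrableOn (fun x => g x k) (Domain.torus ℓ hℓ).cell :=
    (EuclideanSpace.proj (𝕜 := ℝ) k).integrable_comp hg
  have hpc : ∀ n, Continuous (pderiv k (F n)) := fun n =>
    ((hFs n).pderiv (m := 0) (by norm_num) k).continuous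
  have h1 : Tendsto (fun n => ∫ x in (Domain.torus ℓ hℓ).cell, f x * pderiv k (F n) x) atTop
      (𝓝 (∫ x in (Domain.torus ℓ hℓ).cell, f x * pderiv k ζ x)) := by
    refine tendsto_integral_of_dominated_convergence (fun x => ‖f x‖ * C') ?_ ?_ ?_ ?_
    · exact fun n => hf.aestronglyMeasurable.mul (hpc n).aestronglyMeasurable
    · exact hf.norm.mul_const _
    · refine fun n => Eventually.of_forall fun x => ?_
      rw [norm_mul]
      refine mul_le_mul_of_nonneg_left ?_ (norm_nonneg _)
      refine (ContinuousLinearMap.le_opNorm _ _).trans ?_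
      simpa using hFdb C' hC' n x
    · refine Eventually.of_forall fun x => Tendsto.const_mul _ ?_
      exact ((ContinuousLinearMap.apply ℝ ℝ (EuclideanSpace.single k (1 : ℝ))).continuous.tendsto
        _).comp (hFdlim x)
  have h2 : Tendsto (fun n => -∫ x in (Domain.torus ℓ hℓ).cell, g x k * F n x) atTop
      (𝓝 (-∫ x in (Domain.torus ℓ hℓ).cell, g x k * ζ x)) := by
    refine Tendsto.neg ?_
    refine tendsto_integral_of_dominated_convergence (fun x => ‖g x k‖ * C) ?_ ?_ ?_ ?_
    · exact fun n => hgk.aestronglyMeasurable.mul (hFs n).continuous.aestronglyMeasurable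
    · exact hgk.norm.mul_const _
    · refine fun n => Eventually.of_forall fun x => ?_
      rw [norm_mul]
      exact mul_le_mul_of_nonneg_left (hFb C hC n x) (norm_nonneg _)
    · exact Eventually.of_forall fun x => Tendsto.const_mul _ (hFlim x)
  refine tendsto_nhds_unique h1 (h2.congr fun n => ?_)
  exact (hfg.2.2 (F n) (hFs n) (fun j x => hFper _ (hper j) n x) k).symm

/-! ### Differential identities for the Korteweg stress -/

/-- The functions entering the identities below: a density `f` with its derivatives `F1, F2, F3`,
a velocity `W` with its derivatives, the composites `c0 = c ∘ f, c1 = c' ∘ f, c2 = c'' ∘ f`, and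
similarly for `h`. -/
structure KortewegJet (f : E3 → ℝ) (F1 : Fin 3 → E3 → ℝ) (F2 : Fin 3 → Fin 3 → E3 → ℝ)
    (F3 : Fin 3 → Fin 3 → Fin 3 → E3 → ℝ) (W : Fin 3 → E3 → ℝ) (W1 : Fin 3 → Fin 3 → E3 → ℝ)
    (W2 : Fin 3 → Fin 3 → Fin 3 → E3 → ℝ) (W3 : Fin 3 → Fin 3 → Fin 3 → Fin 3 → E3 → ℝ)
    (c0 c1 c2 h0 h1 h2 : E3 → ℝ) : Prop where
  df : Differentiable ℝ f
  dF1 : ∀ k, Differentiable ℝ (F1 k)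
  dF2 : ∀ j k, Differentiable ℝ (F2 j k)
  dW : ∀ k, Differentiable ℝ (W k)
  dW1 : ∀ j k, Differentiable ℝ (W1 j k)
  dW2 : ∀ i j k, Differentiable ℝ (W2 i j k)
  dc0 : Differentiable ℝ c0
  dc1 : Differentiable ℝ c1
  dh0 : Differentiable ℝ h0
  dh1 : Differentiable ℝ h1
  f_eq : ∀ k, pderiv k f = F1 k
  F1_eq : ∀ j k, pderiv j (F1 k) = F2 j k
  F2_eq : ∀ i j k, pderiv i (F2 j k) = F3 i j k
  W_eq : ∀ k j, pderiv k (W j) = W1 k j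
  W1_eq : ∀ i k j, pderiv i (W1 k j) = W2 i k j
  W2_eq : ∀ i k j l, pderiv i (W2 k j l) = W3 i k j l
  c0_eq : ∀ k x, pderiv k c0 x = c1 x * F1 k x
  c1_eq : ∀ k x, pderiv k c1 x = c2 x * F1 k x
  h0_eq : ∀ k x, pderiv k h0 x = h1 x * F1 k x
  h1_eq : ∀ k x, pderiv k h1 x = h2 x * F1 k x
  F2_symm : ∀ j k, F2 j k = F2 k j
  F3_symm : ∀ i j k, F3 i j k = F3 j i k
  W2_symm : ∀ i j k, W2 i j k = W2 j i k

namespace KortewegJet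

variable {f : E3 → ℝ} {F1 : Fin 3 → E3 → ℝ} {F2 : Fin 3 → Fin 3 → E3 → ℝ}
    {F3 : Fin 3 → Fin 3 → Fin 3 → E3 → ℝ} {W : Fin 3 → E3 → ℝ} {W1 : Fin 3 → Fin 3 → E3 → ℝ}
    {W2 : Fin 3 → Fin 3 → Fin 3 → E3 → ℝ} {W3 : Fin 3 → Fin 3 → Fin 3 → Fin 3 → E3 → ℝ}
    {c0 c1 c2 h0 h1 h2 : E3 → ℝ}

/-- Obtained by differentiating `F2_symm`; together with `F3_symm` it makes the third derivatives
fully symmetric. -/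
theorem F3_symm' (J : KortewegJet f F1 F2 F3 W W1 W2 W3 c0 c1 c2 h0 h1 h2) (i j k : Fin 3) :
    F3 i j k = F3 i k j := by
  rw [← J.F2_eq, ← J.F2_eq, J.F2_symm]

/-- The derivative of the chemical potential. -/
theorem pderiv_potential (J : KortewegJet f F1 F2 F3 W W1 W2 W3 c0 c1 c2 h0 h1 h2) (k : Fin 3)
    (x : E3) :
    pderiv k (fun y => h1 y - 1 / 2 * c1 y * (F1 0 y ^ 2 + F1 1 y ^ 2 + F1 2 y ^ 2)
        - c0 y * (F2 0 0 y + F2 1 1 y + F2 2 2 y)) x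
      = h2 x * F1 k x - 1 / 2 * c2 x * F1 k x * (F1 0 x ^ 2 + F1 1 x ^ 2 + F1 2 x ^ 2)
        - c1 x * (F1 0 x * F2 k 0 x + F1 1 x * F2 k 1 x + F1 2 x * F2 k 2 x)
        - c1 x * F1 k x * (F2 0 0 x + F2 1 1 x + F2 2 2 x)
        - c0 x * (F3 k 0 0 x + F3 k 1 1 x + F3 k 2 2 x) := by
  have := J.df; have := J.dF1; have := J.dF2; have := J.dc0; have := J.dc1; have := J.dh1
  simp (disch := fun_prop) only [pderiv_sub, pderiv_add, pderiv_mul, pderiv_pow_two,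
    pderiv_const, J.c0_eq, J.c1_eq, J.h1_eq, J.F1_eq, J.F2_eq]
  ring


/-- The divergence of the Korteweg stress is `-f` times the gradient of the chemical potential. -/
theorem sum_pderiv_stress (J : KortewegJet f F1 F2 F3 W W1 W2 W3 c0 c1 c2 h0 h1 h2) (k : Fin 3)
    (x : E3) :
    ∑ j, pderiv j (fun y => (-(f y * h1 y - h0 y)
          + 1 / 2 * (f y * c1 y + c0 y) * (F1 0 y ^ 2 + F1 1 y ^ 2 + F1 2 y ^ 2)
          + f y * c0 y * (F2 0 0 y + F2 1 1 y + F2 2 2 y)) * (1 : Matrix (Fin 3) (Fin 3) ℝ) k j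
        - c0 y * F1 k y * F1 j y) x
      = -(f x * (h2 x * F1 k x
        - 1 / 2 * c2 x * F1 k x * (F1 0 x ^ 2 + F1 1 x ^ 2 + F1 2 x ^ 2)
        - c1 x * (F1 0 x * F2 k 0 x + F1 1 x * F2 k 1 x + F1 2 x * F2 k 2 x)
        - c1 x * F1 k x * (F2 0 0 x + F2 1 1 x + F2 2 2 x)
        - c0 x * (F3 k 0 0 x + F3 k 1 1 x + F3 k 2 2 x))) := by
  have := J.df; have := J.dF1; have := J.dF2; have := J.dc0; have := J.dc1; have := J.dh1
  have := J.dh0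
  simp (disch := fun_prop) only [Fin.sum_univ_three, pderiv_sub, pderiv_add, pderiv_mul,
    pderiv_pow_two, pderiv_neg, pderiv_const, J.f_eq, J.c0_eq, J.c1_eq, J.h1_eq, J.h0_eq, J.F1_eq,
    J.F2_eq]
  have e1 := J.F2_symm 1 0; have e2 := J.F2_symm 2 0; have e3 := J.F2_symm 2 1
  obtain rfl | rfl | rfl : k = 0 ∨ k = 1 ∨ k = 2 := by fin_cases k <;> simp
  all_goals
    simp [e1, e2, e3]
    ring

theorem differentiable_stress (J : KortewegJet f F1 F2 F3 W W1 W2 W3 c0 c1 c2 h0 h1 h2)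
    (k j : Fin 3) :
    Differentiable ℝ fun y => (-(f y * h1 y - h0 y)
          + 1 / 2 * (f y * c1 y + c0 y) * (F1 0 y ^ 2 + F1 1 y ^ 2 + F1 2 y ^ 2)
          + f y * c0 y * (F2 0 0 y + F2 1 1 y + F2 2 2 y)) * (1 : Matrix (Fin 3) (Fin 3) ℝ) k j
        - c0 y * F1 k y * F1 j y := by
  have := J.df; have := J.dF1; have := J.dF2; have := J.dc0; have := J.dc1; have := J.dh1
  have := J.dh0
  fun_prop

/-- First derivatives of `-div (f W)`. -/
theorem pderiv_flux (J : KortewegJet f F1 F2 F3 W W1 W2 W3 c0 c1 c2 h0 h1 h2) (k : Fin 3) :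
    pderiv k (fun y => -(f y * (W1 0 0 y + W1 1 1 y + W1 2 2 y)
        + (W 0 y * F1 0 y + W 1 y * F1 1 y + W 2 y * F1 2 y)))
      = fun x => -(F1 k x * (W1 0 0 x + W1 1 1 x + W1 2 2 x)
        + f x * (W2 k 0 0 x + W2 k 1 1 x + W2 k 2 2 x)
        + (W1 k 0 x * F1 0 x + W1 k 1 x * F1 1 x + W1 k 2 x * F1 2 x)
        + (W 0 x * F2 k 0 x + W 1 x * F2 k 1 x + W 2 x * F2 k 2 x)) := by
  funext x
  have := J.df; have := J.dF1; have := J.dW; have := J.dW1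
  simp (disch := fun_prop) only [pderiv_add, pderiv_mul, pderiv_neg, J.f_eq, J.W_eq, J.W1_eq,
    J.F1_eq]
  ring

/-- Second derivatives of `-div (f W)`. -/
theorem pderiv_pderiv_flux (J : KortewegJet f F1 F2 F3 W W1 W2 W3 c0 c1 c2 h0 h1 h2) (k : Fin 3)
    (x : E3) :
    pderiv k (pderiv k (fun y => -(f y * (W1 0 0 y + W1 1 1 y + W1 2 2 y)
        + (W 0 y * F1 0 y + W 1 y * F1 1 y + W 2 y * F1 2 y)))) x
      = -(F2 k k x * (W1 0 0 x + W1 1 1 x + W1 2 2 x)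
        + 2 * F1 k x * (W2 k 0 0 x + W2 k 1 1 x + W2 k 2 2 x)
        + f x * (W3 k k 0 0 x + W3 k k 1 1 x + W3 k k 2 2 x)
        + (W2 k k 0 x * F1 0 x + W2 k k 1 x * F1 1 x + W2 k k 2 x * F1 2 x)
        + 2 * (W1 k 0 x * F2 k 0 x + W1 k 1 x * F2 k 1 x + W1 k 2 x * F2 k 2 x)
        + (W 0 x * F3 k k 0 x + W 1 x * F3 k k 1 x + W 2 x * F3 k k 2 x)) := by
  rw [J.pderiv_flux k]
  have := J.df; have := J.dF1; have := J.dF2; have := J.dW; have := J.dW1; have := J.dW2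
  simp (disch := fun_prop) only [pderiv_add, pderiv_mul, pderiv_neg, J.f_eq, J.W_eq, J.W1_eq,
    J.W2_eq, J.F1_eq, J.F2_eq]
  ring

/-- The linearization of the stress power `s div W + r · ∇ div W + H : ∇W` in the density and the
material derivative of the chemical potential are dual to each other. -/
theorem linearized_stress_power (J : KortewegJet f F1 F2 F3 W W1 W2 W3 c0 c1 c2 h0 h1 h2)
    {ft : E3 → ℝ} (hft : ft = fun y => -(f y * (W1 0 0 y + W1 1 1 y + W1 2 2 y)
        + (W 0 y * F1 0 y + W 1 y * F1 1 y + W 2 y * F1 2 y)))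
    (x : E3) :
    ((f x * h2 x + 1 / 2 * (f x * c2 x + 2 * c1 x) * ∑ k, F1 k x ^ 2)
          * (W1 0 0 x + W1 1 1 x + W1 2 2 x)
        + (f x * c1 x + c0 x) * ∑ k, F1 k x * (W2 k 0 0 x + W2 k 1 1 x + W2 k 2 2 x)
        + c1 x * ∑ k, ∑ j, F1 k x * F1 j x * W1 j k x)
      - ∑ k, pderiv k (fun y => (f y * c1 y + c0 y) * F1 k y * (W1 0 0 y + W1 1 1 y + W1 2 2 y)
          + f y * c0 y * (W2 k 0 0 y + W2 k 1 1 y + W2 k 2 2 y)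
          + c0 y * (F1 0 y * (W1 0 k y + W1 k 0 y) + F1 1 y * (W1 1 k y + W1 k 1 y)
            + F1 2 y * (W1 2 k y + W1 k 2 y))) x
      + (h2 x * ft x - 1 / 2 * c2 x * ft x * ∑ k, F1 k x ^ 2
          - c1 x * ∑ k, F1 k x * pderiv k ft x - c1 x * ft x * ∑ k, F2 k k x
          - c0 x * ∑ k, pderiv k (pderiv k ft) x)
      + ∑ k, W k x * (h2 x * F1 k x
        - 1 / 2 * c2 x * F1 k x * (F1 0 x ^ 2 + F1 1 x ^ 2 + F1 2 x ^ 2)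
        - c1 x * (F1 0 x * F2 k 0 x + F1 1 x * F2 k 1 x + F1 2 x * F2 k 2 x)
        - c1 x * F1 k x * (F2 0 0 x + F2 1 1 x + F2 2 2 x)
        - c0 x * (F3 k 0 0 x + F3 k 1 1 x + F3 k 2 2 x)) = 0 := by
  subst hft
  -- Second derivatives come first: rewriting the inner first derivatives would destroy their
  -- pattern.
  simp only [J.pderiv_pderiv_flux]
  simp only [J.pderiv_flux]
  have := J.df; have := J.dF1; have := J.dF2; have := J.dW; have := J.dW1; have := J.dW2
  have := J.dc0; have := J.dc1
  simp (disch := fun_prop) only [pderiv_add, pderiv_mul, J.f_eq, J.W1_eq,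
    J.W2_eq, J.F1_eq, J.c0_eq, J.c1_eq, Fin.sum_univ_three]
  -- Mixed derivatives are brought to one order of indices, after which the claim is a polynomial
  -- identity.
  simp only [J.F2_symm 1 0, J.F2_symm 2 0, J.F2_symm 2 1, J.F3_symm 1 0, J.F3_symm 2 0,
    J.F3_symm 2 1, J.F3_symm' 0 1 0, J.F3_symm' 0 2 0, J.F3_symm' 1 1 0,
    J.F3_symm' 1 2 1, J.F3_symm' 2 2 0, J.F3_symm' 2 2 1,
    J.W2_symm 1 0, J.W2_symm 2 0, J.W2_symm 2 1]
  ring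

/-- The stress power of the density `f` itself is a time derivative up to a divergence. -/
theorem stress_power_divergence (J : KortewegJet f F1 F2 F3 W W1 W2 W3 c0 c1 c2 h0 h1 h2)
    {ft : E3 → ℝ} (hft : ft = fun y => -(f y * (W1 0 0 y + W1 1 1 y + W1 2 2 y)
        + (W 0 y * F1 0 y + W 1 y * F1 1 y + W 2 y * F1 2 y)))
    (x : E3) :
    (h1 x - 1 / 2 * c1 x * ∑ k, F1 k x ^ 2 - c0 x * ∑ k, F2 k k x) * ft x
        - ((h1 x + 1 / 2 * c1 x * ∑ k, F1 k x ^ 2) * ft x + c0 x * ∑ k, F1 k x * pderiv k ft x)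
        - f x * ∑ k, W k x * (h2 x * F1 k x
          - 1 / 2 * c2 x * F1 k x * (F1 0 x ^ 2 + F1 1 x ^ 2 + F1 2 x ^ 2)
          - c1 x * (F1 0 x * F2 k 0 x + F1 1 x * F2 k 1 x + F1 2 x * F2 k 2 x)
          - c1 x * F1 k x * (F2 0 0 x + F2 1 1 x + F2 2 2 x)
          - c0 x * (F3 k 0 0 x + F3 k 1 1 x + F3 k 2 2 x))
        - ((f x * h1 x - h0 x) + 1 / 2 * (f x * c1 x + c0 x) * ∑ k, F1 k x ^ 2)
          * (W1 0 0 x + W1 1 1 x + W1 2 2 x)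
        - f x * c0 x * ∑ k, F1 k x * (W2 k 0 0 x + W2 k 1 1 x + W2 k 2 2 x)
        - c0 x * ∑ k, ∑ j, F1 k x * F1 j x * W1 j k x
      = -∑ k, pderiv k (fun y => c0 y * F1 k y * ft y
          + ((f y * h1 y - h0 y)
            - 1 / 2 * (f y * c1 y + c0 y) * (F1 0 y ^ 2 + F1 1 y ^ 2 + F1 2 y ^ 2)
            - f y * c0 y * (F2 0 0 y + F2 1 1 y + F2 2 2 y)) * W k y
          + c0 y * F1 k y * (F1 0 y * W 0 y + F1 1 y * W 1 y + F1 2 y * W 2 y)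
          + f y * c0 y * F1 k y * (W1 0 0 y + W1 1 1 y + W1 2 2 y)) x := by
  have := J.df; have := J.dF1; have := J.dF2; have := J.dW; have := J.dW1; have := J.dW2
  have := J.dc0; have := J.dc1; have := J.dh0; have := J.dh1
  -- The time derivative `ft` stays opaque while the products are differentiated, and is expanded
  -- only afterwards.
  have dft : Differentiable ℝ ft := by rw [hft]; fun_prop
  simp (disch := fun_prop) only [pderiv_add, pderiv_sub, pderiv_mul, pderiv_pow_two, pderiv_const,
    J.f_eq, J.W_eq, J.W1_eq, J.h0_eq, J.h1_eq,
    J.F1_eq, J.F2_eq, J.c0_eq, J.c1_eq, Fin.sum_univ_three]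
  subst hft
  simp only [J.pderiv_flux]
  simp only [J.F2_symm 1 0, J.F2_symm 2 0, J.F2_symm 2 1]
  ring

end KortewegJet

/-! ### Pointwise estimates -/

theorem exists_bound_Icc {g : ℝ → ℝ} (hg : ContinuousOn g (Ioi 0)) {κ : ℝ} (hκ : 0 < κ) (K : ℝ) :
    ∃ G : ℝ, 0 ≤ G ∧ ∀ r ∈ Icc κ K, |g r| ≤ G := by
  obtain ⟨G, hG⟩ := (isCompact_Icc (a := κ) (b := K)).exists_bound_of_continuousOn
    (hg.mono fun x hx => hκ.trans_le hx.1)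
  exact ⟨max G 0, le_max_right _ _, fun r hr => (hG r hr).trans (le_max_left _ _)⟩

theorem abs_apply_le_norm (u : E3) (k : Fin 3) : |u k| ≤ ‖u‖ := by
  simpa using PiLp.norm_apply_le u k

/-- The first order Taylor remainder of `g(ρ) q_k` at `(r, Q)` is `(g ρ - g r) (q_k - Q_k)` plus the
Taylor remainder of `g` times `Q_k`; both are quadratic in the differences. -/
theorem exists_linear_remainder_bound {g : ℝ → ℝ} (hg : ContDiffOn ℝ 2 g (Ioi 0)) {κ : ℝ}
    (hκ : 0 < κ) (K B : ℝ) (hB : 0 ≤ B) :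
    ∃ C : ℝ, 0 ≤ C ∧ ∀ ρ ∈ Icc κ K, ∀ r ∈ Icc κ K, ∀ q Q : E3, ‖Q‖ ≤ B → ∀ k,
      |g ρ * q k - g r * Q k - deriv g r * (ρ - r) * Q k - g r * (q k - Q k)|
        ≤ C * ((ρ - r) ^ 2 + ‖q - Q‖ ^ 2) := by
  obtain ⟨C, hC0, hC⟩ := exists_taylor_bound hg hκ K
  refine ⟨C + C * B, by positivity, fun ρ hρ r hr q Q hQ k => ?_⟩
  obtain ⟨h1, h2⟩ := hC ρ hρ r hr
  have hy : |q k - Q k| ≤ ‖q - Q‖ := abs_apply_le_norm (q - Q) k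
  have hX : |Q k| ≤ B := (abs_apply_le_norm Q k).trans hQ
  have e : g ρ * q k - g r * Q k - deriv g r * (ρ - r) * Q k - g r * (q k - Q k)
      = (g ρ - g r) * (q k - Q k) + (g ρ - g r - deriv g r * (ρ - r)) * Q k := by ring
  rw [e]
  have i1 : |(g ρ - g r) * (q k - Q k)| ≤ C * |ρ - r| * ‖q - Q‖ := by
    rw [abs_mul]; exact mul_le_mul h1 hy (abs_nonneg _) (by positivity)
  have i2 : |(g ρ - g r - deriv g r * (ρ - r)) * Q k| ≤ C * (ρ - r) ^ 2 * B := by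
    rw [abs_mul]; exact mul_le_mul h2 hX (abs_nonneg _) (by positivity)
  have i3 : |ρ - r| * ‖q - Q‖ ≤ (ρ - r) ^ 2 + ‖q - Q‖ ^ 2 := by
    nlinarith [sq_nonneg (|ρ - r| - ‖q - Q‖), sq_abs (ρ - r), sq_nonneg (ρ - r),
      sq_nonneg ‖q - Q‖]
  calc _ ≤ _ := abs_add_le _ _
    _ ≤ C * (|ρ - r| * ‖q - Q‖) + C * B * (ρ - r) ^ 2 := by linarith
    _ ≤ C * ((ρ - r) ^ 2 + ‖q - Q‖ ^ 2) + C * B * ((ρ - r) ^ 2 + ‖q - Q‖ ^ 2) := by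
      gcongr
      linarith [sq_nonneg ‖q - Q‖]
    _ = _ := by ring

/-- The same for `g(ρ) q_k q_j`. Here the split also produces `g(ρ) (q_k - Q_k) (q_j - Q_j)`, which
needs `g` bounded on `[κ,K]` but no bound on `q`. -/
theorem exists_quadratic_remainder_bound {g : ℝ → ℝ} (hg : ContDiffOn ℝ 1 g (Ioi 0)) {κ : ℝ}
    {g' : ℝ → ℝ} {C : ℝ} (hκ : 0 < κ) (K B : ℝ) (hB : 0 ≤ B) (hC0 : 0 ≤ C)
    (hC : ∀ x ∈ Icc κ K, ∀ y ∈ Icc κ K,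
      |g x - g y| ≤ C * |x - y| ∧ |g x - g y - g' y * (x - y)| ≤ C * (x - y) ^ 2) :
    ∃ C : ℝ, 0 ≤ C ∧ ∀ ρ ∈ Icc κ K, ∀ r ∈ Icc κ K, ∀ q Q : E3, ‖Q‖ ≤ B → ∀ k j,
      |g ρ * (q k * q j) - g r * (Q k * Q j) - g' r * (ρ - r) * (Q k * Q j)
          - g r * ((q k - Q k) * Q j + Q k * (q j - Q j))|
        ≤ C * ((ρ - r) ^ 2 + ‖q - Q‖ ^ 2) := by
  obtain ⟨G, hG0, hG⟩ := exists_bound_Icc hg.continuousOn hκ K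
  refine ⟨G + 2 * C * B + C * (B * B), by positivity, fun ρ hρ r hr q Q hQ k j => ?_⟩
  obtain ⟨h1, h2⟩ := hC ρ hρ r hr
  have hy : ∀ k, |q k - Q k| ≤ ‖q - Q‖ := fun k => abs_apply_le_norm (q - Q) k
  have hX : ∀ k, |Q k| ≤ B := fun k => (abs_apply_le_norm Q k).trans hQ
  have e : g ρ * (q k * q j) - g r * (Q k * Q j) - g' r * (ρ - r) * (Q k * Q j)
          - g r * ((q k - Q k) * Q j + Q k * (q j - Q j))
      = g ρ * ((q k - Q k) * (q j - Q j))
        + (g ρ - g r) * ((q k - Q k) * Q j + Q k * (q j - Q j))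
        + (g ρ - g r - g' r * (ρ - r)) * (Q k * Q j) := by ring
  rw [e]
  have i0 : |g ρ * ((q k - Q k) * (q j - Q j))| ≤ G * (‖q - Q‖ * ‖q - Q‖) := by
    rw [abs_mul, abs_mul]
    gcongr
    exacts [hG ρ hρ, hy k, hy j]
  have i1 : |(g ρ - g r) * ((q k - Q k) * Q j + Q k * (q j - Q j))|
      ≤ C * |ρ - r| * (‖q - Q‖ * B + B * ‖q - Q‖) := by
    rw [abs_mul]
    refine mul_le_mul h1 ((abs_add_le _ _).trans ?_) (abs_nonneg _) (by positivity)
    rw [abs_mul, abs_mul]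
    gcongr
    exacts [hy k, hX j, hX k, hy j]
  have i2 : |(g ρ - g r - g' r * (ρ - r)) * (Q k * Q j)| ≤ C * (ρ - r) ^ 2 * (B * B) := by
    rw [abs_mul, abs_mul]
    gcongr
    exacts [hX k, hX j]
  have i3 : |ρ - r| * ‖q - Q‖ ≤ (ρ - r) ^ 2 + ‖q - Q‖ ^ 2 := by
    nlinarith [sq_nonneg (|ρ - r| - ‖q - Q‖), sq_abs (ρ - r), sq_nonneg (ρ - r),
      sq_nonneg ‖q - Q‖]
  calc _ ≤ _ := abs_add_three _ _ _
    _ ≤ G * ‖q - Q‖ ^ 2 + 2 * C * B * (|ρ - r| * ‖q - Q‖) + C * (B * B) * (ρ - r) ^ 2 := by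
      linarith
    _ ≤ G * ((ρ - r) ^ 2 + ‖q - Q‖ ^ 2) + 2 * C * B * ((ρ - r) ^ 2 + ‖q - Q‖ ^ 2)
        + C * (B * B) * ((ρ - r) ^ 2 + ‖q - Q‖ ^ 2) := by
      gcongr
      · linarith [sq_nonneg (ρ - r)]
      · linarith [sq_nonneg ‖q - Q‖]
    _ = _ := by ring

/-- The contribution of the density and its gradient to the integrand of `χ`. -/
def chiPotential (c : ℝ → ℝ) (ρ r : ℝ) (q Q : E3) : ℝ :=
  (ρ - r) ^ 2 + 1 / (2 * c ρ) * ‖c ρ • q - c r • Q‖ ^ 2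

/-- The second order remainder of the stress power with respect to the density. -/
def stressRemainder (h c : ℝ → ℝ) (ρ r : ℝ) (q Q : E3) (D1 : Fin 3 → Fin 3 → ℝ)
    (D2 : Fin 3 → ℝ) : ℝ :=
  ((ρ * deriv h ρ - h ρ) - (r * deriv h r - h r) - r * deriv (deriv h) r * (ρ - r))
      * ∑ k, D1 k k
    + (∑ k, (1 / 2 * (ρ * deriv c ρ + c ρ) * (q k * q k)
        - 1 / 2 * (r * deriv c r + c r) * (Q k * Q k)
        - 1 / 2 * (r * deriv (deriv c) r + 2 * deriv c r) * (ρ - r) * (Q k * Q k)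
        - 1 / 2 * (r * deriv c r + c r) * ((q k - Q k) * Q k + Q k * (q k - Q k))))
      * ∑ k, D1 k k
    + ∑ k, (ρ * c ρ * q k - r * c r * Q k - (r * deriv c r + c r) * (ρ - r) * Q k
        - r * c r * (q k - Q k)) * D2 k
    + ∑ k, ∑ j, (c ρ * (q k * q j) - c r * (Q k * Q j) - deriv c r * (ρ - r) * (Q k * Q j)
          - c r * ((q k - Q k) * Q j + Q k * (q j - Q j))) * D1 j k

section

variable {h c : ℝ → ℝ} {α : ℝ}

theorem hasDerivAt_of_contDiffOn_Ioi {f : ℝ → ℝ} {n : WithTop ℕ∞} (hf : ContDiffOn ℝ n f (Ioi 0))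
    (hn : n ≠ 0) {r : ℝ} (hr : 0 < r) : HasDerivAt f (deriv f r) r :=
  ((hf.differentiableOn hn).differentiableAt (Ioi_mem_nhds hr)).hasDerivAt

/-- With `u = c(ρ) q - c(r) Q` one has `q - Q = c(ρ)⁻¹ u - c(ρ)⁻¹ (c(ρ) - c(r)) Q`. The first term
is controlled by the capillary part of `chiPotential`, the second by `(ρ - r)²`. -/
theorem exists_norm_sub_sq_le_chiPotential (hc : ContDiffOn ℝ 3 c (Ioi 0))
    (hc0 : ∀ r, 0 < r → 0 < c r) {κ : ℝ} (hκ : 0 < κ) (K B : ℝ) :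
    ∃ C : ℝ, 0 ≤ C ∧ ∀ ρ ∈ Icc κ K, ∀ r ∈ Icc κ K, ∀ q Q : E3, ‖Q‖ ≤ B →
      ‖q - Q‖ ^ 2 ≤ C * chiPotential c ρ r q Q := by
  obtain ⟨C, hC0, hC⟩ := exists_taylor_bound (hc.of_le (by norm_num)) hκ K
  have hinv : ContinuousOn (fun r => (c r)⁻¹) (Ioi 0) :=
    hc.continuousOn.inv₀ fun r hr => (hc0 r hr).ne'
  obtain ⟨G, hG0, hG⟩ := exists_bound_Icc hinv hκ K
  refine ⟨4 * G + 2 * (G * C * B) ^ 2, by positivity, fun ρ hρ r hr q Q hQ => ?_⟩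
  have hcρ : 0 < c ρ := hc0 ρ (hκ.trans_le hρ.1)
  have hGρ : (c ρ)⁻¹ ≤ G := (le_abs_self _).trans (hG ρ hρ)
  set u := c ρ • q - c r • Q with hu
  have e : q - Q = (c ρ)⁻¹ • u - ((c ρ)⁻¹ * (c ρ - c r)) • Q := by
    rw [hu, smul_sub, smul_smul, smul_smul, inv_mul_cancel₀ hcρ.ne', one_smul, mul_sub,
      inv_mul_cancel₀ hcρ.ne', sub_smul, one_smul]
    abel
  have h1 : ‖((c ρ)⁻¹ * (c ρ - c r)) • Q‖ ≤ G * (C * |ρ - r|) * B := by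
    rw [norm_smul, norm_mul, Real.norm_eq_abs, Real.norm_eq_abs, abs_of_pos (inv_pos.2 hcρ)]
    gcongr
    exact (hC ρ hρ r hr).1
  have h2 : ‖(c ρ)⁻¹ • u‖ ^ 2 ≤ 2 * G * (1 / (2 * c ρ) * ‖u‖ ^ 2) := by
    rw [norm_smul, mul_pow, Real.norm_eq_abs, abs_of_pos (inv_pos.2 hcρ)]
    calc (c ρ)⁻¹ ^ 2 * ‖u‖ ^ 2 = (c ρ)⁻¹ * ((c ρ)⁻¹ * ‖u‖ ^ 2) := by ring
      _ ≤ G * ((c ρ)⁻¹ * ‖u‖ ^ 2) := by gcongr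
      _ = _ := by rw [one_div, mul_inv]; ring
  have h3 : ‖((c ρ)⁻¹ * (c ρ - c r)) • Q‖ ^ 2 ≤ (G * C * B) ^ 2 * (ρ - r) ^ 2 := by
    refine (pow_le_pow_left₀ (norm_nonneg _) h1 2).trans (le_of_eq ?_)
    rw [← sq_abs (ρ - r)]; ring
  have h4 : ‖q - Q‖ ^ 2 ≤ 2 * ‖(c ρ)⁻¹ • u‖ ^ 2 + 2 * ‖((c ρ)⁻¹ * (c ρ - c r)) • Q‖ ^ 2 := by
    have hn := norm_sub_le ((c ρ)⁻¹ • u) (((c ρ)⁻¹ * (c ρ - c r)) • Q)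
    rw [← e] at hn
    nlinarith [sq_nonneg (‖(c ρ)⁻¹ • u‖ - ‖((c ρ)⁻¹ * (c ρ - c r)) • Q‖), norm_nonneg (q - Q),
      norm_nonneg ((c ρ)⁻¹ • u), norm_nonneg (((c ρ)⁻¹ * (c ρ - c r)) • Q)]
  have hz : 0 ≤ 1 / (2 * c ρ) * ‖u‖ ^ 2 := by positivity
  have hz' := sq_nonneg (ρ - r)
  unfold chiPotential
  rw [← hu]
  have e2 : (4 * G + 2 * (G * C * B) ^ 2) * ((ρ - r) ^ 2 + 1 / (2 * c ρ) * ‖u‖ ^ 2)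
      = 4 * G * (1 / (2 * c ρ) * ‖u‖ ^ 2) + 2 * ((G * C * B) ^ 2 * (ρ - r) ^ 2)
        + (4 * G * (ρ - r) ^ 2 + 2 * (G * C * B) ^ 2 * (1 / (2 * c ρ) * ‖u‖ ^ 2)) := by ring
  have : 0 ≤ 4 * G * (ρ - r) ^ 2 + 2 * (G * C * B) ^ 2 * (1 / (2 * c ρ) * ‖u‖ ^ 2) := by
    positivity
  rw [e2]
  linarith

/-- Each line of `stressRemainder` is the first order Taylor remainder of a function of `ρ` times
`1`, `q_k` or `q_k q_j`, so everything is `O((ρ - r)² + |q - Q|²)`. This is where three derivatives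
of `h` and `c` are used: the pressure contains `h'` and must be `C²`. -/
theorem exists_stressRemainder_bound (hh : ContDiffOn ℝ 3 h (Ioi 0))
    (hc : ContDiffOn ℝ 3 c (Ioi 0)) (hc0 : ∀ r, 0 < r → 0 < c r) {κ : ℝ} (hκ : 0 < κ) (K B : ℝ)
    (hB : 0 ≤ B) :
    ∃ C : ℝ, 0 ≤ C ∧ ∀ ρ ∈ Icc κ K, ∀ r ∈ Icc κ K, ∀ q Q : E3, ‖Q‖ ≤ B →
      ∀ D1 : Fin 3 → Fin 3 → ℝ, ∀ D2 : Fin 3 → ℝ, (∀ j k, |D1 j k| ≤ B) → (∀ k, |D2 k| ≤ B) →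
      |stressRemainder h c ρ r q Q D1 D2| ≤ C * chiPotential c ρ r q Q := by
  have hh1 : ContDiffOn ℝ 2 (deriv h) (Ioi 0) := hh.deriv_of_isOpen isOpen_Ioi (by norm_num)
  have hc1 : ContDiffOn ℝ 2 (deriv c) (Ioi 0) := hc.deriv_of_isOpen isOpen_Ioi (by norm_num)
  have hh' : ContDiffOn ℝ 2 h (Ioi 0) := hh.of_le (by norm_num)
  have hc' : ContDiffOn ℝ 2 c (Ioi 0) := hc.of_le (by norm_num)
  have hp : ContDiffOn ℝ 2 (fun ρ => ρ * deriv h ρ - h ρ) (Ioi 0) := (contDiffOn_id.mul hh1).sub hh'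
  have ha : ContDiffOn ℝ 2 (fun ρ => 1 / 2 * (ρ * deriv c ρ + c ρ)) (Ioi 0) :=
    contDiffOn_const.mul ((contDiffOn_id.mul hc1).add hc')
  have hR : ContDiffOn ℝ 2 (fun ρ => ρ * c ρ) (Ioi 0) := contDiffOn_id.mul hc'
  have dp : ∀ r, 0 < r → deriv (fun ρ => ρ * deriv h ρ - h ρ) r = r * deriv (deriv h) r := by
    intro r hr
    have := ((hasDerivAt_id r).mul (hasDerivAt_of_contDiffOn_Ioi hh1 (by norm_num) hr)).sub
      (hasDerivAt_of_contDiffOn_Ioi hh (by norm_num) hr)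
    refine Eq.trans rfl (this.deriv.trans ?_)
    simp
  have da : ∀ r, 0 < r → deriv (fun ρ => 1 / 2 * (ρ * deriv c ρ + c ρ)) r
      = 1 / 2 * (r * deriv (deriv c) r + 2 * deriv c r) := by
    intro r hr
    have := (((hasDerivAt_id r).mul (hasDerivAt_of_contDiffOn_Ioi hc1 (by norm_num) hr)).add
      (hasDerivAt_of_contDiffOn_Ioi hc (by norm_num) hr)).const_mul (1 / 2 : ℝ)
    have h2 := this.deriv
    simp only [id] at h2
    refine Eq.trans ?_ (h2.trans ?_)
    · rfl
    · ring
  have dR : ∀ r, 0 < r → deriv (fun ρ => ρ * c ρ) r = r * deriv c r + c r := by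
    intro r hr
    have := ((hasDerivAt_id r).mul (hasDerivAt_of_contDiffOn_Ioi hc (by norm_num) hr)).deriv
    refine Eq.trans ?_ (this.trans ?_)
    · rfl
    · simp only [id]; ring
  obtain ⟨Cp, hCp0, hCp⟩ := exists_taylor_bound hp hκ K
  obtain ⟨Ta, hTa0, hTa⟩ := exists_taylor_bound ha hκ K
  obtain ⟨Tc, hTc0, hTc⟩ := exists_taylor_bound hc' hκ K
  obtain ⟨Ca, hCa0, hCa⟩ := exists_quadratic_remainder_bound (ha.of_le (by norm_num)) hκ K B hB
    hTa0 hTa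
  obtain ⟨Cc, hCc0, hCc⟩ := exists_quadratic_remainder_bound (hc.of_le (by norm_num)) hκ K B hB
    hTc0 hTc
  obtain ⟨CR, hCR0, hCR⟩ := exists_linear_remainder_bound hR hκ K B hB
  obtain ⟨Cq, hCq0, hCq⟩ := exists_norm_sub_sq_le_chiPotential hc hc0 hκ K B
  -- The trace of `D1` contributes `3 B`, the single sums a factor 3 and the double sum a factor 9.
  -- The factor `1 + Cq` passes from the squared differences to `chiPotential`.
  refine ⟨(3 * Cp * B + 9 * Ca * B + 3 * CR * B + 9 * Cc * B) * (1 + Cq), by positivity,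
    fun ρ hρ r hr q Q hQ D1 D2 hD1 hD2 => ?_⟩
  have hr0 : 0 < r := hκ.trans_le hr.1
  set S := (ρ - r) ^ 2 + ‖q - Q‖ ^ 2 with hS
  have hS0 : 0 ≤ S := by positivity
  have hSchi : S ≤ (1 + Cq) * chiPotential c ρ r q Q := by
    have h1 := hCq ρ hρ r hr q Q hQ
    have h2 : (ρ - r) ^ 2 ≤ chiPotential c ρ r q Q := by
      have := hc0 ρ (hκ.trans_le hρ.1)
      have : 0 ≤ 1 / (2 * c ρ) * ‖c ρ • q - c r • Q‖ ^ 2 := by positivity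
      unfold chiPotential; linarith
    rw [hS]; linarith
  have hd : |∑ k, D1 k k| ≤ 3 * B := by
    refine (Finset.abs_sum_le_sum_abs _ _).trans ?_
    refine (Finset.sum_le_sum fun k _ => hD1 k k).trans ?_
    simp
  have t1 : |((ρ * deriv h ρ - h ρ) - (r * deriv h r - h r) - r * deriv (deriv h) r * (ρ - r))
      * ∑ k, D1 k k| ≤ Cp * S * (3 * B) := by
    rw [abs_mul]
    refine mul_le_mul ?_ hd (abs_nonneg _) (by positivity)
    have := (hCp ρ hρ r hr).2
    rw [dp r hr0] at this
    refine this.trans (mul_le_mul_of_nonneg_left ?_ hCp0)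
    rw [hS]; linarith [sq_nonneg ‖q - Q‖]
  have t2 : |(∑ k, (1 / 2 * (ρ * deriv c ρ + c ρ) * (q k * q k)
        - 1 / 2 * (r * deriv c r + c r) * (Q k * Q k)
        - 1 / 2 * (r * deriv (deriv c) r + 2 * deriv c r) * (ρ - r) * (Q k * Q k)
        - 1 / 2 * (r * deriv c r + c r) * ((q k - Q k) * Q k + Q k * (q k - Q k))))
      * ∑ k, D1 k k| ≤ (3 * (Ca * S)) * (3 * B) := by
    rw [abs_mul]
    refine mul_le_mul ?_ hd (abs_nonneg _) (by positivity)
    refine (Finset.abs_sum_le_sum_abs _ _).trans ?_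
    refine (Finset.sum_le_sum (g := fun _ => Ca * S) fun k _ => ?_).trans (by simp)
    have := hCa ρ hρ r hr q Q hQ k k
    rwa [da r hr0] at this
  have t3 : |∑ k, (ρ * c ρ * q k - r * c r * Q k - (r * deriv c r + c r) * (ρ - r) * Q k
        - r * c r * (q k - Q k)) * D2 k| ≤ 3 * (CR * S * B) := by
    refine (Finset.abs_sum_le_sum_abs _ _).trans ?_
    refine (Finset.sum_le_sum (g := fun _ => CR * S * B) fun k _ => ?_).trans (by simp)
    rw [abs_mul]
    refine mul_le_mul ?_ (hD2 k) (abs_nonneg _) (by positivity)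
    have := hCR ρ hρ r hr q Q hQ k
    rwa [dR r hr0] at this
  have t4 : |∑ k, ∑ j, (c ρ * (q k * q j) - c r * (Q k * Q j)
          - deriv c r * (ρ - r) * (Q k * Q j)
          - c r * ((q k - Q k) * Q j + Q k * (q j - Q j))) * D1 j k| ≤ 9 * (Cc * S * B) := by
    refine (Finset.abs_sum_le_sum_abs _ _).trans ?_
    refine (Finset.sum_le_sum (g := fun _ => 3 * (Cc * S * B)) fun k _ => ?_).trans
      (le_of_eq (by simp; ring))
    refine (Finset.abs_sum_le_sum_abs _ _).trans ?_
    refine (Finset.sum_le_sum (g := fun _ => Cc * S * B) fun j _ => ?_).trans (by simp)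
    rw [abs_mul]
    exact mul_le_mul (hCc ρ hρ r hr q Q hQ k j) (hD1 j k) (abs_nonneg _) (by positivity)
  have habs : |stressRemainder h c ρ r q Q D1 D2|
      ≤ (3 * Cp * B + 9 * Ca * B + 3 * CR * B + 9 * Cc * B) * S := by
    unfold stressRemainder
    refine (abs_add_le _ _).trans ?_
    have := abs_add_three (((ρ * deriv h ρ - h ρ) - (r * deriv h r - h r)
      - r * deriv (deriv h) r * (ρ - r)) * ∑ k, D1 k k) _ _ |>.trans
        (add_le_add (add_le_add t1 t2) t3)
    linarith
  refine habs.trans ?_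
  exact (mul_le_mul_of_nonneg_left hSchi (by positivity)).trans (le_of_eq (by ring))

/-! ### Two-sided bounds for the relative potential energy -/

/-- The relative potential energy. -/
def relativePotential (h c : ℝ → ℝ) (ρ r : ℝ) (q Q : E3) : ℝ :=
  energyF h c ρ q - energyF h c r Q
    - (deriv h r + 1 / 2 * deriv c r * ‖Q‖ ^ 2) * (ρ - r) - c r * inner ℝ Q (q - Q)

/-- Completing the square in `c(ρ) q - c(r) Q`. What is left of the capillary energy is `½ |Q|²
c(r)²` times the gap between `1/c` and its tangent at `r`, so that `q` occurs only in the square. -/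
theorem relativePotential_eq (hc0 : ∀ r, 0 < r → 0 < c r) {ρ r : ℝ} (hρ : 0 < ρ) (hr : 0 < r)
    (q Q : E3) :
    relativePotential h c ρ r q Q = (h ρ - h r - deriv h r * (ρ - r))
      + 1 / (2 * c ρ) * ‖c ρ • q - c r • Q‖ ^ 2
      + 1 / 2 * ‖Q‖ ^ 2 * c r ^ 2 * ((c r)⁻¹ - deriv c r / c r ^ 2 * (ρ - r) - (c ρ)⁻¹) := by
  have h1 := (hc0 ρ hρ).ne'
  have h2 := (hc0 r hr).ne'
  unfold relativePotential energyF
  have hn : ‖c ρ • q - c r • Q‖ ^ 2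
      = c ρ ^ 2 * ‖q‖ ^ 2 - 2 * (c ρ * c r) * inner ℝ Q q + c r ^ 2 * ‖Q‖ ^ 2 := by
    rw [norm_sub_sq_real, norm_smul, norm_smul, inner_smul_left, inner_smul_right,
      real_inner_comm, mul_pow, mul_pow, Real.norm_eq_abs, Real.norm_eq_abs, sq_abs, sq_abs]
    simp only [conj_trivial]
    ring
  rw [hn, inner_sub_right, real_inner_self_eq_norm_sq]
  field_simp
  ring

/-- Concavity of `1/c`: the second derivative of `-1/c` is `(c c'' - 2 c'²) / c³`, nonnegative by
the structural assumption. -/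
theorem inv_le_tangent (hc : ContDiffOn ℝ 3 c (Ioi 0)) (hc0 : ∀ r, 0 < r → 0 < c r)
    (hcc : ∀ r, 0 < r → 0 ≤ c r * deriv (deriv c) r - 2 * deriv c r ^ 2) {ρ r : ℝ} (hρ : 0 < ρ)
    (hr : 0 < r) : (c ρ)⁻¹ ≤ (c r)⁻¹ - deriv c r / c r ^ 2 * (ρ - r) := by
  have hc1 : ContDiffOn ℝ 2 (deriv c) (Ioi 0) := hc.deriv_of_isOpen isOpen_Ioi (by norm_num)
  have hd : ∀ x, 0 < x → HasDerivAt (fun y => -(c y)⁻¹) (deriv c x / c x ^ 2) x := by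
    intro x hx
    have := ((hasDerivAt_of_contDiffOn_Ioi hc (by norm_num) hx).inv (hc0 x hx).ne').neg
    exact this.congr_deriv (by ring)
  have hd2 : ∀ x, 0 < x → deriv (deriv fun y => -(c y)⁻¹) x
      = (c x * deriv (deriv c) x - 2 * deriv c x ^ 2) / c x ^ 3 := by
    intro x hx
    have he : deriv (fun y => -(c y)⁻¹) =ᶠ[𝓝 x] fun y => deriv c y / c y ^ 2 := by
      filter_upwards [Ioi_mem_nhds hx] with y hy using (hd y hy).deriv
    rw [he.deriv_eq]
    have h1 := (hasDerivAt_of_contDiffOn_Ioi hc1 (by norm_num) hx).div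
      ((hasDerivAt_of_contDiffOn_Ioi hc (by norm_num) hx).pow 2) (by
        have := hc0 x hx; exact (pow_pos this 2).ne')
    refine (h1.deriv).trans ?_
    have := (hc0 x hx).ne'
    simp only [Pi.pow_apply]
    field_simp
    ring
  have hs : ContDiffOn ℝ 2 (fun y => -(c y)⁻¹) (Ioi 0) :=
    ((hc.of_le (by norm_num)).inv fun x hx => (hc0 x hx).ne').neg
  have := add_deriv_mul_sub_le_of_deriv2_nonneg hs (fun x hx => by
    rw [hd2 x hx]; exact div_nonneg (hcc x hx) (pow_pos (hc0 x hx) 3).le) hρ hr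
  rw [(hd r hr).deriv] at this
  linarith

/-- In `relativePotential_eq` the `h` part is at least `α/2 (ρ - r)²` because `h - α/2 y²` is
convex, the square is kept, and the last part is nonnegative by `inv_le_tangent`. -/
theorem chiPotential_le_relativePotential (hh : ContDiffOn ℝ 3 h (Ioi 0))
    (hc : ContDiffOn ℝ 3 c (Ioi 0)) (hc0 : ∀ r, 0 < r → 0 < c r)
    (hcc : ∀ r, 0 < r → 0 ≤ c r * deriv (deriv c) r - 2 * deriv c r ^ 2)
    (hα : ∀ r, 0 < r → α ≤ deriv (deriv h) r) {ρ r : ℝ} (hρ : 0 < ρ) (hr : 0 < r) (q Q : E3) :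
    min 1 (α / 2) * chiPotential c ρ r q Q ≤ relativePotential h c ρ r q Q := by
  rw [relativePotential_eq hc0 hρ hr]
  have hh1 : ContDiffOn ℝ 2 (deriv h) (Ioi 0) := hh.deriv_of_isOpen isOpen_Ioi (by norm_num)
  have hd : ∀ x, 0 < x → HasDerivAt (fun y => h y - α / 2 * y ^ 2) (deriv h x - α * x) x := by
    intro x hx
    have := (hasDerivAt_of_contDiffOn_Ioi hh (by norm_num) hx).sub
      ((hasDerivAt_pow 2 x).const_mul (α / 2))
    exact this.congr_deriv (by norm_num; ring)
  have hd2 : ∀ x, 0 < x → deriv (deriv fun y => h y - α / 2 * y ^ 2) x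
      = deriv (deriv h) x - α := by
    intro x hx
    have he : deriv (fun y => h y - α / 2 * y ^ 2) =ᶠ[𝓝 x] fun y => deriv h y - α * y := by
      filter_upwards [Ioi_mem_nhds hx] with y hy using (hd y hy).deriv
    rw [he.deriv_eq]
    have := ((hasDerivAt_of_contDiffOn_Ioi hh1 (by norm_num) hx).sub
      ((hasDerivAt_id x).const_mul α)).deriv
    refine Eq.trans rfl (this.trans (by ring))
  have hs : ContDiffOn ℝ 2 (fun y => h y - α / 2 * y ^ 2) (Ioi 0) :=
    (hh.of_le (by norm_num)).sub (contDiffOn_const.mul (contDiffOn_id.pow 2))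
  have h1 := add_deriv_mul_sub_le_of_deriv2_nonneg hs (fun x hx => by
    rw [hd2 x hx]; linarith [hα x hx]) hρ hr
  rw [(hd r hr).deriv] at h1
  have h2 : α / 2 * (ρ - r) ^ 2 ≤ h ρ - h r - deriv h r * (ρ - r) := by nlinarith
  have h3 := inv_le_tangent hc hc0 hcc hρ hr
  have h4 : 0 ≤ 1 / 2 * ‖Q‖ ^ 2 * c r ^ 2 * ((c r)⁻¹ - deriv c r / c r ^ 2 * (ρ - r) - (c ρ)⁻¹) :=
    mul_nonneg (by positivity) (by linarith)
  have h5 : min 1 (α / 2) * (ρ - r) ^ 2 ≤ α / 2 * (ρ - r) ^ 2 :=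
    mul_le_mul_of_nonneg_right (min_le_right _ _) (sq_nonneg _)
  have h6 : min 1 (α / 2) * (1 / (2 * c ρ) * ‖c ρ • q - c r • Q‖ ^ 2)
      ≤ 1 * (1 / (2 * c ρ) * ‖c ρ • q - c r • Q‖ ^ 2) := by
    have := hc0 ρ hρ
    exact mul_le_mul_of_nonneg_right (min_le_left _ _) (by positivity)
  unfold chiPotential
  linarith

/-- The two Bregman-type parts of `relativePotential_eq` are Taylor remainders of `h` and `-1/c`,
hence `O((ρ - r)²)` on `[κ,K]`; the square already belongs to `chiPotential`. This direction is
needed only for the initial time. -/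
theorem exists_relativePotential_le (hh : ContDiffOn ℝ 3 h (Ioi 0))
    (hc : ContDiffOn ℝ 3 c (Ioi 0)) (hc0 : ∀ r, 0 < r → 0 < c r) {κ : ℝ} (hκ : 0 < κ) (K B : ℝ) :
    ∃ C : ℝ, 0 ≤ C ∧ ∀ ρ ∈ Icc κ K, ∀ r ∈ Icc κ K, ∀ q Q : E3, ‖Q‖ ≤ B →
      relativePotential h c ρ r q Q ≤ C * chiPotential c ρ r q Q := by
  have hs : ContDiffOn ℝ 2 (fun y => -(c y)⁻¹) (Ioi 0) :=
    ((hc.of_le (by norm_num)).inv fun x hx => (hc0 x hx).ne').neg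
  have hd : ∀ x, 0 < x → HasDerivAt (fun y => -(c y)⁻¹) (deriv c x / c x ^ 2) x := by
    intro x hx
    have := ((hasDerivAt_of_contDiffOn_Ioi hc (by norm_num) hx).inv (hc0 x hx).ne').neg
    exact this.congr_deriv (by ring)
  obtain ⟨Ch, hCh0, hCh⟩ := exists_taylor_bound (hh.of_le (by norm_num)) hκ K
  obtain ⟨Cu, hCu0, hCu⟩ := exists_taylor_bound hs hκ K
  obtain ⟨G, hG0, hG⟩ := exists_bound_Icc hc.continuousOn hκ K
  refine ⟨Ch + 1 + 1 / 2 * B ^ 2 * G ^ 2 * Cu, by positivity, fun ρ hρ r hr q Q hQ => ?_⟩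
  have hρ0 := hκ.trans_le hρ.1
  have hr0 := hκ.trans_le hr.1
  rw [relativePotential_eq hc0 hρ0 hr0]
  have h1 : h ρ - h r - deriv h r * (ρ - r) ≤ Ch * (ρ - r) ^ 2 :=
    (le_abs_self _).trans (hCh ρ hρ r hr).2
  have h2 : (c r)⁻¹ - deriv c r / c r ^ 2 * (ρ - r) - (c ρ)⁻¹ ≤ Cu * (ρ - r) ^ 2 := by
    have := (le_abs_self _).trans (hCu ρ hρ r hr).2
    rw [(hd r hr0).deriv] at this
    linarith
  have h3 : 1 / 2 * ‖Q‖ ^ 2 * c r ^ 2 * ((c r)⁻¹ - deriv c r / c r ^ 2 * (ρ - r) - (c ρ)⁻¹)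
      ≤ 1 / 2 * B ^ 2 * G ^ 2 * (Cu * (ρ - r) ^ 2) := by
    have hcr : c r ^ 2 ≤ G ^ 2 := by
      rw [← sq_abs]; exact pow_le_pow_left₀ (abs_nonneg _) (hG r hr) 2
    have hQ2 : ‖Q‖ ^ 2 ≤ B ^ 2 := pow_le_pow_left₀ (norm_nonneg _) hQ 2
    refine (mul_le_mul_of_nonneg_left h2 (by positivity)).trans ?_
    gcongr
  have h4 : 0 ≤ 1 / (2 * c ρ) * ‖c ρ • q - c r • Q‖ ^ 2 := by
    have := hc0 ρ hρ0
    positivity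
  have h5 := sq_nonneg (ρ - r)
  unfold chiPotential
  have h6 : 0 ≤ (Ch + 1 / 2 * B ^ 2 * G ^ 2 * Cu) * (1 / (2 * c ρ) * ‖c ρ • q - c r • Q‖ ^ 2) := by
    positivity
  nlinarith

end

/-- Because `∑ r i • R i = 0`, replacing `v i - W` by `v i - v i₀` costs only terms with the factor
`ρ i - r i`, which are quadratic. What remains is linear in `v i - v i₀` and is absorbed by the
dissipation, which carries the factor `1/ε`, leaving a multiple of `ε`. -/
theorem exists_friction_estimate {n : ℕ} {b : Fin n → Fin n → ℝ} (hN : FrictionHypothesis b)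
    {κ : ℝ} (hκ : 0 < κ) (K B : ℝ) (hB : 0 ≤ B) :
    ∃ C : ℝ, 0 ≤ C ∧ ∀ ε : ℝ, 0 < ε → ∀ ρ r : Fin n → ℝ, ∀ v R : Fin n → E3, ∀ W : E3,
      (∀ i, κ ≤ ρ i) → (∀ i, ρ i ≤ K) → (∀ i, ‖R i‖ ≤ B) → ∑ i, r i • R i = 0 →
      -∑ i, ρ i * inner ℝ (v i - W) (R i)
          - 1 / (2 * ε) * ∑ i, ∑ j, b i j * ρ i * ρ j * ‖v i - v j‖ ^ 2
        ≤ C * ∑ i, (1 / 2 * ρ i * ‖v i - W‖ ^ 2 + (ρ i - r i) ^ 2) + C * ε := by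
  obtain ⟨c₀, hc₀, hco⟩ := exists_friction_coercivity hN
  rcases Nat.eq_zero_or_pos n with hn | hn
  · subst hn
    exact ⟨0, le_rfl, fun ε hε ρ r v R W _ _ _ _ => by simp⟩
  have hnR : (0 : ℝ) < n := Nat.cast_pos.2 hn
  let i₀ : Fin n := ⟨0, hn⟩
  -- `κ²` bounds the products of densities from below; `1/n` pays for summing the coercivity
  -- estimate over all components.
  let A : ℝ := κ ^ 2 * c₀ / n
  have hA : 0 < A := by positivity
  refine ⟨n * ((K * B) ^ 2 / (2 * A)) + (B * n / κ + B), by positivity,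
    fun ε hε ρ r v R W hρ hρK hR hsum => ?_⟩
  have hρ0 : ∀ i, 0 < ρ i := fun i => hκ.trans_le (hρ i)
  have hK0 : 0 ≤ K := (hρ0 i₀).le.trans (hρK i₀)
  have hdiss : A * ∑ i, ‖v i - v i₀‖ ^ 2 ≤ ∑ i, ∑ j, b i j * ρ i * ρ j * ‖v i - v j‖ ^ 2 := by
    have h1 : κ ^ 2 * ∑ i, ∑ j, b i j * ‖v i - v j‖ ^ 2
        ≤ ∑ i, ∑ j, b i j * ρ i * ρ j * ‖v i - v j‖ ^ 2 := by
      simp only [Finset.mul_sum]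
      refine Finset.sum_le_sum fun i _ => Finset.sum_le_sum fun j _ => ?_
      have h2 : κ * κ ≤ ρ i * ρ j := mul_le_mul (hρ i) (hρ j) hκ.le (hρ0 i).le
      have h3 : 0 ≤ b i j * ‖v i - v j‖ ^ 2 := mul_nonneg (hN.2.1 i j) (sq_nonneg _)
      nlinarith [mul_le_mul_of_nonneg_right h2 h3]
    refine le_trans ?_ h1
    have h4 : c₀ * ∑ i, ‖v i - v i₀‖ ^ 2 ≤ n * ∑ i, ∑ j, b i j * ‖v i - v j‖ ^ 2 := by
      rw [Finset.mul_sum]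
      refine (Finset.sum_le_sum fun i _ => hco v i i₀).trans ?_
      simp
    have h5 : A * ∑ i, ‖v i - v i₀‖ ^ 2 = κ ^ 2 * (c₀ * ∑ i, ‖v i - v i₀‖ ^ 2 / n) := by
      simp only [A, ← Finset.sum_div]; ring
    rw [h5]
    refine mul_le_mul_of_nonneg_left ?_ (sq_nonneg κ)
    rw [← Finset.sum_div, ← mul_div_assoc, div_le_iff₀ hnR]
    linarith
  -- The difference of the two sides is `∑ r i * inner (v i₀ - W) (R i)`, which vanishes by
  -- orthogonality.
  have hsplit : -∑ i, ρ i * inner ℝ (v i - W) (R i)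
      = ∑ i, -(ρ i * inner ℝ (v i - v i₀) (R i))
        + ∑ i, -((ρ i - r i) * inner ℝ (v i₀ - W) (R i)) := by
    have h0 : ∑ i, r i * inner ℝ (v i₀ - W) (R i) = 0 := by
      have := congrArg (fun z => inner ℝ (v i₀ - W) z) hsum
      simpa [inner_sum, inner_smul_right] using this
    rw [← Finset.sum_neg_distrib, ← Finset.sum_add_distrib, ← sub_eq_zero,
      ← Finset.sum_sub_distrib, ← neg_eq_zero, ← Finset.sum_neg_distrib, ← h0]
    refine Finset.sum_congr rfl fun i _ => ?_
    have : v i - W = (v i - v i₀) + (v i₀ - W) := by abel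
    rw [this, inner_add_left]
    ring
  have hone : ∀ i, -(ρ i * inner ℝ (v i - v i₀) (R i))
      ≤ A / (2 * ε) * ‖v i - v i₀‖ ^ 2 + (K * B) ^ 2 / (2 * A) * ε := by
    intro i
    have h1 : |ρ i * inner ℝ (v i - v i₀) (R i)| ≤ K * (‖v i - v i₀‖ * B) := by
      rw [abs_mul, abs_of_pos (hρ0 i)]
      refine mul_le_mul (hρK i) ((abs_real_inner_le_norm _ _).trans ?_) (abs_nonneg _) hK0
      exact mul_le_mul_of_nonneg_left (hR i) (norm_nonneg _)
    have h2 := neg_abs_le (ρ i * inner ℝ (v i - v i₀) (R i))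
    -- Young's inequality with weight `A/ε`, written as an exact square.
    have h3 : A / (2 * ε) * ‖v i - v i₀‖ ^ 2 + (K * B) ^ 2 / (2 * A) * ε
        - K * (‖v i - v i₀‖ * B)
        = (A * ‖v i - v i₀‖ - K * B * ε) ^ 2 / (2 * A * ε) := by
      field_simp; ring
    have h4 : 0 ≤ (A * ‖v i - v i₀‖ - K * B * ε) ^ 2 / (2 * A * ε) := by positivity
    linarith
  have htwo : ∀ i, -((ρ i - r i) * inner ℝ (v i₀ - W) (R i))
      ≤ B / 2 * (‖v i₀ - W‖ ^ 2 + (ρ i - r i) ^ 2) := by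
    intro i
    have h1 : |(ρ i - r i) * inner ℝ (v i₀ - W) (R i)| ≤ |ρ i - r i| * (‖v i₀ - W‖ * B) := by
      rw [abs_mul]
      refine mul_le_mul_of_nonneg_left ((abs_real_inner_le_norm _ _).trans ?_) (abs_nonneg _)
      exact mul_le_mul_of_nonneg_left (hR i) (norm_nonneg _)
    have h2 := neg_abs_le ((ρ i - r i) * inner ℝ (v i₀ - W) (R i))
    have h3 : 2 * (|ρ i - r i| * ‖v i₀ - W‖) ≤ ‖v i₀ - W‖ ^ 2 + (ρ i - r i) ^ 2 := by
      nlinarith [sq_nonneg (|ρ i - r i| - ‖v i₀ - W‖), sq_abs (ρ i - r i)]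
    nlinarith
  have hX : ∀ i, 0 ≤ 1 / 2 * ρ i * ‖v i - W‖ ^ 2 + (ρ i - r i) ^ 2 := fun i => by
    have := hρ0 i; positivity
  set X := ∑ i, (1 / 2 * ρ i * ‖v i - W‖ ^ 2 + (ρ i - r i) ^ 2) with hXdef
  have hX0 : 0 ≤ X := Finset.sum_nonneg fun i _ => hX i
  have h1 : ∑ i, -((ρ i - r i) * inner ℝ (v i₀ - W) (R i)) ≤ (B * n / κ + B) * X := by
    refine (Finset.sum_le_sum fun i _ => htwo i).trans ?_
    rw [← Finset.mul_sum, Finset.sum_add_distrib, Finset.sum_const, Finset.card_univ,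
      Fintype.card_fin, nsmul_eq_mul]
    have i1 : 1 / 2 * κ * ‖v i₀ - W‖ ^ 2 ≤ X := by
      refine le_trans ?_ (Finset.single_le_sum (fun i _ => hX i) (Finset.mem_univ i₀))
      have : κ * ‖v i₀ - W‖ ^ 2 ≤ ρ i₀ * ‖v i₀ - W‖ ^ 2 :=
        mul_le_mul_of_nonneg_right (hρ i₀) (sq_nonneg _)
      linarith [sq_nonneg (ρ i₀ - r i₀)]
    have i2 : ∑ i, (ρ i - r i) ^ 2 ≤ X := by
      refine Finset.sum_le_sum fun i _ => ?_
      have := hρ0 i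
      have : 0 ≤ 1 / 2 * ρ i * ‖v i - W‖ ^ 2 := by positivity
      linarith
    have i3 : ‖v i₀ - W‖ ^ 2 ≤ 2 * X / κ := by
      rw [le_div_iff₀ hκ]; linarith
    calc B / 2 * (n * ‖v i₀ - W‖ ^ 2 + ∑ i, (ρ i - r i) ^ 2)
        ≤ B / 2 * (n * (2 * X / κ) + X) := by gcongr
      _ = B * n / κ * X + B / 2 * X := by ring
      _ ≤ B * n / κ * X + B * X := by
        have : 0 ≤ B * X := mul_nonneg hB hX0
        linarith
      _ = _ := by ring
  have h2 : ∑ i, -(ρ i * inner ℝ (v i - v i₀) (R i))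
      ≤ A / (2 * ε) * ∑ i, ‖v i - v i₀‖ ^ 2 + n * ((K * B) ^ 2 / (2 * A)) * ε := by
    refine (Finset.sum_le_sum fun i _ => hone i).trans ?_
    rw [Finset.sum_add_distrib, ← Finset.mul_sum]
    simp [mul_assoc]
  have h3 : A / (2 * ε) * ∑ i, ‖v i - v i₀‖ ^ 2
      ≤ 1 / (2 * ε) * ∑ i, ∑ j, b i j * ρ i * ρ j * ‖v i - v j‖ ^ 2 := by
    have := mul_le_mul_of_nonneg_left hdiss (by positivity : 0 ≤ 1 / (2 * ε))
    refine le_trans (le_of_eq ?_) this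
    ring
  rw [hsplit]
  -- One constant serves for both `X` and `ε`; these are the resulting surplus terms.
  have h4 : 0 ≤ n * ((K * B) ^ 2 / (2 * A)) * X := by positivity
  have h5 : 0 ≤ (B * n / κ + B) * ε := by positivity
  nlinarith

/-! ### Estimates at a fixed time -/

/-- The chemical potential `h'(f) - ½ c'(f) |∇f|² - c(f) Δf`. -/
def potential (h c : ℝ → ℝ) (f : E3 → ℝ) (x : E3) : ℝ :=
  deriv h (f x) - 1 / 2 * deriv c (f x) * ∑ k, pderiv k f x ^ 2
    - c (f x) * ∑ k, pderiv k (pderiv k f) x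

/-- The derivative of the chemical potential at `f` in the direction `g`. -/
def potentialLin (h c : ℝ → ℝ) (f g : E3 → ℝ) (x : E3) : ℝ :=
  deriv (deriv h) (f x) * g x - 1 / 2 * deriv (deriv c) (f x) * g x * ∑ k, pderiv k f x ^ 2
    - deriv c (f x) * ∑ k, pderiv k f x * pderiv k g x
    - deriv c (f x) * g x * ∑ k, pderiv k (pderiv k f) x
    - c (f x) * ∑ k, pderiv k (pderiv k g) x

/-- The derivative of the energy density at `f` in the direction `g`. -/
def energyLin (h c : ℝ → ℝ) (f g : E3 → ℝ) (x : E3) : ℝ :=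
  (deriv h (f x) + 1 / 2 * deriv c (f x) * ∑ k, pderiv k f x ^ 2) * g x
    + c (f x) * ∑ k, pderiv k f x * pderiv k g x

/-- The vector `∂ₜw + (w · ∇)w + ∇μ`. -/
def momentumDefect (μ : E3 → ℝ) (W wt : E3 → E3) (x : E3) : E3 :=
  WithLp.toLp 2 fun k =>
    wt x k + ∑ j, W x j * pderiv j (fun y => W y k) x + pderiv k μ x

/-- Places concrete functions in the abstract identities. The composites with `h''` and `c''` occur
there only undifferentiated. With `W = 0` the statements about the density alone follow. -/
theorem kortewegJet_of_contDiff {h c : ℝ → ℝ} (hh : ContDiffOn ℝ 3 h (Ioi 0))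
    (hc : ContDiffOn ℝ 3 c (Ioi 0)) {f : E3 → ℝ} (hf : ContDiff ℝ ∞ f) (hpos : ∀ x, 0 < f x)
    {W : E3 → E3} (hW : ContDiff ℝ ∞ W) :
    KortewegJet f (fun k => pderiv k f) (fun j k => pderiv j (pderiv k f))
      (fun i j k => pderiv i (pderiv j (pderiv k f))) (fun k y => W y k)
      (fun j k => pderiv j fun y => W y k) (fun i j k => pderiv i (pderiv j fun y => W y k))
      (fun i j k l => pderiv i (pderiv j (pderiv k fun y => W y l)))
      (fun y => c (f y)) (fun y => deriv c (f y)) (fun y => deriv (deriv c) (f y))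
      (fun y => h (f y)) (fun y => deriv h (f y)) (fun y => deriv (deriv h) (f y)) := by
  have hh1 : ContDiffOn ℝ 2 (deriv h) (Ioi 0) := hh.deriv_of_isOpen isOpen_Ioi (by norm_num)
  have hc1 : ContDiffOn ℝ 2 (deriv c) (Ioi 0) := hc.deriv_of_isOpen isOpen_Ioi (by norm_num)
  have hW' : ∀ k, ContDiff ℝ ∞ fun y => W y k := fun k =>
    (EuclideanSpace.proj (𝕜 := ℝ) k).contDiff.comp hW
  have hd : ∀ {g : E3 → ℝ}, ContDiff ℝ ∞ g → Differentiable ℝ g := fun hg =>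
    hg.differentiable (by simp)
  have hp : ∀ {g : E3 → ℝ}, ContDiff ℝ ∞ g → ∀ k, ContDiff ℝ ∞ (pderiv k g) := fun hg k =>
    hg.pderiv (by simp) k
  have hs : ∀ {g : E3 → ℝ}, ContDiff ℝ ∞ g → ∀ j k,
      pderiv j (pderiv k g) = pderiv k (pderiv j g) := fun hg j k =>
    funext fun x => pderiv_comm (contDiff_infty.1 hg 2) j k x
  have hcomp : ∀ {g : ℝ → ℝ} {n : WithTop ℕ∞}, ContDiffOn ℝ n g (Ioi 0) → n ≠ 0 → ∀ x,
      DifferentiableAt ℝ g (f x) := fun hg hn x =>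
    (hasDerivAt_of_contDiffOn_Ioi hg hn (hpos x)).differentiableAt
  constructor
  · exact hd hf
  · exact fun k => hd (hp hf k)
  · exact fun j k => hd (hp (hp hf k) j)
  · exact fun k => hd (hW' k)
  · exact fun j k => hd (hp (hW' k) j)
  · exact fun i j k => hd (hp (hp (hW' k) j) i)
  · exact fun x => (hcomp hc (by norm_num) x).comp x (hd hf x)
  · exact fun x => (hcomp hc1 (by norm_num) x).comp x (hd hf x)
  · exact fun x => (hcomp hh (by norm_num) x).comp x (hd hf x)
  · exact fun x => (hcomp hh1 (by norm_num) x).comp x (hd hf x)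
  · exact fun _ => rfl
  · exact fun _ _ => rfl
  · exact fun _ _ _ => rfl
  · exact fun _ _ => rfl
  · exact fun _ _ _ => rfl
  · exact fun _ _ _ _ => rfl
  · exact fun k x => pderiv_comp (hcomp hc (by norm_num) x) (hd hf x)
  · exact fun k x => pderiv_comp (hcomp hc1 (by norm_num) x) (hd hf x)
  · exact fun k x => pderiv_comp (hcomp hh (by norm_num) x) (hd hf x)
  · exact fun k x => pderiv_comp (hcomp hh1 (by norm_num) x) (hd hf x)
  · exact fun j k => hs hf j k
  · exact fun i j k => hs (hp hf k) i j
  · exact fun i j k => hs (hW' k) i j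

theorem pderiv_potential {h c : ℝ → ℝ} (hh : ContDiffOn ℝ 3 h (Ioi 0))
    (hc : ContDiffOn ℝ 3 c (Ioi 0)) {f : E3 → ℝ} (hf : ContDiff ℝ ∞ f) (hpos : ∀ x, 0 < f x)
    (k : Fin 3) (x : E3) :
    pderiv k (potential h c f) x
      = deriv (deriv h) (f x) * pderiv k f x
        - 1 / 2 * deriv (deriv c) (f x) * pderiv k f x
          * (pderiv 0 f x ^ 2 + pderiv 1 f x ^ 2 + pderiv 2 f x ^ 2)
        - deriv c (f x) * (pderiv 0 f x * pderiv k (pderiv 0 f) x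
          + pderiv 1 f x * pderiv k (pderiv 1 f) x + pderiv 2 f x * pderiv k (pderiv 2 f) x)
        - deriv c (f x) * pderiv k f x * (pderiv 0 (pderiv 0 f) x + pderiv 1 (pderiv 1 f) x
          + pderiv 2 (pderiv 2 f) x)
        - c (f x) * (pderiv k (pderiv 0 (pderiv 0 f)) x + pderiv k (pderiv 1 (pderiv 1 f)) x
          + pderiv k (pderiv 2 (pderiv 2 f)) x) := by
  have J := kortewegJet_of_contDiff hh hc hf hpos (W := fun _ => 0) contDiff_const
  rw [← J.pderiv_potential k x]
  congr 1
  funext y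
  simp only [potential, Fin.sum_univ_three]

theorem contDiff_apply_of_contDiff {n : WithTop ℕ∞} {W : E3 → E3} (hW : ContDiff ℝ n W)
    (k : Fin 3) : ContDiff ℝ n fun y => W y k :=
  (EuclideanSpace.proj (𝕜 := ℝ) k).contDiff.comp hW

theorem pderiv_divergence {W : E3 → E3} (hW : ContDiff ℝ 2 W) (k : Fin 3) (x : E3) :
    pderiv k (divergence W) x = ∑ l, pderiv k (pderiv l fun y => W y l) x := by
  change pderiv k (fun y => ∑ l, pderiv l (fun z => W z l) y) x = _
  rw [pderiv_sum]
  exact fun l _ => ((contDiff_apply_of_contDiff hW l).pderiv (m := 1) (by norm_num)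
    l).differentiable (by norm_num) x

/-- The divergence of the stress tensor of a smooth density. -/
theorem sum_pderiv_stressTensor {h c : ℝ → ℝ} (hh : ContDiffOn ℝ 3 h (Ioi 0))
    (hc : ContDiffOn ℝ 3 c (Ioi 0)) {f : E3 → ℝ} (hf : ContDiff ℝ ∞ f) (hpos : ∀ x, 0 < f x)
    (k : Fin 3) :
    (∀ j, Differentiable ℝ fun y => stressTensor h c f y k j) ∧
    ∀ x, ∑ j, pderiv j (fun y => stressTensor h c f y k j) x
      = -(f x * pderiv k (potential h c f) x) := by
  have J := kortewegJet_of_contDiff hh hc hf hpos (W := fun _ => 0) contDiff_const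
  have e : ∀ j y, stressTensor h c f y k j
      = (-(f y * deriv h (f y) - h (f y))
          + 1 / 2 * (f y * deriv c (f y) + c (f y))
            * (pderiv 0 f y ^ 2 + pderiv 1 f y ^ 2 + pderiv 2 f y ^ 2)
          + f y * c (f y) * (pderiv 0 (pderiv 0 f) y + pderiv 1 (pderiv 1 f) y
            + pderiv 2 (pderiv 2 f) y)) * (1 : Matrix (Fin 3) (Fin 3) ℝ) k j
        - c (f y) * pderiv k f y * pderiv j f y := by
    intro j y
    -- The gradient term `(c + f c') |∇f|²` of `div r` is twice the one subtracted with `s`, so it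
    -- reappears in the stress with the opposite sign.
    have hdiv : divergence (fun y => stressR c (f y) (gradient f y)) y
        = (c (f y) + f y * deriv c (f y))
            * (pderiv 0 f y ^ 2 + pderiv 1 f y ^ 2 + pderiv 2 f y ^ 2)
          + f y * c (f y) * (pderiv 0 (pderiv 0 f) y + pderiv 1 (pderiv 1 f) y
            + pderiv 2 (pderiv 2 f) y) := by
      have h1 : ∀ l, (fun y => stressR c (f y) (gradient f y) l)
          = fun y => f y * c (f y) * pderiv l f y := fun l => by
        funext z
        simp [stressR, gradient_apply]
      simp only [divergence, h1, Fin.sum_univ_three]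
      have := J.df; have := J.dc0; have := J.dF1
      have e1 := J.c0_eq; have e2 := J.F1_eq
      simp only at e1 e2
      have key : ∀ l, pderiv l (fun y => f y * c (f y) * pderiv l f y) y
          = (c (f y) + f y * deriv c (f y)) * pderiv l f y ^ 2
            + f y * c (f y) * pderiv l (pderiv l f) y := by
        intro l
        rw [pderiv_mul (f := fun y => f y * c (f y)) ((J.df.mul J.dc0) y) (J.dF1 l y), pderiv_mul (J.df y) (J.dc0 y), e1]
        ring
      rw [key, key, key]
      ring
    simp only [stressTensor, stressS, stressH, tensorSq, hdiv, norm_sq_eq_sum, gradient_apply,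
      Matrix.sub_apply, Matrix.smul_apply, Matrix.of_apply, smul_eq_mul, Fin.sum_univ_three]
    ring
  have hfun : ∀ j, (fun y => stressTensor h c f y k j) = _ := fun j => funext (e j)
  constructor
  · intro j
    rw [hfun]
    exact J.differentiable_stress k j
  · intro x
    simp only [hfun]
    rw [pderiv_potential hh hc hf hpos]
    exact J.sum_pderiv_stress k x

/-! ### The relative energy at a fixed time -/

/-- The vector field dual to the linearized stress power. -/
def dualFlux (c : ℝ → ℝ) (f : E3 → ℝ) (W : E3 → E3) (k : Fin 3) (y : E3) : ℝ :=
  (f y * deriv c (f y) + c (f y)) * pderiv k f y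
      * (pderiv 0 (fun z => W z 0) y + pderiv 1 (fun z => W z 1) y + pderiv 2 (fun z => W z 2) y)
    + f y * c (f y) * (pderiv k (pderiv 0 fun z => W z 0) y
      + pderiv k (pderiv 1 fun z => W z 1) y + pderiv k (pderiv 2 fun z => W z 2) y)
    + c (f y) * (pderiv 0 f y * (pderiv 0 (fun z => W z k) y + pderiv k (fun z => W z 0) y)
      + pderiv 1 f y * (pderiv 1 (fun z => W z k) y + pderiv k (fun z => W z 1) y)
      + pderiv 2 f y * (pderiv 2 (fun z => W z k) y + pderiv k (fun z => W z 2) y))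

/-- The flux in the energy balance of a smooth density `f` transported by `W`. -/
def energyFlux (h c : ℝ → ℝ) (f ft : E3 → ℝ) (W : E3 → E3) (k : Fin 3) (y : E3) : ℝ :=
  c (f y) * pderiv k f y * ft y
    + ((f y * deriv h (f y) - h (f y))
      - 1 / 2 * (f y * deriv c (f y) + c (f y))
        * (pderiv 0 f y ^ 2 + pderiv 1 f y ^ 2 + pderiv 2 f y ^ 2)
      - f y * c (f y) * (pderiv 0 (pderiv 0 f) y + pderiv 1 (pderiv 1 f) y
        + pderiv 2 (pderiv 2 f) y)) * W y k
    + c (f y) * pderiv k f y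
      * (pderiv 0 f y * W y 0 + pderiv 1 f y * W y 1 + pderiv 2 f y * W y 2)
    + f y * c (f y) * pderiv k f y
      * (pderiv 0 (fun z => W z 0) y + pderiv 1 (fun z => W z 1) y + pderiv 2 (fun z => W z 2) y)

theorem contDiff_comp_pos {g : ℝ → ℝ} {n : WithTop ℕ∞} (hg : ContDiffOn ℝ n g (Ioi 0))
    {f : E3 → ℝ} (hf : ContDiff ℝ n f) (hpos : ∀ x, 0 < f x) : ContDiff ℝ n fun y => g (f y) :=
  hg.comp_contDiff hf hpos

section

variable {ℓ : ℝ} {hℓ : 0 < ℓ} {h c : ℝ → ℝ} {f ft : E3 → ℝ} {W : E3 → E3}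

theorem contDiff_dualFlux (hc : ContDiffOn ℝ 3 c (Ioi 0)) (hf : ContDiff ℝ ∞ f)
    (hpos : ∀ x, 0 < f x) (hW : ContDiff ℝ ∞ W) (k : Fin 3) : ContDiff ℝ 1 (dualFlux c f W k) := by
  have hc1 : ContDiffOn ℝ 2 (deriv c) (Ioi 0) := hc.deriv_of_isOpen isOpen_Ioi (by norm_num)
  have f1 : ContDiff ℝ 1 f := contDiff_infty.1 hf 1
  have a0 : ContDiff ℝ 1 fun y => c (f y) := contDiff_comp_pos (hc.of_le (by norm_num)) f1 hpos
  have a1 : ContDiff ℝ 1 fun y => deriv c (f y) :=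
    contDiff_comp_pos (hc1.of_le (by norm_num)) f1 hpos
  have b1 : ∀ k, ContDiff ℝ 1 (pderiv k f) := fun k =>
    (contDiff_infty.1 hf 2).pderiv (by norm_num) k
  have d1 : ∀ j k, ContDiff ℝ 1 (pderiv j fun y => W y k) := fun j k =>
    (contDiff_apply_of_contDiff (contDiff_infty.1 hW 2) k).pderiv (by norm_num) j
  have d2 : ∀ i j k, ContDiff ℝ 1 (pderiv i (pderiv j fun y => W y k)) := fun i j k =>
    ((contDiff_apply_of_contDiff (contDiff_infty.1 hW 3) k).pderiv (m := 2) (by norm_num)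
      j).pderiv (by norm_num) i
  exact ((((f1.mul a1).add a0).mul (b1 k)).mul (((d1 0 0).add (d1 1 1)).add (d1 2 2))).add
    ((f1.mul a0).mul (((d2 k 0 0).add (d2 k 1 1)).add (d2 k 2 2))) |>.add
    (a0.mul ((((b1 0).mul ((d1 0 k).add (d1 k 0))).add
      ((b1 1).mul ((d1 1 k).add (d1 k 1)))).add ((b1 2).mul ((d1 2 k).add (d1 k 2)))))

theorem contDiff_energyFlux (hh : ContDiffOn ℝ 3 h (Ioi 0)) (hc : ContDiffOn ℝ 3 c (Ioi 0))
    (hf : ContDiff ℝ ∞ f) (hpos : ∀ x, 0 < f x) (hft : ContDiff ℝ 1 ft) (hW : ContDiff ℝ ∞ W)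
    (k : Fin 3) : ContDiff ℝ 1 (energyFlux h c f ft W k) := by
  have hc1 : ContDiffOn ℝ 2 (deriv c) (Ioi 0) := hc.deriv_of_isOpen isOpen_Ioi (by norm_num)
  have hh1 : ContDiffOn ℝ 2 (deriv h) (Ioi 0) := hh.deriv_of_isOpen isOpen_Ioi (by norm_num)
  have f1 : ContDiff ℝ 1 f := contDiff_infty.1 hf 1
  have a0 : ContDiff ℝ 1 fun y => c (f y) := contDiff_comp_pos (hc.of_le (by norm_num)) f1 hpos
  have a1 : ContDiff ℝ 1 fun y => deriv c (f y) :=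
    contDiff_comp_pos (hc1.of_le (by norm_num)) f1 hpos
  have e0 : ContDiff ℝ 1 fun y => h (f y) := contDiff_comp_pos (hh.of_le (by norm_num)) f1 hpos
  have e1 : ContDiff ℝ 1 fun y => deriv h (f y) :=
    contDiff_comp_pos (hh1.of_le (by norm_num)) f1 hpos
  have b1 : ∀ k, ContDiff ℝ 1 (pderiv k f) := fun k =>
    (contDiff_infty.1 hf 2).pderiv (by norm_num) k
  have b2 : ∀ j k, ContDiff ℝ 1 (pderiv j (pderiv k f)) := fun j k =>
    ((contDiff_infty.1 hf 3).pderiv (m := 2) (by norm_num) k).pderiv (by norm_num) j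
  have w0 : ∀ k, ContDiff ℝ 1 fun y => W y k := fun k =>
    contDiff_apply_of_contDiff (contDiff_infty.1 hW 1) k
  have d1 : ∀ j k, ContDiff ℝ 1 (pderiv j fun y => W y k) := fun j k =>
    (contDiff_apply_of_contDiff (contDiff_infty.1 hW 2) k).pderiv (by norm_num) j
  exact (((a0.mul (b1 k)).mul hft).add
    (((((f1.mul e1).sub e0).sub ((contDiff_const.mul ((f1.mul a1).add a0)).mul
      ((((b1 0).pow 2).add ((b1 1).pow 2)).add ((b1 2).pow 2)))).sub
      ((f1.mul a0).mul (((b2 0 0).add (b2 1 1)).add (b2 2 2)))).mul (w0 k))).add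
    ((a0.mul (b1 k)).mul ((((b1 0).mul (w0 0)).add ((b1 1).mul (w0 1))).add ((b1 2).mul (w0 2))))
    |>.add (((f1.mul a0).mul (b1 k)).mul (((d1 0 0).add (d1 1 1)).add (d1 2 2)))

theorem Domain.IsFunctionOn.apply {D : Domain} (hW : D.IsFunctionOn W) (k : Fin 3) :
    D.IsFunctionOn fun y => W y k := by
  cases D with
  | space => trivial
  | torus ℓ hℓ => exact fun j x => congrArg (fun z : E3 => z k) (hW j x)

theorem isFunctionOn_dualFlux (hf : (Domain.torus ℓ hℓ).IsFunctionOn f)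
    (hW : (Domain.torus ℓ hℓ).IsFunctionOn W) (k : Fin 3) :
    (Domain.torus ℓ hℓ).IsFunctionOn (dualFlux c f W k) := by
  intro j x
  have a : ∀ i, pderiv i f (x + EuclideanSpace.single j ℓ) = pderiv i f x := fun i =>
    hf.pderiv i j x
  have b : ∀ i k, pderiv i (fun y => W y k) (x + EuclideanSpace.single j ℓ)
      = pderiv i (fun y => W y k) x := fun i k => (hW.apply k).pderiv i j x
  have d : ∀ i l k, pderiv i (pderiv l fun y => W y k) (x + EuclideanSpace.single j ℓ)
      = pderiv i (pderiv l fun y => W y k) x := fun i l k => ((hW.apply k).pderiv l).pderiv i j x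
  simp only [dualFlux, hf j x, a, b, d]

theorem isFunctionOn_energyFlux (hf : (Domain.torus ℓ hℓ).IsFunctionOn f)
    (hft : (Domain.torus ℓ hℓ).IsFunctionOn ft)
    (hW : (Domain.torus ℓ hℓ).IsFunctionOn W) (k : Fin 3) :
    (Domain.torus ℓ hℓ).IsFunctionOn (energyFlux h c f ft W k) := by
  intro j x
  have a : ∀ i, pderiv i f (x + EuclideanSpace.single j ℓ) = pderiv i f x := fun i =>
    hf.pderiv i j x
  have a2 : ∀ i l, pderiv i (pderiv l f) (x + EuclideanSpace.single j ℓ)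
      = pderiv i (pderiv l f) x := fun i l => (hf.pderiv l).pderiv i j x
  have b : ∀ i k, pderiv i (fun y => W y k) (x + EuclideanSpace.single j ℓ)
      = pderiv i (fun y => W y k) x := fun i k => (hW.apply k).pderiv i j x
  simp only [energyFlux, hf j x, hft j x, hW j x, a, a2, b]

/-- Integration by parts against the difference of a weakly differentiable and a smooth function. -/
theorem integral_dual_eq_zero {ρ : E3 → ℝ} {q : E3 → E3} {B : Fin 3 → E3 → ℝ}
    (hρ : HasWeakGradient (Domain.torus ℓ hℓ) ρ q) (hf : ContDiff ℝ ∞ f)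
    (hfp : (Domain.torus ℓ hℓ).IsFunctionOn f)
    (hB : ∀ k, ContDiff ℝ 1 (B k)) (hBp : ∀ k, (Domain.torus ℓ hℓ).IsFunctionOn (B k)) :
    IntegrableOn (fun x => ∑ k, B k x * (q x k - pderiv k f x)
        + (∑ k, pderiv k (B k) x) * (ρ x - f x)) (Domain.torus ℓ hℓ).cell ∧
    ∫ x in (Domain.torus ℓ hℓ).cell, (∑ k, B k x * (q x k - pderiv k f x)
        + (∑ k, pderiv k (B k) x) * (ρ x - f x)) = 0 := by
  have hρi : IntegrableOn ρ (Domain.torus ℓ hℓ).cell :=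
    (hρ.1.integrableOn_isCompact (isCompact_closedCell ℓ)).mono_set (cell_subset_closedCell ℓ hℓ)
  have hqi : IntegrableOn q (Domain.torus ℓ hℓ).cell :=
    (hρ.2.1.integrableOn_isCompact (isCompact_closedCell ℓ)).mono_set
      (cell_subset_closedCell ℓ hℓ)
  have hqk : ∀ k, IntegrableOn (fun x => q x k) (Domain.torus ℓ hℓ).cell := fun k =>
    (EuclideanSpace.proj (𝕜 := ℝ) k).integrable_comp hqi
  have hmul : ∀ {g u : E3 → ℝ}, Continuous g → (Domain.torus ℓ hℓ).IsFunctionOn g →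
      IntegrableOn u (Domain.torus ℓ hℓ).cell →
      IntegrableOn (fun x => u x * g x) (Domain.torus ℓ hℓ).cell := by
    intro g u hg hgp hu
    obtain ⟨C, hC⟩ := exists_bound_of_periodic hg hgp
    exact hu.mul_bdd hg.aestronglyMeasurable (Eventually.of_forall hC)
  have hB' : ∀ k, Continuous (pderiv k (B k)) := fun k =>
    ((hB k).pderiv (m := 0) (by norm_num) k).continuous
  have f1 : ContDiff ℝ 1 f := contDiff_infty.1 hf 1
  have hBf : ∀ k, ContDiff ℝ 1 fun x => B k x * f x := fun k => (hB k).mul f1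
  have hBfp : ∀ k, (Domain.torus ℓ hℓ).IsFunctionOn fun x => B k x * f x := fun k j x => by
    simp only [hBp k j x, hfp j x]
  have i1 : ∀ k, IntegrableOn (fun x => q x k * B k x) (Domain.torus ℓ hℓ).cell := fun k =>
    hmul (hB k).continuous (hBp k) (hqk k)
  have i2 : ∀ k, IntegrableOn (fun x => ρ x * pderiv k (B k) x) (Domain.torus ℓ hℓ).cell :=
    fun k => hmul (hB' k) ((hBp k).pderiv k) hρi
  have i3 : ∀ k, IntegrableOn (fun x => pderiv k (fun x => B k x * f x) x)
      (Domain.torus ℓ hℓ).cell := fun k =>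
    integrableOn_cell_of_continuous hℓ ((hBf k).pderiv (m := 0) (by norm_num) k).continuous
  -- In each summand the first two terms cancel upon integration by the definition of the weak
  -- gradient, and the third is the derivative of a periodic function.
  have e : (fun x => ∑ k, B k x * (q x k - pderiv k f x)
        + (∑ k, pderiv k (B k) x) * (ρ x - f x))
      = fun x => ∑ k, (q x k * B k x + ρ x * pderiv k (B k) x
        - pderiv k (fun x => B k x * f x) x) := by
    funext x
    rw [Finset.sum_mul, ← Finset.sum_add_distrib]
    refine Finset.sum_congr rfl fun k _ => ?_
    rw [pderiv_mul ((hB k).differentiable one_ne_zero x) (f1.differentiable one_ne_zero x)]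
    ring
  rw [e]
  refine ⟨integrable_finsetSum _ fun k _ => ((i1 k).add (i2 k)).sub (i3 k), ?_⟩
  refine (integral_finsetSum _ fun k _ => ((i1 k).add (i2 k)).sub (i3 k)).trans ?_
  refine Finset.sum_eq_zero fun k _ => ?_
  refine (integral_sub ((i1 k).add (i2 k)) (i3 k)).trans ?_
  refine (congrArg (· - _) (integral_add (i1 k) (i2 k))).trans ?_
  simp only
  rw [integral_cell_pderiv_eq_zero hℓ (hBf k) (hBfp k), hρ.integral_mul_pderiv (hB k) (hBp k) k]
  ring

theorem contDiff_flux (hf : ContDiff ℝ ∞ f) (hW : ContDiff ℝ ∞ W) :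
    ContDiff ℝ ∞ fun x => -divergence (fun y => f y • W y) x := by
  refine ContDiff.neg (ContDiff.sum fun k _ => ContDiff.pderiv ?_ (n := ∞) (by simp) k)
  exact contDiff_apply_of_contDiff (hf.smul hW) k

theorem isFunctionOn_flux (hf : (Domain.torus ℓ hℓ).IsFunctionOn f)
    (hW : (Domain.torus ℓ hℓ).IsFunctionOn W) :
    (Domain.torus ℓ hℓ).IsFunctionOn fun x => -divergence (fun y => f y • W y) x := by
  intro j x
  have h1 : ∀ k, (Domain.torus ℓ hℓ).IsFunctionOn fun y => (f y • W y) k := fun k i y => by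
    simp only [hf i y, hW i y]
  simp only [divergence]
  congr 1
  exact Finset.sum_congr rfl fun k _ => (h1 k).pderiv k j x

theorem flux_eq (hf : ContDiff ℝ ∞ f) (hW : ContDiff ℝ ∞ W) :
    (fun x => -divergence (fun y => f y • W y) x)
      = fun y => -(f y * (pderiv 0 (fun z => W z 0) y + pderiv 1 (fun z => W z 1) y
          + pderiv 2 (fun z => W z 2) y)
        + (W y 0 * pderiv 0 f y + W y 1 * pderiv 1 f y + W y 2 * pderiv 2 f y)) := by
  funext x
  have h1 : ∀ k, pderiv k (fun y => (f y • W y) k) x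
      = f x * pderiv k (fun z => W z k) x + W x k * pderiv k f x := fun k => by
    simp only [PiLp.smul_apply, smul_eq_mul]
    exact pderiv_mul (hf.differentiable (by simp) x)
      ((contDiff_apply_of_contDiff hW k).differentiable (by simp) x)
  simp only [divergence, h1, Fin.sum_univ_three]
  ring

/-- The integrand of one component in the relative energy inequality. -/
theorem component_identity (hh : ContDiffOn ℝ 3 h (Ioi 0)) (hc : ContDiffOn ℝ 3 c (Ioi 0))
    (hf : ContDiff ℝ ∞ f) (hpos : ∀ x, 0 < f x) (hW : ContDiff ℝ ∞ W) {wt : E3 → E3}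
    (hft : ft = fun x => -divergence (fun y => f y • W y) x) (ρ : ℝ) (q v : E3) (x : E3) :
    potential h c f x * ft x + f x * potentialLin h c f ft x - energyLin h c f ft x
        - (ρ * (potentialLin h c f ft x - inner ℝ (W x) (wt x))
          + inner ℝ (ρ • v) (gradient (fun y => potential h c f y - 1 / 2 * ‖W y‖ ^ 2) x))
        - (inner ℝ (ρ • v) (wt x)
          + contractGrad (ρ • tensorSq v) W x
          + stressS h c ρ q * divergence W x
          + inner ℝ (stressR c ρ q) (gradient (divergence W) x)
          + contractGrad (stressH c ρ q) W x)
      = -contractGrad (ρ • tensorSq (v - W x)) W x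
        - ρ * inner ℝ (v - W x) (momentumDefect (potential h c f) W wt x)
        - stressRemainder h c ρ (f x) q (gradient f x) (fun j k => pderiv j (fun y => W y k) x)
            (fun k => pderiv k (divergence W) x)
        - ∑ k, pderiv k (energyFlux h c f ft W k) x
        - (∑ k, dualFlux c f W k x * (q k - pderiv k f x)
            + (∑ k, pderiv k (dualFlux c f W k) x) * (ρ - f x)) := by
  have J := kortewegJet_of_contDiff hh hc hf hpos hW
  have hft' := hft.trans (flux_eq hf hW)
  have I2 := J.linearized_stress_power hft' x
  have I3 := J.stress_power_divergence hft' x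
  have hdμ : DifferentiableAt ℝ (potential h c f) x := by
    have d1 : ∀ k, DifferentiableAt ℝ (pderiv k f) x := fun k => J.dF1 k x
    have d2 : ∀ k, DifferentiableAt ℝ (pderiv k (pderiv k f)) x := fun k => J.dF2 k k x
    exact ((J.dh1 x).sub (((J.dc1 x).const_mul _).mul
      (DifferentiableAt.fun_sum fun k _ => (d1 k).pow 2))).sub
      ((J.dc0 x).mul (DifferentiableAt.fun_sum fun k _ => d2 k))
  have hgrad : ∀ k, pderiv k (fun y => potential h c f y - 1 / 2 * ‖W y‖ ^ 2) x
      = pderiv k (potential h c f) x - (W x 0 * pderiv k (fun y => W y 0) x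
        + W x 1 * pderiv k (fun y => W y 1) x + W x 2 * pderiv k (fun y => W y 2) x) := by
    intro k
    have hw : ∀ l, DifferentiableAt ℝ (fun y => W y l) x := fun l => J.dW l x
    have e : (fun y => potential h c f y - 1 / 2 * ‖W y‖ ^ 2)
        = fun y => potential h c f y - 1 / 2 * (W y 0 ^ 2 + W y 1 ^ 2 + W y 2 ^ 2) := by
      funext y; rw [norm_sq_eq_sum, Fin.sum_univ_three]
    have hw2 : DifferentiableAt ℝ (fun y => W y 0 ^ 2 + W y 1 ^ 2 + W y 2 ^ 2) x :=
      (((hw 0).pow 2).add ((hw 1).pow 2)).add ((hw 2).pow 2)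
    rw [e, pderiv_sub hdμ (hw2.const_mul _), pderiv_const_mul hw2,
      pderiv_add (f := fun y => W y 0 ^ 2 + W y 1 ^ 2) (g := fun y => W y 2 ^ 2)
        (((hw 0).pow 2).add ((hw 1).pow 2))
        ((hw 2).pow 2),
      pderiv_add (f := fun y => W y 0 ^ 2) (g := fun y => W y 1 ^ 2) ((hw 0).pow 2)
        ((hw 1).pow 2), pderiv_pow_two (hw 0), pderiv_pow_two (hw 1), pderiv_pow_two (hw 2)]
    ring
  have hD2 : ∀ k, pderiv k (divergence W) x = pderiv k (pderiv 0 fun y => W y 0) x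
      + pderiv k (pderiv 1 fun y => W y 1) x + pderiv k (pderiv 2 fun y => W y 2) x := fun k => by
    rw [pderiv_divergence (contDiff_infty.1 hW 2), Fin.sum_univ_three]
  have hM : ∀ k, momentumDefect (potential h c f) W wt x k
      = wt x k + ∑ j, W x j * pderiv j (fun y => W y k) x + pderiv k (potential h c f) x :=
    fun k => rfl
  -- The fluxes in the two jet identities are, by definition, `dualFlux` and `energyFlux`.
  change _ - ∑ k, pderiv k (dualFlux c f W k) x + _ + _ = 0 at I2
  change _ = -∑ k, pderiv k (energyFlux h c f ft W k) x at I3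
  simp only [← pderiv_potential hh hc hf hpos] at I2 I3
  simp only [inner_eq_sum, gradient_apply, hgrad]
  simp only [potentialLin, energyLin, potential, gradient_apply, contractGrad,
    Matrix.smul_apply, tensorSq, Matrix.of_apply, stressS, stressR, stressH, divergence, hM,
    norm_sq_eq_sum, stressRemainder, PiLp.smul_apply, PiLp.sub_apply, smul_eq_mul]
  simp only [hD2]
  -- Both divergences become opaque, so that unfolding `dualFlux` below touches only its
  -- undifferentiated occurrences.
  generalize hE : ∑ k, pderiv k (energyFlux h c f ft W k) x = E at I3 ⊢
  generalize hBB : ∑ k, pderiv k (dualFlux c f W k) x = BB at I2 ⊢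
  simp only [Fin.sum_univ_three, dualFlux] at I2 I3 ⊢
  -- `I3` settles the part of order zero in `(ρ - f, q - ∇f)` and `I2` the coefficient of `ρ - f`.
  -- The coefficient of `q - ∇f` in the linearized stress power is `dualFlux` itself.
  linear_combination I3 - (ρ - f x) * I2

end

/-! ### Rate of change of the relative energy -/

/-- The integrand of `χ` for one component. -/
def chiComponent (c : ℝ → ℝ) (ρ r : ℝ) (q Q v w : E3) : ℝ :=
  1 / 2 * ρ * ‖v - w‖ ^ 2 + chiPotential c ρ r q Q

/-- The rate of change of the relative energy density of one component. -/
def componentRate (h c : ℝ → ℝ) (f ft : E3 → ℝ) (W wt : E3 → E3) (ρ : ℝ) (q v x : E3) : ℝ :=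
  potential h c f x * ft x + f x * potentialLin h c f ft x - energyLin h c f ft x
    - (ρ * (potentialLin h c f ft x - inner ℝ (W x) (wt x))
      + inner ℝ (ρ • v) (gradient (fun y => potential h c f y - 1 / 2 * ‖W y‖ ^ 2) x))
    - (inner ℝ (ρ • v) (wt x)
      + contractGrad (ρ • tensorSq v) W x
      + stressS h c ρ q * divergence W x
      + inner ℝ (stressR c ρ q) (gradient (divergence W) x)
      + contractGrad (stressH c ρ q) W x)

/-- The relative energy density of one component, up to a divergence. -/
def relativeEnergyComponent (h c : ℝ → ℝ) (f : E3 → ℝ) (W : E3 → E3) (ρ : ℝ) (q v x : E3) : ℝ :=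
  (energyF h c ρ q + 1 / 2 * ρ * ‖v‖ ^ 2)
    - (ρ * (potential h c f x - 1 / 2 * ‖W x‖ ^ 2) + inner ℝ (ρ • v) (W x))
    + (potential h c f x * f x - energyF h c (f x) (gradient f x))

theorem chiPotential_nonneg {c : ℝ → ℝ} {ρ : ℝ} (hc : 0 < c ρ) (r : ℝ) (q Q : E3) :
    0 ≤ chiPotential c ρ r q Q := by
  unfold chiPotential; positivity

theorem chiComponent_nonneg {c : ℝ → ℝ} {ρ : ℝ} (hρ : 0 ≤ ρ) (hc : 0 < c ρ) (r : ℝ)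
    (q Q v w : E3) : 0 ≤ chiComponent c ρ r q Q v w :=
  add_nonneg (by positivity) (chiPotential_nonneg hc r q Q)

theorem neg_contractGrad_tensorSq_le {ρ B : ℝ} (hρ : 0 ≤ ρ) {u : E3} {W : E3 → E3} {x : E3}
    (hB : ∀ j k, |pderiv j (fun y => W y k) x| ≤ B) :
    -contractGrad (ρ • tensorSq u) W x ≤ 9 * B * (ρ * ‖u‖ ^ 2) := by
  refine (neg_le_abs _).trans ?_
  unfold contractGrad
  refine (Finset.abs_sum_le_sum_abs _ _).trans ?_
  refine (Finset.sum_le_sum (g := fun _ => 3 * (B * (ρ * ‖u‖ ^ 2))) fun k _ => ?_).trans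
    (le_of_eq (by simp; ring))
  refine (Finset.abs_sum_le_sum_abs _ _).trans ?_
  refine (Finset.sum_le_sum (g := fun _ => B * (ρ * ‖u‖ ^ 2)) fun j _ => ?_).trans (by simp)
  simp only [Matrix.smul_apply, tensorSq, Matrix.of_apply, smul_eq_mul]
  rw [abs_mul, abs_mul, abs_mul, abs_of_nonneg hρ, mul_comm]
  have h1 := abs_apply_le_norm u k
  have h2 := abs_apply_le_norm u j
  have hB0 : 0 ≤ B := (abs_nonneg _).trans (hB j k)
  refine mul_le_mul (hB j k) ?_ (by positivity) hB0
  rw [sq]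
  exact mul_le_mul_of_nonneg_left (mul_le_mul h1 h2 (abs_nonneg _) (norm_nonneg _)) hρ

/-- The sum of the nonnegative constants dominates each of them. -/
theorem exists_uniform_const {n : ℕ} {P : Fin n → ℝ → Prop}
    (hP : ∀ i, ∃ C : ℝ, 0 ≤ C ∧ P i C) (hmono : ∀ i C C', C ≤ C' → P i C → P i C') :
    ∃ C : ℝ, 0 ≤ C ∧ ∀ i, P i C := by
  choose C hC0 hC using hP
  refine ⟨∑ i, C i, Finset.sum_nonneg fun i _ => hC0 i, fun i => hmono i _ _ ?_ (hC i)⟩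
  exact Finset.single_le_sum (fun j _ => hC0 j) (Finset.mem_univ i)

/-- The rate of change of the relative energy is controlled by `χ` and the parameter `ε`. -/
theorem exists_rate_estimate {n : ℕ} {b : Fin n → Fin n → ℝ} (hN : FrictionHypothesis b)
    {h c : Fin n → ℝ → ℝ} (hF : EnergyHypothesis h c) {κ : ℝ} (hκ : 0 < κ) (K B : ℝ) (hB : 0 ≤ B)
    {ℓ : ℝ} (hℓ : 0 < ℓ) :
    ∃ C : ℝ, 0 ≤ C ∧ ∀ ε : ℝ, 0 < ε → ∀ (f : Fin n → E3 → ℝ) (W wt : E3 → E3)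
      (ρ : Fin n → E3 → ℝ) (q v : Fin n → E3 → E3),
      (∀ i, ContDiff ℝ ∞ (f i)) → (∀ i, (Domain.torus ℓ hℓ).IsFunctionOn (f i)) →
      ContDiff ℝ ∞ W → (Domain.torus ℓ hℓ).IsFunctionOn W →
      (∀ i x, f i x ∈ Icc κ K) → (∀ i x, ‖gradient (f i) x‖ ≤ B) →
      (∀ j k x, |pderiv j (fun y => W y k) x| ≤ B) → (∀ k x, |pderiv k (divergence W) x| ≤ B) →
      (∀ i x, ‖momentumDefect (potential (h i) (c i) (f i)) W wt x‖ ≤ B) →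
      (∀ x, ∑ i, f i x • momentumDefect (potential (h i) (c i) (f i)) W wt x = 0) →
      (∀ i, HasWeakGradient (Domain.torus ℓ hℓ) (ρ i) (q i)) →
      (∀ i, ∀ᵐ x ∂volume.restrict (Domain.torus ℓ hℓ).cell, ρ i x ∈ Icc κ K) →
      IntegrableOn (fun x => ∑ i, chiComponent (c i) (ρ i x) (f i x) (q i x)
        (gradient (f i) x) (v i x) (W x)) (Domain.torus ℓ hℓ).cell →
      IntegrableOn (fun x => ∑ i, componentRate (h i) (c i) (f i)
            (fun x => -divergence (fun y => f i y • W y) x) W wt (ρ i x) (q i x) (v i x) x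
          - 1 / (2 * ε) * ∑ i, ∑ j, b i j * ρ i x * ρ j x * ‖v i x - v j x‖ ^ 2)
        (Domain.torus ℓ hℓ).cell →
      ∫ x in (Domain.torus ℓ hℓ).cell, (∑ i, componentRate (h i) (c i) (f i)
            (fun x => -divergence (fun y => f i y • W y) x) W wt (ρ i x) (q i x) (v i x) x
          - 1 / (2 * ε) * ∑ i, ∑ j, b i j * ρ i x * ρ j x * ‖v i x - v j x‖ ^ 2)
        ≤ C * (∫ x in (Domain.torus ℓ hℓ).cell, ∑ i, chiComponent (c i) (ρ i x) (f i x) (q i x)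
            (gradient (f i) x) (v i x) (W x)) + C * ε := by
  obtain ⟨hh, hc, α, hα, hstruct⟩ := hF
  have hc0 : ∀ i r, 0 < r → 0 < c i r := fun i r hr => (hstruct i r hr).2.2
  obtain ⟨C₁, hC₁0, hC₁⟩ := exists_friction_estimate hN hκ K B hB
  obtain ⟨C₂, hC₂0, hC₂⟩ := exists_uniform_const
    (P := fun i C => ∀ ρ ∈ Icc κ K, ∀ r ∈ Icc κ K, ∀ q Q : E3, ‖Q‖ ≤ B →
      ∀ D1 : Fin 3 → Fin 3 → ℝ, ∀ D2 : Fin 3 → ℝ, (∀ j k, |D1 j k| ≤ B) → (∀ k, |D2 k| ≤ B) →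
      |stressRemainder (h i) (c i) ρ r q Q D1 D2| ≤ C * chiPotential (c i) ρ r q Q)
    (fun i => exists_stressRemainder_bound (hh i) (hc i) (hc0 i) hκ K B hB)
    (fun i C C' hCC' hP ρ hρ r hr q Q hQ D1 D2 hD1 hD2 =>
      (hP ρ hρ r hr q Q hQ D1 D2 hD1 hD2).trans (mul_le_mul_of_nonneg_right hCC'
        (chiPotential_nonneg (hc0 i ρ (hκ.trans_le hρ.1)) r q Q)))
  set vol : ℝ := (volume.restrict (Domain.torus ℓ hℓ).cell).real univ with hvol
  have hvol0 : 0 ≤ vol := measureReal_nonneg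
  have : IsFiniteMeasure (volume.restrict (Domain.torus ℓ hℓ).cell) :=
    ⟨by rw [Measure.restrict_apply_univ]; exact volume_cell_lt_top ℓ hℓ⟩
  -- `18 B` comes from the nine entries of the convective term against `½ ρ |v - w|²`, `C₂` from the
  -- stress remainder, `C₁` from friction. Integrating `C₁ ε` over the cell gives `C₁ vol`.
  refine ⟨18 * B + C₂ + C₁ + C₁ * vol, by positivity, ?_⟩
  intro ε hε f W wt ρ q v hf hfp hW hWp hfK hgrad hW1 hW2 hR hRsum hweak hρ hX hY
  have hpos : ∀ i x, 0 < f i x := fun i x => hκ.trans_le (hfK i x).1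
  set ft : Fin n → E3 → ℝ := fun i x => -divergence (fun y => f i y • W y) x with hft
  have hfts : ∀ i, ContDiff ℝ ∞ (ft i) := fun i => contDiff_flux (hf i) hW
  have hftp : ∀ i, (Domain.torus ℓ hℓ).IsFunctionOn (ft i) := fun i =>
    isFunctionOn_flux (hfp i) hWp
  set N₁ : Fin n → E3 → ℝ := fun i x =>
    ∑ k, pderiv k (energyFlux (h i) (c i) (f i) (ft i) W k) x with hN₁
  set N₂ : Fin n → E3 → ℝ := fun i x =>
    ∑ k, dualFlux (c i) (f i) W k x * (q i x k - pderiv k (f i) x)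
      + (∑ k, pderiv k (dualFlux (c i) (f i) W k) x) * (ρ i x - f i x) with hN₂
  have hZ : ∀ i k, ContDiff ℝ 1 (energyFlux (h i) (c i) (f i) (ft i) W k) := fun i k =>
    contDiff_energyFlux (hh i) (hc i) (hf i) (hpos i) (contDiff_infty.1 (hfts i) 1) hW k
  have hZi : ∀ i k, IntegrableOn (pderiv k (energyFlux (h i) (c i) (f i) (ft i) W k))
      (Domain.torus ℓ hℓ).cell := fun i k =>
    integrableOn_cell_of_continuous hℓ ((hZ i k).pderiv (m := 0) (by norm_num) k).continuous
  have hN₁i : ∀ i, IntegrableOn (N₁ i) (Domain.torus ℓ hℓ).cell := fun i =>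
    integrable_finsetSum _ fun k _ => hZi i k
  have hN₁0 : ∀ i, ∫ x in (Domain.torus ℓ hℓ).cell, N₁ i x = 0 := by
    intro i
    refine (integral_finsetSum _ fun k _ => hZi i k).trans ?_
    exact Finset.sum_eq_zero fun k _ => integral_cell_pderiv_eq_zero hℓ (hZ i k)
      (isFunctionOn_energyFlux (hfp i) (hftp i) hWp k) k
  have hN₂' := fun i => integral_dual_eq_zero (hweak i) (hf i) (hfp i)
    (fun k => contDiff_dualFlux (hc i) (hf i) (hpos i) hW k)
    (fun k => isFunctionOn_dualFlux (c := c i) (hfp i) hWp k)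
  set X : E3 → ℝ := fun x => ∑ i, chiComponent (c i) (ρ i x) (f i x) (q i x)
        (gradient (f i) x) (v i x) (W x) with hXdef
  set Y : E3 → ℝ := fun x => ∑ i, componentRate (h i) (c i) (f i) (ft i) W wt (ρ i x) (q i x)
      (v i x) x - 1 / (2 * ε) * ∑ i, ∑ j, b i j * ρ i x * ρ j x * ‖v i x - v j x‖ ^ 2 with hYdef
  have hNi : IntegrableOn (fun x => ∑ i, (N₁ i x + N₂ i x)) (Domain.torus ℓ hℓ).cell :=
    integrable_finsetSum _ fun i _ => (hN₁i i).add (hN₂' i).1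
  have hN0 : ∫ x in (Domain.torus ℓ hℓ).cell, ∑ i, (N₁ i x + N₂ i x) = 0 := by
    refine (integral_finsetSum _ fun i _ => (hN₁i i).add (hN₂' i).1).trans ?_
    refine Finset.sum_eq_zero fun i _ => ?_
    refine (integral_add (hN₁i i) (hN₂' i).1).trans ?_
    rw [hN₁0 i, (hN₂' i).2, add_zero]
  have hbound : ∀ᵐ x ∂volume.restrict (Domain.torus ℓ hℓ).cell,
      Y x + ∑ i, (N₁ i x + N₂ i x) ≤ (18 * B + C₂ + C₁) * X x + C₁ * ε := by
    filter_upwards [ae_all_iff.2 hρ] with x hx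
    have hid : ∀ i, componentRate (h i) (c i) (f i) (ft i) W wt (ρ i x) (q i x) (v i x) x
        + (N₁ i x + N₂ i x)
        = -contractGrad (ρ i x • tensorSq (v i x - W x)) W x
          - ρ i x * inner ℝ (v i x - W x) (momentumDefect (potential (h i) (c i) (f i)) W wt x)
          - stressRemainder (h i) (c i) (ρ i x) (f i x) (q i x) (gradient (f i) x)
            (fun j k => pderiv j (fun y => W y k) x) (fun k => pderiv k (divergence W) x) := by
      intro i
      have := component_identity (hh i) (hc i) (hf i) (hpos i) hW (wt := wt) (ft := ft i) rfl
        (ρ i x) (q i x) (v i x) x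
      rw [componentRate, this]
      simp only [hN₁, hN₂]
      ring
    have hcomp : ∀ i, -contractGrad (ρ i x • tensorSq (v i x - W x)) W x
        - stressRemainder (h i) (c i) (ρ i x) (f i x) (q i x) (gradient (f i) x)
            (fun j k => pderiv j (fun y => W y k) x) (fun k => pderiv k (divergence W) x)
        ≤ (18 * B + C₂) * chiComponent (c i) (ρ i x) (f i x) (q i x) (gradient (f i) x) (v i x)
            (W x) := by
      intro i
      have hρ0 : 0 < ρ i x := hκ.trans_le (hx i).1
      have h1 := neg_contractGrad_tensorSq_le hρ0.le (u := v i x - W x) (fun j k => hW1 j k x)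
      have h2 := (neg_le_abs _).trans (hC₂ i (ρ i x) (hx i) (f i x) (hfK i x) (q i x)
        (gradient (f i) x) (hgrad i x) (fun j k => pderiv j (fun y => W y k) x)
        (fun k => pderiv k (divergence W) x) (fun j k => hW1 j k x) (fun k => hW2 k x))
      have h3 := chiPotential_nonneg (hc0 i _ hρ0) (f i x) (q i x) (gradient (f i) x)
      have h4 : 0 ≤ ρ i x * ‖v i x - W x‖ ^ 2 := by positivity
      unfold chiComponent
      nlinarith [mul_nonneg hB h3, mul_nonneg hC₂0 h4]
    have hfr := hC₁ ε hε (fun i => ρ i x) (fun i => f i x) (fun i => v i x)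
      (fun i => momentumDefect (potential (h i) (c i) (f i)) W wt x) (W x) (fun i => (hx i).1)
      (fun i => (hx i).2) (fun i => hR i x) (hRsum x)
    have hXfr : ∑ i, (1 / 2 * ρ i x * ‖v i x - W x‖ ^ 2 + (ρ i x - f i x) ^ 2) ≤ X x := by
      refine Finset.sum_le_sum fun i _ => ?_
      have := hc0 i _ (hκ.trans_le (hx i).1)
      have : 0 ≤ 1 / (2 * c i (ρ i x))
        * ‖c i (ρ i x) • q i x - c i (f i x) • gradient (f i) x‖ ^ 2 := by positivity
      unfold chiComponent chiPotential
      linarith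
    have hsum : Y x + ∑ i, (N₁ i x + N₂ i x)
        = ∑ i, (-contractGrad (ρ i x • tensorSq (v i x - W x)) W x
          - stressRemainder (h i) (c i) (ρ i x) (f i x) (q i x) (gradient (f i) x)
            (fun j k => pderiv j (fun y => W y k) x) (fun k => pderiv k (divergence W) x))
          + (-∑ i, ρ i x * inner ℝ (v i x - W x)
              (momentumDefect (potential (h i) (c i) (f i)) W wt x)
            - 1 / (2 * ε) * ∑ i, ∑ j, b i j * ρ i x * ρ j x * ‖v i x - v j x‖ ^ 2) := by
      have h1 : ∑ i, (componentRate (h i) (c i) (f i) (ft i) W wt (ρ i x) (q i x) (v i x) x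
          + (N₁ i x + N₂ i x)) = _ := Finset.sum_congr rfl fun i _ => hid i
      rw [Finset.sum_add_distrib] at h1
      simp only [Finset.sum_sub_distrib] at h1 ⊢
      simp only [hYdef]
      linarith
    rw [hsum]
    have h2 := Finset.sum_le_sum fun i (_ : i ∈ Finset.univ) => hcomp i
    rw [← Finset.mul_sum] at h2
    have h3 := mul_le_mul_of_nonneg_left hXfr hC₁0
    simp only [hXdef] at h3 ⊢
    linarith
  -- The rate has no useful pointwise bound by itself; one is available once the terms `N₁`, `N₂` of
  -- zero integral are added.
  have hfin : ∫ x in (Domain.torus ℓ hℓ).cell, Y x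
      = ∫ x in (Domain.torus ℓ hℓ).cell, (Y x + ∑ i, (N₁ i x + N₂ i x)) := by
    rw [integral_add hY hNi, hN0, add_zero]
  rw [hfin]
  refine (integral_mono_ae (hY.add hNi)
    ((hX.const_mul (18 * B + C₂ + C₁)).add (integrable_const (C₁ * ε))) hbound).trans ?_
  rw [integral_add' (hX.const_mul _) (integrable_const _), integral_const_mul, integral_const,
    smul_eq_mul, ← hvol]
  have hXint : 0 ≤ ∫ x in (Domain.torus ℓ hℓ).cell, X x := by
    refine integral_nonneg_of_ae ?_
    filter_upwards [ae_all_iff.2 hρ] with x hx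
    exact Finset.sum_nonneg fun i _ => chiComponent_nonneg (hκ.trans_le (hx i).1).le
      (hc0 i _ (hκ.trans_le (hx i).1)) _ _ _ _ _
  have e1 : 0 ≤ C₁ * vol * ∫ x in (Domain.torus ℓ hℓ).cell, X x := by positivity
  have e2 : 0 ≤ (18 * B + C₂ + C₁) * ε := by positivity
  nlinarith

/-- Since `μ = h' + ½ c' |∇f|² - div (c ∇f)`, replacing `μ` by the partial derivative of `F` in the
density leaves the last bracket, of the kind treated in `integral_dual_eq_zero`. -/
theorem relativeEnergyComponent_eq {h c : ℝ → ℝ} (hc : ContDiffOn ℝ 3 c (Ioi 0)) {f : E3 → ℝ}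
    (hf : ContDiff ℝ ∞ f) (hpos : ∀ x, 0 < f x) (W : E3 → E3) (ρ : ℝ) (q v x : E3) :
    relativeEnergyComponent h c f W ρ q v x
      = relativePotential h c ρ (f x) q (gradient f x) + 1 / 2 * ρ * ‖v - W x‖ ^ 2
        + (∑ k, c (f x) * pderiv k f x * (q k - pderiv k f x)
          + (∑ k, pderiv k (fun y => c (f y) * pderiv k f y) x) * (ρ - f x)) := by
  have hdf : DifferentiableAt ℝ f x := hf.differentiable (by simp) x
  have hdc := (hasDerivAt_of_contDiffOn_Ioi hc (by norm_num) (hpos x)).differentiableAt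
  have h1 : ∀ k, pderiv k (fun y => c (f y) * pderiv k f y) x
      = c (f x) * pderiv k (pderiv k f) x + deriv c (f x) * pderiv k f x ^ 2 := by
    intro k
    rw [pderiv_mul (f := fun y => c (f y)) (hdc.comp x hdf)
      ((hf.pderiv (m := ∞) (by simp) k).differentiable (by simp) x), pderiv_comp hdc hdf]
    ring
  simp only [relativeEnergyComponent, relativePotential, energyF, h1, potential, norm_sq_eq_sum,
    inner_eq_sum, gradient_apply, PiLp.smul_apply, PiLp.sub_apply, smul_eq_mul,
    Fin.sum_univ_three]
  ring

/-- As `g` is continuous on `(0,∞)` only, compose with `g (max κ ·)`, which is continuous everywhere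
and agrees with `g` on `[κ,K]`. -/
theorem aemeasurable_comp_of_mem_Icc {X : Type*} [MeasurableSpace X] {μ : Measure X} {g : ℝ → ℝ}
    (hg : ContinuousOn g (Ioi 0)) {κ K : ℝ} (hκ : 0 < κ) {ρ : X → ℝ}
    (hρm : AEStronglyMeasurable ρ μ) (hρ : ∀ᵐ x ∂μ, ρ x ∈ Icc κ K) :
    AEStronglyMeasurable (fun x => g (ρ x)) μ := by
  have h1 : Continuous fun r => g (max κ r) :=
    hg.comp_continuous (continuous_const.max continuous_id) fun r =>
      hκ.trans_le (le_max_left _ _)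
  refine (h1.comp_aestronglyMeasurable hρm).congr ?_
  filter_upwards [hρ] with x hx
  simp [max_eq_right hx.1]

/-- At a fixed time measurability is known for the momentum, not for the velocity; dividing by the
density recovers the latter. -/
theorem aestronglyMeasurable_of_smul {X : Type*} [MeasurableSpace X] {μ : Measure X} {κ K : ℝ}
    (hκ : 0 < κ) {ρ : X → ℝ} {v : X → E3} (hρm : AEStronglyMeasurable ρ μ)
    (hρ : ∀ᵐ x ∂μ, ρ x ∈ Icc κ K) (hm : AEStronglyMeasurable (fun x => ρ x • v x) μ) :
    AEStronglyMeasurable v μ := by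
  have h1 : AEStronglyMeasurable (fun x => (ρ x)⁻¹) μ :=
    aemeasurable_comp_of_mem_Icc (g := fun r => r⁻¹)
      (continuousOn_id.inv₀ fun r hr => (mem_Ioi.1 hr).ne') hκ hρm hρ
  refine (h1.smul hm).congr ?_
  filter_upwards [hρ] with x hx
  simp [smul_smul, inv_mul_cancel₀ (hκ.trans_le hx.1).ne']

theorem aestronglyMeasurable_chiComponent {X : Type*} [MeasurableSpace X] {μ : Measure X}
    {c : ℝ → ℝ} (hc : ContinuousOn c (Ioi 0)) {κ K : ℝ} (hκ : 0 < κ)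
    {ρ r : X → ℝ} {q Q v w : X → E3} (hρm : AEStronglyMeasurable ρ μ)
    (hρ : ∀ᵐ x ∂μ, ρ x ∈ Icc κ K) (hr : AEStronglyMeasurable r μ)
    (hr' : ∀ᵐ x ∂μ, r x ∈ Icc κ K)
    (hq : AEStronglyMeasurable q μ) (hQ : AEStronglyMeasurable Q μ)
    (hv : AEStronglyMeasurable v μ) (hw : AEStronglyMeasurable w μ) :
    AEStronglyMeasurable (fun x => chiComponent c (ρ x) (r x) (q x) (Q x) (v x) (w x)) μ := by
  have hcρ := aemeasurable_comp_of_mem_Icc hc hκ hρm hρ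
  have hcr := aemeasurable_comp_of_mem_Icc hc hκ hr hr'
  unfold chiComponent chiPotential
  refine ((hρm.const_mul _).mul ((hv.sub hw).norm.pow 2)).add (((hρm.sub hr).pow 2).add ?_)
  refine AEStronglyMeasurable.mul ?_ (((hcρ.smul hq).sub (hcr.smul hQ)).norm.pow 2)
  exact (((hcρ.const_mul 2).aemeasurable.const_div 1)).aestronglyMeasurable

/-- At each time the relative energy is comparable to `χ`. -/
theorem exists_relativeEnergy_comparison {n : ℕ} {h c : Fin n → ℝ → ℝ}
    (hF : EnergyHypothesis h c) {κ : ℝ} (hκ : 0 < κ) (K B : ℝ) {ℓ : ℝ} (hℓ : 0 < ℓ) :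
    ∃ a C : ℝ, 0 < a ∧ 0 ≤ C ∧ ∀ (f : Fin n → E3 → ℝ) (W : E3 → E3)
      (ρ : Fin n → E3 → ℝ) (q v : Fin n → E3 → E3),
      (∀ i, ContDiff ℝ ∞ (f i)) → (∀ i, (Domain.torus ℓ hℓ).IsFunctionOn (f i)) →
      Continuous W → (Domain.torus ℓ hℓ).IsFunctionOn W →
      (∀ i x, f i x ∈ Icc κ K) → (∀ i x, ‖gradient (f i) x‖ ≤ B) →
      (∀ i, HasWeakGradient (Domain.torus ℓ hℓ) (ρ i) (q i)) →
      (∀ i, ∀ᵐ x ∂volume.restrict (Domain.torus ℓ hℓ).cell, ρ i x ∈ Icc κ K) →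
      (∀ i, IntegrableOn (fun x => ρ i x • v i x) (Domain.torus ℓ hℓ).cell) →
      IntegrableOn (fun x => ∑ i, relativeEnergyComponent (h i) (c i) (f i) W (ρ i x) (q i x)
        (v i x) x) (Domain.torus ℓ hℓ).cell →
      IntegrableOn (fun x => ∑ i, chiComponent (c i) (ρ i x) (f i x) (q i x)
        (gradient (f i) x) (v i x) (W x)) (Domain.torus ℓ hℓ).cell ∧
      a * ∫ x in (Domain.torus ℓ hℓ).cell, (∑ i, chiComponent (c i) (ρ i x) (f i x) (q i x)
          (gradient (f i) x) (v i x) (W x))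
        ≤ ∫ x in (Domain.torus ℓ hℓ).cell, (∑ i, relativeEnergyComponent (h i) (c i) (f i) W
          (ρ i x) (q i x) (v i x) x) ∧
      ∫ x in (Domain.torus ℓ hℓ).cell, (∑ i, relativeEnergyComponent (h i) (c i) (f i) W
          (ρ i x) (q i x) (v i x) x)
        ≤ C * ∫ x in (Domain.torus ℓ hℓ).cell, (∑ i, chiComponent (c i) (ρ i x) (f i x) (q i x)
          (gradient (f i) x) (v i x) (W x)) := by
  obtain ⟨hh, hc, α, hα, hstruct⟩ := hF
  have hc0 : ∀ i r, 0 < r → 0 < c i r := fun i r hr => (hstruct i r hr).2.2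
  obtain ⟨C, hC0, hC⟩ := exists_uniform_const
    (P := fun i C => ∀ ρ ∈ Icc κ K, ∀ r ∈ Icc κ K, ∀ q Q : E3, ‖Q‖ ≤ B →
      relativePotential (h i) (c i) ρ r q Q ≤ C * chiPotential (c i) ρ r q Q)
    (fun i => exists_relativePotential_le (hh i) (hc i) (hc0 i) hκ K B)
    (fun i C C' hCC' hP ρ hρ r hr q Q hQ =>
      (hP ρ hρ r hr q Q hQ).trans (mul_le_mul_of_nonneg_right hCC'
        (chiPotential_nonneg (hc0 i ρ (hκ.trans_le hρ.1)) r q Q)))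
  refine ⟨min 1 (α / 2), C + 1, lt_min one_pos (by linarith), by linarith, ?_⟩
  intro f W ρ q v hf hfp hW hWp hfK hgrad hweak hρ hm hrel
  have hpos : ∀ i x, 0 < f i x := fun i x => hκ.trans_le (hfK i x).1
  set N : Fin n → E3 → ℝ := fun i x =>
    ∑ k, c i (f i x) * pderiv k (f i) x * (q i x k - pderiv k (f i) x)
      + (∑ k, pderiv k (fun y => c i (f i y) * pderiv k (f i) y) x) * (ρ i x - f i x) with hN
  have hN' := fun i => integral_dual_eq_zero (hweak i) (hf i) (hfp i)
    (B := fun k y => c i (f i y) * pderiv k (f i) y)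
    (fun k => (contDiff_comp_pos ((hc i).of_le (by norm_num)) (contDiff_infty.1 (hf i) 1)
      (hpos i)).mul ((contDiff_infty.1 (hf i) 2).pderiv (by norm_num) k))
    (fun k j x => by
      have h1 := hfp i j x
      have h2 := (hfp i).pderiv k j x
      simp only [h1, h2])
  have hNi : IntegrableOn (fun x => ∑ i, N i x) (Domain.torus ℓ hℓ).cell :=
    integrable_finsetSum _ fun i _ => (hN' i).1
  have hN0 : ∫ x in (Domain.torus ℓ hℓ).cell, ∑ i, N i x = 0 :=
    (integral_finsetSum _ fun i _ => (hN' i).1).trans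
      (Finset.sum_eq_zero fun i _ => (hN' i).2)
  set X : E3 → ℝ := fun x => ∑ i, chiComponent (c i) (ρ i x) (f i x) (q i x)
        (gradient (f i) x) (v i x) (W x) with hX
  set Z : E3 → ℝ := fun x => ∑ i, relativeEnergyComponent (h i) (c i) (f i) W (ρ i x) (q i x)
        (v i x) x with hZ
  have hZN : ∀ x, Z x - ∑ i, N i x = ∑ i, (relativePotential (h i) (c i) (ρ i x) (f i x) (q i x)
      (gradient (f i) x) + 1 / 2 * ρ i x * ‖v i x - W x‖ ^ 2) := by
    intro x
    simp only [hZ, hN]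
    rw [← Finset.sum_sub_distrib]
    refine Finset.sum_congr rfl fun i _ => ?_
    rw [relativeEnergyComponent_eq (hc i) (hf i) (hpos i)]
    ring
  have hlow : ∀ᵐ x ∂volume.restrict (Domain.torus ℓ hℓ).cell,
      0 ≤ X x ∧ min 1 (α / 2) * X x ≤ Z x - ∑ i, N i x ∧ Z x - ∑ i, N i x ≤ (C + 1) * X x := by
    filter_upwards [ae_all_iff.2 hρ] with x hx
    have hρ0 : ∀ i, 0 < ρ i x := fun i => hκ.trans_le (hx i).1
    refine ⟨Finset.sum_nonneg fun i _ => chiComponent_nonneg (hρ0 i).le (hc0 i _ (hρ0 i)) _ _ _ _ _,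
      ?_, ?_⟩
    · rw [hZN, hX, Finset.mul_sum]
      refine Finset.sum_le_sum fun i _ => ?_
      have h1 := chiPotential_le_relativePotential (hh i) (hc i) (hc0 i)
        (fun r hr => (hstruct i r hr).2.1) (fun r hr => (hstruct i r hr).1) (hρ0 i) (hpos i x)
        (q i x) (gradient (f i) x)
      have h2 : min 1 (α / 2) * (1 / 2 * ρ i x * ‖v i x - W x‖ ^ 2)
          ≤ 1 * (1 / 2 * ρ i x * ‖v i x - W x‖ ^ 2) := by
        have := hρ0 i
        exact mul_le_mul_of_nonneg_right (min_le_left _ _) (by positivity)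
      unfold chiComponent
      linarith
    · rw [hZN, hX, Finset.mul_sum]
      refine Finset.sum_le_sum fun i _ => ?_
      have h1 := hC i (ρ i x) (hx i) (f i x) (hfK i x) (q i x) (gradient (f i) x) (hgrad i x)
      have h2 : 0 ≤ 1 / 2 * ρ i x * ‖v i x - W x‖ ^ 2 := by
        have := hρ0 i
        positivity
      have h3 := chiPotential_nonneg (hc0 i _ (hρ0 i)) (f i x) (q i x) (gradient (f i) x)
      unfold chiComponent
      nlinarith
  have hgradc : ∀ i, Continuous (gradient (f i)) := fun i =>
    (InnerProductSpace.toDual ℝ E3).symm.continuous.comp ((hf i).continuous_fderiv (by simp))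
  have hXm : AEStronglyMeasurable X (volume.restrict (Domain.torus ℓ hℓ).cell) := by
    refine Finset.aestronglyMeasurable_fun_sum _ fun i _ => ?_
    have hρm : AEStronglyMeasurable (ρ i) (volume.restrict (Domain.torus ℓ hℓ).cell) :=
      (hweak i).1.aestronglyMeasurable.restrict
    exact aestronglyMeasurable_chiComponent (hc i).continuousOn hκ hρm (hρ i)
      (hf i).continuous.aestronglyMeasurable (Eventually.of_forall (hfK i))
      (hweak i).2.1.aestronglyMeasurable.restrict (hgradc i).aestronglyMeasurable
      (aestronglyMeasurable_of_smul hκ hρm (hρ i) (hm i).aestronglyMeasurable)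
      hW.aestronglyMeasurable
  have ha : 0 < min 1 (α / 2) := lt_min one_pos (by linarith)
  have hZNi : IntegrableOn (fun x => Z x - ∑ i, N i x) (Domain.torus ℓ hℓ).cell := hrel.sub hNi
  -- Finiteness of `χ` is not assumed: the coercive lower bound derives it from the integrability of
  -- the relative energy.
  have hXi : IntegrableOn X (Domain.torus ℓ hℓ).cell := by
    refine (hZNi.const_mul (min 1 (α / 2))⁻¹).mono' hXm ?_
    filter_upwards [hlow] with x hx
    rw [Real.norm_of_nonneg hx.1, le_inv_mul_iff₀ ha]
    exact hx.2.1
  have hint : ∫ x in (Domain.torus ℓ hℓ).cell, Z x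
      = ∫ x in (Domain.torus ℓ hℓ).cell, (Z x - ∑ i, N i x) := by
    rw [integral_sub hrel hNi, hN0, sub_zero]
  refine ⟨hXi, ?_, ?_⟩
  · rw [hint, ← integral_const_mul]
    exact integral_mono_ae (hXi.const_mul _) hZNi (hlow.mono fun x hx => hx.2.1)
  · rw [hint, ← integral_const_mul]
    exact integral_mono_ae hZNi (hXi.const_mul _) (hlow.mono fun x hx => hx.2.2)

/-! ### Regularity in space and time -/

theorem uniqueDiffOn_slab {I : Set ℝ} (hI : UniqueDiffOn ℝ I) :
    UniqueDiffOn ℝ (I ×ˢ (univ : Set E3)) := hI.prod uniqueDiffOn_univ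

theorem contDiff_slice {V : Type*} [NormedAddCommGroup V] [NormedSpace ℝ V] {I : Set ℝ}
    {F : ℝ → E3 → V} {n : WithTop ℕ∞}
    (hF : ContDiffOn ℝ n (fun p : ℝ × E3 => F p.1 p.2) (I ×ˢ univ)) {t : ℝ} (ht : t ∈ I) :
    ContDiff ℝ n (F t) :=
  hF.comp_contDiff (f := fun x : E3 => (t, x)) (contDiff_const.prodMk contDiff_id)
    fun x => ⟨ht, mem_univ x⟩

/-- Formulated with derivatives within the slab, so that half-open time intervals are allowed and
space derivatives of the limit solution stay smooth up to time zero. -/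
theorem pderiv_slice {I : Set ℝ} {F : ℝ → E3 → ℝ}
    (hF : DifferentiableOn ℝ (fun p : ℝ × E3 => F p.1 p.2) (I ×ˢ univ)) (k : Fin 3)
    {p : ℝ × E3} (hp : p ∈ I ×ˢ (univ : Set E3)) :
    pderiv k (F p.1) p.2 = fderivWithin ℝ (fun p : ℝ × E3 => F p.1 p.2) (I ×ˢ univ) p
      (0, EuclideanSpace.single k 1) := by
  have h1 := (hF p hp).hasFDerivWithinAt
  have h2 : HasFDerivWithinAt (fun x : E3 => (p.1, x))
      ((0 : E3 →L[ℝ] ℝ).prod (ContinuousLinearMap.id ℝ E3)) univ p.2 :=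
    (hasFDerivWithinAt_const _ _ _).prodMk (hasFDerivWithinAt_id _ _)
  have h3 := HasFDerivWithinAt.comp (t := I ×ˢ (univ : Set E3)) p.2 h1 h2
    fun x _ => ⟨hp.1, mem_univ x⟩
  rw [hasFDerivWithinAt_univ] at h3
  have h4 : fderiv ℝ (F p.1) p.2 = _ := h3.fderiv
  simp [pderiv, h4]

theorem contDiffOn_pderiv {I : Set ℝ} (hI : UniqueDiffOn ℝ I) {F : ℝ → E3 → ℝ}
    {m n : WithTop ℕ∞} (hF : ContDiffOn ℝ n (fun p : ℝ × E3 => F p.1 p.2) (I ×ˢ univ))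
    (hmn : m + 1 ≤ n) (k : Fin 3) :
    ContDiffOn ℝ m (fun p : ℝ × E3 => pderiv k (F p.1) p.2) (I ×ˢ univ) := by
  have hn : n ≠ 0 := fun h => by simp [h] at hmn
  exact ((hF.fderivWithin (uniqueDiffOn_slab hI) hmn).clm_apply contDiffOn_const).congr
    fun p hp => pderiv_slice (hF.differentiableOn hn) k hp

theorem hasDerivAt_time {V : Type*} [NormedAddCommGroup V] [NormedSpace ℝ V] {I : Set ℝ}
    (hI : IsOpen I) {F : ℝ → E3 → V}
    (hF : DifferentiableOn ℝ (fun p : ℝ × E3 => F p.1 p.2) (I ×ˢ univ)) {t : ℝ} (ht : t ∈ I)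
    (x : E3) :
    HasDerivAt (fun s => F s x) (fderiv ℝ (fun p : ℝ × E3 => F p.1 p.2) (t, x) (1, 0)) t := by
  have h1 := (hF.differentiableAt ((hI.prod isOpen_univ).mem_nhds
    (show (t, x) ∈ I ×ˢ (univ : Set E3) from ⟨ht, mem_univ x⟩))).hasFDerivAt
  exact HasFDerivAt.comp_hasDerivAt t h1 ((hasDerivAt_id t).prodMk (hasDerivAt_const t x))

theorem contDiffOn_deriv_time {V : Type*} [NormedAddCommGroup V] [NormedSpace ℝ V] {I : Set ℝ}
    (hI : IsOpen I) {F : ℝ → E3 → V} {m n : WithTop ℕ∞}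
    (hF : ContDiffOn ℝ n (fun p : ℝ × E3 => F p.1 p.2) (I ×ˢ univ)) (hmn : m + 1 ≤ n) :
    ContDiffOn ℝ m (fun p : ℝ × E3 => deriv (fun s => F s p.2) p.1) (I ×ˢ univ) := by
  have hn : n ≠ 0 := fun h => by simp [h] at hmn
  exact ((hF.fderiv_of_isOpen (hI.prod isOpen_univ) hmn).clm_apply contDiffOn_const).congr
    fun p hp => (hasDerivAt_time hI (hF.differentiableOn hn) hp.1 p.2).deriv

/-- Time and space derivatives commute by the symmetry of the second derivative on space-time. -/
theorem hasDerivAt_pderiv_time {I : Set ℝ} (hI : IsOpen I) {F : ℝ → E3 → ℝ}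
    (hF : ContDiffOn ℝ 2 (fun p : ℝ × E3 => F p.1 p.2) (I ×ˢ univ)) {t : ℝ} (ht : t ∈ I)
    (k : Fin 3) (x : E3) :
    HasDerivAt (fun s => pderiv k (F s) x) (pderiv k (fun y => deriv (fun s => F s y) t) x) t := by
  set G : ℝ × E3 → ℝ := fun p => F p.1 p.2 with hG
  have hU : IsOpen (I ×ˢ (univ : Set E3)) := hI.prod isOpen_univ
  have hp : ((t, x) : ℝ × E3) ∈ I ×ˢ (univ : Set E3) := ⟨ht, mem_univ x⟩
  have hd : DifferentiableOn ℝ G (I ×ˢ univ) := hF.differentiableOn (by norm_num)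
  have hG2 : ContDiffAt ℝ 2 G (t, x) := hF.contDiffAt (hU.mem_nhds hp)
  have hdd : DifferentiableOn ℝ (fderiv ℝ G) (I ×ˢ univ) :=
    (hF.fderiv_of_isOpen hU (m := 1) (by norm_num)).differentiableOn (by norm_num)
  have hv : ∀ v : ℝ × E3, DifferentiableOn ℝ (fun p : ℝ × E3 => fderiv ℝ G (p.1, p.2) v)
      (I ×ˢ univ) := fun v => hdd.clm_apply (differentiableOn_const v)
  have hv' : ∀ v w : ℝ × E3, fderiv ℝ (fun p : ℝ × E3 => fderiv ℝ G (p.1, p.2) v) (t, x) w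
      = fderiv ℝ (fderiv ℝ G) (t, x) w v := fun v w => by
    have h1 := ((ContinuousLinearMap.apply ℝ ℝ v).hasFDerivAt).comp (t, x)
      (hdd.differentiableAt (hU.mem_nhds hp)).hasFDerivAt
    have h2 : fderiv ℝ (fun p : ℝ × E3 => fderiv ℝ G (p.1, p.2) v) (t, x) = _ := h1.fderiv
    rw [h2]
    rfl
  have hsymm := (hG2.isSymmSndFDerivAt (by simp)) (1, 0) (0, EuclideanSpace.single k 1)
  have e1 : pderiv k (fun y => deriv (fun s => F s y) t) x
      = fderiv ℝ (fderiv ℝ G) (t, x) (0, EuclideanSpace.single k 1) (1, 0) := by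
    have h1 : (fun y => deriv (fun s => F s y) t) = fun y => fderiv ℝ G (t, y) (1, 0) := by
      funext y
      exact (hasDerivAt_time hI hd ht y).deriv
    rw [h1]
    have h2 := pderiv_slice (F := fun s y => fderiv ℝ G (s, y) (1, 0)) (hv (1, 0)) k hp
    rw [fderivWithin_of_isOpen hU hp, hv'] at h2
    exact h2
  have h3 := hasDerivAt_time hI (F := fun s y => fderiv ℝ G (s, y) (0, EuclideanSpace.single k 1))
    (hv (0, EuclideanSpace.single k 1)) ht x
  rw [hv'] at h3
  rw [e1, ← hsymm]
  refine h3.congr_of_eventuallyEq ?_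
  filter_upwards [hI.mem_nhds ht] with s hs
  rw [pderiv_slice hd k (p := (s, x)) ⟨hs, mem_univ x⟩,
    fderivWithin_of_isOpen hU ⟨hs, mem_univ x⟩]

section

variable {h c : ℝ → ℝ} {I : Set ℝ} {F : ℝ → E3 → ℝ}

theorem contDiffOn_comp_slab {g : ℝ → ℝ} {n : WithTop ℕ∞} (hg : ContDiffOn ℝ n g (Ioi 0))
    (hF : ContDiffOn ℝ n (fun p : ℝ × E3 => F p.1 p.2) (I ×ˢ univ))
    (hpos : ∀ t ∈ I, ∀ x, 0 < F t x) :
    ContDiffOn ℝ n (fun p : ℝ × E3 => g (F p.1 p.2)) (I ×ˢ univ) :=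
  hg.comp hF fun p hp => hpos p.1 hp.1 p.2

theorem contDiffOn_potential (hI : UniqueDiffOn ℝ I) (hh : ContDiffOn ℝ 3 h (Ioi 0))
    (hc : ContDiffOn ℝ 3 c (Ioi 0))
    (hF : ContDiffOn ℝ ∞ (fun p : ℝ × E3 => F p.1 p.2) (I ×ˢ univ))
    (hpos : ∀ t ∈ I, ∀ x, 0 < F t x) :
    ContDiffOn ℝ 1 (fun p : ℝ × E3 => potential h c (F p.1) p.2) (I ×ˢ univ) := by
  have hh1 : ContDiffOn ℝ 2 (deriv h) (Ioi 0) := hh.deriv_of_isOpen isOpen_Ioi (by norm_num)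
  have hc1 : ContDiffOn ℝ 2 (deriv c) (Ioi 0) := hc.deriv_of_isOpen isOpen_Ioi (by norm_num)
  have hF1 := contDiffOn_infty.1 hF 1
  have h1 : ∀ k, ContDiffOn ℝ ∞ (fun p : ℝ × E3 => pderiv k (F p.1) p.2) (I ×ˢ univ) := fun k =>
    contDiffOn_pderiv hI hF (by simp) k
  have h2 : ∀ k, ContDiffOn ℝ 1 (fun p : ℝ × E3 => pderiv k (pderiv k (F p.1)) p.2) (I ×ˢ univ) :=
    fun k => contDiffOn_pderiv hI (F := fun t => pderiv k (F t)) (contDiffOn_infty.1 (h1 k) 2)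
      (by norm_num) k
  have h1' := fun k => contDiffOn_infty.1 (h1 k) 1
  exact ((contDiffOn_comp_slab (hh1.of_le (by norm_num)) hF1 hpos).sub
    ((contDiffOn_const.mul (contDiffOn_comp_slab (hc1.of_le (by norm_num)) hF1 hpos)).mul
      (ContDiffOn.sum fun k _ => (h1' k).pow 2))).sub
    ((contDiffOn_comp_slab (hc.of_le (by norm_num)) hF1 hpos).mul (ContDiffOn.sum fun k _ => h2 k))

theorem energyF_gradient (x : E3) (f : E3 → ℝ) :
    energyF h c (f x) (gradient f x) = h (f x) + 1 / 2 * c (f x) * ∑ k, pderiv k f x ^ 2 := by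
  simp only [energyF, norm_sq_eq_sum, gradient_apply]

theorem contDiffOn_energyF (hI : UniqueDiffOn ℝ I) (hh : ContDiffOn ℝ 3 h (Ioi 0))
    (hc : ContDiffOn ℝ 3 c (Ioi 0))
    (hF : ContDiffOn ℝ ∞ (fun p : ℝ × E3 => F p.1 p.2) (I ×ˢ univ))
    (hpos : ∀ t ∈ I, ∀ x, 0 < F t x) :
    ContDiffOn ℝ 1 (fun p : ℝ × E3 => energyF h c (F p.1 p.2) (gradient (F p.1) p.2))
      (I ×ˢ univ) := by
  have hF1 := contDiffOn_infty.1 hF 1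
  have h1 : ∀ k, ContDiffOn ℝ 1 (fun p : ℝ × E3 => pderiv k (F p.1) p.2) (I ×ˢ univ) := fun k =>
    contDiffOn_pderiv hI (contDiffOn_infty.1 hF 2) (by norm_num) k
  simp only [energyF_gradient]
  exact (contDiffOn_comp_slab (hh.of_le (by norm_num)) hF1 hpos).add
    ((contDiffOn_const.mul (contDiffOn_comp_slab (hc.of_le (by norm_num)) hF1 hpos)).mul
      (ContDiffOn.sum fun k _ => (h1 k).pow 2))

theorem hasDerivAt_comp_time {g : ℝ → ℝ} {n : WithTop ℕ∞} (hg : ContDiffOn ℝ n g (Ioi 0))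
    (hn : n ≠ 0) (hI : IsOpen I)
    (hF : ContDiffOn ℝ ∞ (fun p : ℝ × E3 => F p.1 p.2) (I ×ˢ univ))
    (hpos : ∀ t ∈ I, ∀ x, 0 < F t x) {t : ℝ} (ht : t ∈ I) (x : E3) :
    HasDerivAt (fun s => g (F s x)) (deriv g (F t x) * deriv (fun s => F s x) t) t :=
  (hasDerivAt_of_contDiffOn_Ioi hg hn (hpos t ht x)).comp t
    (hasDerivAt_time hI (hF.differentiableOn (by simp)) ht x).differentiableAt.hasDerivAt

theorem hasDerivAt_potential_time (hI : IsOpen I) (hh : ContDiffOn ℝ 3 h (Ioi 0))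
    (hc : ContDiffOn ℝ 3 c (Ioi 0))
    (hF : ContDiffOn ℝ ∞ (fun p : ℝ × E3 => F p.1 p.2) (I ×ˢ univ))
    (hpos : ∀ t ∈ I, ∀ x, 0 < F t x) {t : ℝ} (ht : t ∈ I) (x : E3) :
    HasDerivAt (fun s => potential h c (F s) x)
      (potentialLin h c (F t) (fun y => deriv (fun s => F s y) t) x) t := by
  have hh1 : ContDiffOn ℝ 2 (deriv h) (Ioi 0) := hh.deriv_of_isOpen isOpen_Ioi (by norm_num)
  have hc1 : ContDiffOn ℝ 2 (deriv c) (Ioi 0) := hc.deriv_of_isOpen isOpen_Ioi (by norm_num)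
  have hF2 := contDiffOn_infty.1 hF 2
  have d1 : ∀ k, HasDerivAt (fun s => pderiv k (F s) x)
      (pderiv k (fun y => deriv (fun s => F s y) t) x) t :=
    fun k => hasDerivAt_pderiv_time hI hF2 ht k x
  have d2 : ∀ k, HasDerivAt (fun s => pderiv k (pderiv k (F s)) x)
      (pderiv k (pderiv k (fun y => deriv (fun s => F s y) t)) x) t := by
    intro k
    have h1 := hasDerivAt_pderiv_time hI (F := fun s => pderiv k (F s))
      (contDiffOn_pderiv hI.uniqueDiffOn (contDiffOn_infty.1 hF 3) (by norm_num) k) ht k x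
    have h2 : (fun y => deriv (fun s => pderiv k (F s) y) t)
        = pderiv k (fun y => deriv (fun s => F s y) t) := by
      funext y
      exact (hasDerivAt_pderiv_time hI hF2 ht k y).deriv
    rwa [h2] at h1
  have a1 := hasDerivAt_comp_time hh1 (by norm_num) hI hF hpos ht x
  have a2 := hasDerivAt_comp_time hc1 (by norm_num) hI hF hpos ht x
  have a3 := hasDerivAt_comp_time hc (by norm_num) hI hF hpos ht x
  have s1 := HasDerivAt.fun_sum (u := Finset.univ) fun k _ => (d1 k).pow 2
  have s2 := HasDerivAt.fun_sum (u := Finset.univ) fun k _ => d2 k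
  have hfin := (a1.sub ((a2.const_mul (1 / 2)).mul s1)).sub (a3.mul s2)
  refine HasDerivAt.congr_deriv hfin ?_
  simp only [potentialLin, Fin.sum_univ_three, Pi.pow_apply]
  push_cast
  ring

theorem hasDerivAt_energyF_time (hI : IsOpen I) (hh : ContDiffOn ℝ 3 h (Ioi 0))
    (hc : ContDiffOn ℝ 3 c (Ioi 0))
    (hF : ContDiffOn ℝ ∞ (fun p : ℝ × E3 => F p.1 p.2) (I ×ˢ univ))
    (hpos : ∀ t ∈ I, ∀ x, 0 < F t x) {t : ℝ} (ht : t ∈ I) (x : E3) :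
    HasDerivAt (fun s => energyF h c (F s x) (gradient (F s) x))
      (energyLin h c (F t) (fun y => deriv (fun s => F s y) t) x) t := by
  have hF2 := contDiffOn_infty.1 hF 2
  have d1 : ∀ k, HasDerivAt (fun s => pderiv k (F s) x)
      (pderiv k (fun y => deriv (fun s => F s y) t) x) t :=
    fun k => hasDerivAt_pderiv_time hI hF2 ht k x
  have a1 := hasDerivAt_comp_time hh (by norm_num) hI hF hpos ht x
  have a3 := hasDerivAt_comp_time hc (by norm_num) hI hF hpos ht x
  have s1 := HasDerivAt.fun_sum (u := Finset.univ) fun k _ => (d1 k).pow 2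
  have hfin := a1.add ((a3.const_mul (1 / 2)).mul s1)
  simp only [energyF_gradient]
  refine HasDerivAt.congr_deriv hfin ?_
  simp only [energyLin, Fin.sum_univ_three, Pi.pow_apply]
  push_cast
  ring

end

/-! ### The smooth limit solution -/

/-- The limit momentum equation minus `w` times the sum of the mass equations, with `div S_i = -ρb_i
∇μ_i`. Only this weighted sum of defects vanishes in general, not the single ones. -/
theorem sum_smul_momentumDefect_eq_zero {n : ℕ} {D : Domain} {h c : Fin n → ℝ → ℝ}
    (hF : EnergyHypothesis h c) {T : ℝ} {ρb : Fin n → ℝ → E3 → ℝ} {w : ℝ → E3 → E3}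
    (hlim : IsSmoothLimitSolution D h c T ρb w) {t : ℝ} (ht : t ∈ Ioo 0 T)
    (hpos : ∀ i x, 0 < ρb i t x) (x : E3) :
    ∑ i, ρb i t x • momentumDefect (potential (h i) (c i) (ρb i t)) (w t)
      (fun y => deriv (fun s => w s y) t) x = 0 := by
  have hsub : Ioo (0 : ℝ) T ×ˢ (univ : Set E3) ⊆ Ico 0 T ×ˢ univ :=
    prod_mono Ioo_subset_Ico_self subset_rfl
  have hf : ∀ i, ContDiff ℝ ∞ (ρb i t) := fun i =>
    contDiff_slice (hlim.smooth_density i) (Ioo_subset_Ico_self ht)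
  have hw : ContDiff ℝ ∞ (w t) := contDiff_slice hlim.smooth_velocity (Ioo_subset_Ico_self ht)
  have hdt : ∀ i, HasDerivAt (fun s => ρb i s x) (deriv (fun s => ρb i s x) t) t := fun i =>
    (hasDerivAt_time isOpen_Ioo (((hlim.smooth_density i).mono hsub).differentiableOn (by simp))
      ht x).differentiableAt.hasDerivAt
  have hwt : HasDerivAt (fun s => w s x) (deriv (fun s => w s x) t) t :=
    (hasDerivAt_time isOpen_Ioo ((hlim.smooth_velocity.mono hsub).differentiableOn (by simp))
      ht x).differentiableAt.hasDerivAt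
  have hwtk : ∀ k : Fin 3, HasDerivAt (fun s => w s x k) (deriv (fun s => w s x) t k) t := fun k =>
    (EuclideanSpace.proj (𝕜 := ℝ) k).hasFDerivAt.comp_hasDerivAt t hwt
  have hfd : ∀ i, DifferentiableAt ℝ (ρb i t) x := fun i => (hf i).differentiable (by simp) x
  have hwk : ∀ k, DifferentiableAt ℝ (fun y => w t y k) x := fun k =>
    (contDiff_apply_of_contDiff hw k).differentiable (by simp) x
  ext k
  have hmom := hlim.momentum t ht x k
  have e1 := (HasDerivAt.fun_sum (u := Finset.univ) fun i _ => hdt i).mul (hwtk k)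
  have hmass : ∀ i, deriv (fun s => ρb i s x) t
      = -∑ j, (ρb i t x * pderiv j (fun y => w t y j) x + pderiv j (ρb i t) x * w t x j) := by
    intro i
    have h1 := hlim.mass i t ht x
    have h2 : divergence (fun y => ρb i t y • w t y) x
        = ∑ j, (ρb i t x * pderiv j (fun y => w t y j) x + pderiv j (ρb i t) x * w t x j) := by
      refine Finset.sum_congr rfl fun j _ => ?_
      simp only [PiLp.smul_apply, smul_eq_mul]
      rw [pderiv_mul (hfd i) (hwk j)]
      ring
    linarith
  have hsumd : DifferentiableAt ℝ (fun y => ∑ i, ρb i t y) x :=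
    DifferentiableAt.fun_sum fun i _ => hfd i
  have hconv : ∀ j, pderiv j (fun y => (∑ i, ρb i t y) * w t y k * w t y j) x
      = (∑ i, pderiv j (ρb i t) x) * w t x k * w t x j
        + (∑ i, ρb i t x) * pderiv j (fun y => w t y k) x * w t x j
        + (∑ i, ρb i t x) * w t x k * pderiv j (fun y => w t y j) x := by
    intro j
    rw [pderiv_mul (f := fun y => (∑ i, ρb i t y) * w t y k) (hsumd.mul (hwk k)) (hwk j),
      pderiv_mul hsumd (hwk k), pderiv_sum fun i _ => hfd i]
    ring
  have hst : ∑ j, pderiv j (fun y => (∑ i, stressTensor (h i) (c i) (ρb i t) y) k j) x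
      = ∑ i, -(ρb i t x * pderiv k (potential (h i) (c i) (ρb i t)) x) := by
    have h1 := fun i => sum_pderiv_stressTensor (hF.1 i) (hF.2.1 i) (hf i) (hpos i) k
    have h2 : ∀ j, pderiv j (fun y => (∑ i, stressTensor (h i) (c i) (ρb i t) y) k j) x
        = ∑ i, pderiv j (fun y => stressTensor (h i) (c i) (ρb i t) y k j) x := by
      intro j
      simp only [Matrix.sum_apply]
      exact pderiv_sum fun i _ => (h1 i).1 j x
    simp only [h2]
    rw [Finset.sum_comm]
    exact Finset.sum_congr rfl fun i _ => (h1 i).2 x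
  have e1' : deriv (fun s => (∑ i, ρb i s x) * w s x k) t = _ := e1.deriv
  rw [e1', hst] at hmom
  simp only [hconv, hmass] at hmom
  simp only [momentumDefect, PiLp.zero_apply, WithLp.ofLp_sum, Finset.sum_apply, PiLp.smul_apply,
    smul_eq_mul]
  have key : ∀ i, ρb i t x * (deriv (fun s => w s x) t k
      + ∑ j, w t x j * pderiv j (fun y => w t y k) x
        + pderiv k (potential (h i) (c i) (ρb i t)) x)
      = ρb i t x * (deriv (fun s => w s x) t k + ∑ j, w t x j * pderiv j (fun y => w t y k) x)
        + ρb i t x * pderiv k (potential (h i) (c i) (ρb i t)) x := fun i => by ring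
  rw [Finset.sum_congr rfl fun i _ => key i, Finset.sum_add_distrib, ← Finset.sum_mul]
  simp only [Finset.sum_neg_distrib, Fin.sum_univ_three, Finset.sum_add_distrib,
    ← Finset.sum_mul] at hmom ⊢
  linear_combination hmom

/-! ### Boundedness calculus for the limit solution -/

/-- `F` is bounded on `s`. -/
def IsBddOn {X : Type*} (s : Set X) (F : X → ℝ) : Prop := ∃ B, ∀ p ∈ s, |F p| ≤ B

section

variable {X : Type*} {s : Set X} {F G : X → ℝ}

theorem IsBddOn.add (hF : IsBddOn s F) (hG : IsBddOn s G) : IsBddOn s fun p => F p + G p := by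
  obtain ⟨A, hA⟩ := hF
  obtain ⟨B, hB⟩ := hG
  exact ⟨A + B, fun p hp => (abs_add_le _ _).trans (add_le_add (hA p hp) (hB p hp))⟩

theorem IsBddOn.mul (hF : IsBddOn s F) (hG : IsBddOn s G) : IsBddOn s fun p => F p * G p := by
  obtain ⟨A, hA⟩ := hF
  obtain ⟨B, hB⟩ := hG
  refine ⟨A * B, fun p hp => ?_⟩
  rw [abs_mul]
  exact mul_le_mul (hA p hp) (hB p hp) (abs_nonneg _) ((abs_nonneg _).trans (hA p hp))

theorem isBddOn_const (a : ℝ) : IsBddOn s fun _ => a := ⟨|a|, fun _ _ => le_rfl⟩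

theorem IsBddOn.neg (hF : IsBddOn s F) : IsBddOn s fun p => -F p := by
  obtain ⟨A, hA⟩ := hF
  exact ⟨A, fun p hp => by rw [abs_neg]; exact hA p hp⟩

theorem IsBddOn.sub (hF : IsBddOn s F) (hG : IsBddOn s G) : IsBddOn s fun p => F p - G p := by
  simpa only [sub_eq_add_neg] using hF.add hG.neg

theorem IsBddOn.sq (hF : IsBddOn s F) : IsBddOn s fun p => F p ^ 2 := by
  simpa only [_root_.sq] using hF.mul hF

theorem IsBddOn.sum {ι : Type*} (t : Finset ι) {F : ι → X → ℝ} (hF : ∀ i, IsBddOn s (F i)) :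
    IsBddOn s fun p => ∑ i ∈ t, F i p := by
  choose A hA using hF
  exact ⟨∑ i ∈ t, A i, fun p hp => (Finset.abs_sum_le_sum_abs _ _).trans
    (Finset.sum_le_sum fun i _ => hA i p hp)⟩

theorem IsBddOn.congr (hF : IsBddOn s F) (h : ∀ p ∈ s, G p = F p) : IsBddOn s G := by
  obtain ⟨A, hA⟩ := hF
  exact ⟨A, fun p hp => by rw [h p hp]; exact hA p hp⟩

/-- The hypotheses bound the total momentum instead of the velocity; division by the total density,
which is at least `κ`, passes to the velocity. -/
theorem IsBddOn.of_mul_left {κ : ℝ} (hκ : 0 < κ) (hG : ∀ p ∈ s, κ ≤ G p)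
    (hF : IsBddOn s fun p => G p * F p) : IsBddOn s F := by
  obtain ⟨A, hA⟩ := hF
  refine ⟨A / κ, fun p hp => ?_⟩
  rw [le_div_iff₀ hκ]
  have h1 := hA p hp
  rw [abs_mul, abs_of_pos (hκ.trans_le (hG p hp))] at h1
  nlinarith [hG p hp, abs_nonneg (F p)]

theorem IsBddOn.comp_pos {g : ℝ → ℝ} (hg : ContinuousOn g (Ioi 0)) {κ : ℝ} (hκ : 0 < κ)
    (hF : IsBddOn s F) (hlow : ∀ p ∈ s, κ ≤ F p) : IsBddOn s fun p => g (F p) := by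
  obtain ⟨A, hA⟩ := hF
  obtain ⟨G, -, hG⟩ := exists_bound_Icc hg hκ A
  exact ⟨G, fun p hp => hG _ ⟨hlow p hp, (le_abs_self _).trans (hA p hp)⟩⟩

theorem exists_common_bound {ι : Type*} [Fintype ι] {F : ι → X → ℝ} (hF : ∀ i, IsBddOn s (F i)) :
    ∃ B, 0 ≤ B ∧ ∀ i, ∀ p ∈ s, |F i p| ≤ B := by
  choose A hA using hF
  refine ⟨∑ i, |A i|, Finset.sum_nonneg fun i _ => abs_nonneg _, fun i p hp => ?_⟩
  exact ((hA i p hp).trans (le_abs_self _)).trans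
    (Finset.single_le_sum (f := fun i => |A i|) (fun j _ => abs_nonneg _) (Finset.mem_univ i))

end

theorem norm_iteratedFDeriv_pderiv_le {f : E3 → ℝ} (hf : ContDiff ℝ ∞ f) (k : Fin 3) (m : ℕ)
    (x : E3) : ‖iteratedFDeriv ℝ m (pderiv k f) x‖ ≤ ‖iteratedFDeriv ℝ (m + 1) f x‖ := by
  rw [← norm_iteratedFDeriv_fderiv]
  have h1 : ContDiff ℝ m (fderiv ℝ f) := (contDiff_infty.1 hf (m + 1)).fderiv_right (by norm_num)
  refine ((ContinuousLinearMap.apply ℝ ℝ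
    (EuclideanSpace.single k (1 : ℝ) : E3)).norm_iteratedFDeriv_comp_left h1.contDiffAt
    le_rfl).trans ?_
  refine mul_le_of_le_one_left (norm_nonneg _) ?_
  refine ContinuousLinearMap.opNorm_le_bound _ zero_le_one fun L => ?_
  have h2 := L.le_opNorm (EuclideanSpace.single k (1 : ℝ) : E3)
  simp only [ContinuousLinearMap.apply_apply, PiLp.norm_single, norm_one, mul_one] at h2 ⊢
  linarith

theorem norm_iteratedFDeriv_apply_le {W : E3 → E3} (hW : ContDiff ℝ ∞ W) (k : Fin 3) (m : ℕ)
    (x : E3) : ‖iteratedFDeriv ℝ m (fun y => W y k) x‖ ≤ ‖iteratedFDeriv ℝ m W x‖ := by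
  refine ((EuclideanSpace.proj (𝕜 := ℝ) k).norm_iteratedFDeriv_comp_left
    (contDiff_infty.1 hW m).contDiffAt le_rfl).trans ?_
  refine mul_le_of_le_one_left (norm_nonneg _) ?_
  exact ContinuousLinearMap.opNorm_le_bound _ zero_le_one fun u => by
    simpa using abs_apply_le_norm u k

/-- Uniform bounds for the smooth limit solution. -/
theorem exists_limit_bounds {n : ℕ} (hn : 0 < n) {D : Domain} {h c : Fin n → ℝ → ℝ}
    (hF : EnergyHypothesis h c) {T κ : ℝ} (hκ : 0 < κ) {ρb : Fin n → ℝ → E3 → ℝ}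
    {w : ℝ → E3 → E3} (hlim : IsSmoothLimitSolution D h c T ρb w) (hbd : LimitBounds T ρb w)
    (hlow : ∀ i, ∀ t ∈ Ioo 0 T, ∀ x, κ ≤ ρb i t x) :
    ∃ B : ℝ, 0 ≤ B ∧ ∀ t ∈ Ioo 0 T, ∀ x,
      (∀ i, ρb i t x ≤ B) ∧ (∀ i, ‖gradient (ρb i t) x‖ ≤ B) ∧
      (∀ j k, |pderiv j (fun y => w t y k) x| ≤ B) ∧ (∀ k, |pderiv k (divergence (w t)) x| ≤ B) ∧
      ∀ i, ‖momentumDefect (potential (h i) (c i) (ρb i t)) (w t)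
        (fun y => deriv (fun s => w s y) t) x‖ ≤ B := by
  obtain ⟨B, hB⟩ := hbd
  set s : Set (ℝ × E3) := Ioo 0 T ×ˢ univ with hs
  have hsub : s ⊆ Ico 0 T ×ˢ univ := prod_mono Ioo_subset_Ico_self subset_rfl
  have hf : ∀ i, ∀ p ∈ s, ContDiff ℝ ∞ (ρb i p.1) := fun i p hp =>
    contDiff_slice (hlim.smooth_density i) (Ioo_subset_Ico_self hp.1)
  have hw : ∀ p ∈ s, ContDiff ℝ ∞ (w p.1) := fun p hp =>
    contDiff_slice hlim.smooth_velocity (Ioo_subset_Ico_self hp.1)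
  have hwk : ∀ k, ∀ p ∈ s, ContDiff ℝ ∞ fun y => w p.1 y k := fun k p hp =>
    contDiff_apply_of_contDiff (hw p hp) k
  set R : ℝ × E3 → ℝ := fun p => ∑ i, ρb i p.1 p.2 with hR
  have hRs : ∀ p ∈ s, ContDiff ℝ ∞ fun y => ∑ i, ρb i p.1 y := fun p hp =>
    ContDiff.sum fun i _ => hf i p hp
  -- A single component already provides the lower bound, which is why `n` must be positive.
  have hRlow : ∀ p ∈ s, κ ≤ R p := fun p hp => by
    have h1 : ∀ i, κ ≤ ρb i p.1 p.2 := fun i => hlow i p.1 hp.1 p.2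
    exact (h1 ⟨0, hn⟩).trans (Finset.single_le_sum (f := fun i => ρb i p.1 p.2)
      (fun j _ => hκ.le.trans (h1 j)) (Finset.mem_univ _))
  have b0 : ∀ i, IsBddOn s fun p => ρb i p.1 p.2 := fun i => ⟨B, fun p hp => by
    simpa using ((hB p.1 hp.1 p.2).1 i).2 0 (by norm_num)⟩
  have b1 : ∀ i k, IsBddOn s fun p => pderiv k (ρb i p.1) p.2 := fun i k => ⟨B, fun p hp => by
    have h1 := norm_iteratedFDeriv_pderiv_le (hf i p hp) k 0 p.2
    simpa using h1.trans (((hB p.1 hp.1 p.2).1 i).2 1 (by norm_num))⟩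
  have b2 : ∀ i j k, IsBddOn s fun p => pderiv j (pderiv k (ρb i p.1)) p.2 := fun i j k =>
    ⟨B, fun p hp => by
      have h1 := norm_iteratedFDeriv_pderiv_le ((hf i p hp).pderiv (m := ∞) (by simp) k) j 0 p.2
      have h2 := norm_iteratedFDeriv_pderiv_le (hf i p hp) k 1 p.2
      simpa using (h1.trans h2).trans (((hB p.1 hp.1 p.2).1 i).2 2 (by norm_num))⟩
  have b3 : ∀ i j k l, IsBddOn s fun p => pderiv j (pderiv k (pderiv l (ρb i p.1))) p.2 :=
    fun i j k l => ⟨B, fun p hp => by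
      have hl := (hf i p hp).pderiv (m := ∞) (by simp) l
      have h1 := norm_iteratedFDeriv_pderiv_le (hl.pderiv (m := ∞) (by simp) k) j 0 p.2
      have h2 := norm_iteratedFDeriv_pderiv_le hl k 1 p.2
      have h3 := norm_iteratedFDeriv_pderiv_le (hf i p hp) l 2 p.2
      simpa using ((h1.trans h2).trans h3).trans (((hB p.1 hp.1 p.2).1 i).2 3 (by norm_num))⟩
  have bt : ∀ i, IsBddOn s fun p => deriv (fun t => ρb i t p.2) p.1 := fun i =>
    ⟨B, fun p hp => ((hB p.1 hp.1 p.2).1 i).1⟩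
  have R1 : ∀ j, ∀ p ∈ s, pderiv j (fun y => ∑ i, ρb i p.1 y) p.2
      = ∑ i, pderiv j (ρb i p.1) p.2 := fun j p hp =>
    pderiv_sum fun i _ => (hf i p hp).differentiable (by simp) _
  have hm : ∀ p ∈ s, ContDiff ℝ ∞ fun y => (∑ i, ρb i p.1 y) • w p.1 y := fun p hp =>
    (hRs p hp).smul (hw p hp)
  have m0 : ∀ k, IsBddOn s fun p => R p * w p.1 p.2 k := fun k => ⟨B, fun p hp => by
    have h1 := norm_iteratedFDeriv_apply_le (hm p hp) k 0 p.2
    simpa using h1.trans ((hB p.1 hp.1 p.2).2.2 0 (by norm_num))⟩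
  have m1 : ∀ j k, IsBddOn s fun p => pderiv j (fun y => (∑ i, ρb i p.1 y) * w p.1 y k) p.2 :=
    fun j k => ⟨B, fun p hp => by
      have h0 := norm_iteratedFDeriv_pderiv_le (contDiff_apply_of_contDiff (hm p hp) k) j 0 p.2
      have h1 := norm_iteratedFDeriv_apply_le (hm p hp) k 1 p.2
      simpa using (h0.trans h1).trans ((hB p.1 hp.1 p.2).2.2 1 (by norm_num))⟩
  have m2 : ∀ l j k, IsBddOn s fun p =>
      pderiv l (pderiv j (fun y => (∑ i, ρb i p.1 y) * w p.1 y k)) p.2 :=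
    fun l j k => ⟨B, fun p hp => by
      have hk := contDiff_apply_of_contDiff (hm p hp) k
      have h0 := norm_iteratedFDeriv_pderiv_le (hk.pderiv (m := ∞) (by simp) j) l 0 p.2
      have h0' := norm_iteratedFDeriv_pderiv_le hk j 1 p.2
      have h1 := norm_iteratedFDeriv_apply_le (hm p hp) k 2 p.2
      simpa using ((h0.trans h0').trans h1).trans ((hB p.1 hp.1 p.2).2.2 2 (by norm_num))⟩
  have bR1 : ∀ j, IsBddOn s fun p => pderiv j (fun y => ∑ i, ρb i p.1 y) p.2 := fun j =>
    (IsBddOn.sum Finset.univ fun i => b1 i j).congr (R1 j)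
  -- The velocity and its derivatives are bounded recursively: in the product rule for `R w` every
  -- term except the highest derivative of `w`, multiplied by `R`, is already bounded.
  have w0 : ∀ k, IsBddOn s fun p => w p.1 p.2 k := fun k => (m0 k).of_mul_left hκ hRlow
  have hprod : ∀ j k, ∀ p ∈ s, ∀ x, pderiv j (fun y => (∑ i, ρb i p.1 y) * w p.1 y k) x
      = (∑ i, ρb i p.1 x) * pderiv j (fun y => w p.1 y k) x
        + w p.1 x k * pderiv j (fun y => ∑ i, ρb i p.1 y) x := fun j k p hp x =>
    pderiv_mul ((hRs p hp).differentiable (by simp) x) ((hwk k p hp).differentiable (by simp) x)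
  have w1 : ∀ j k, IsBddOn s fun p => pderiv j (fun y => w p.1 y k) p.2 := fun j k =>
    (((m1 j k).sub ((w0 k).mul (bR1 j))).congr fun p hp => by
      simp only [hprod j k p hp]; ring).of_mul_left hκ hRlow
  have bR2 : ∀ l j, IsBddOn s fun p => pderiv l (pderiv j (fun y => ∑ i, ρb i p.1 y)) p.2 :=
    fun l j => (IsBddOn.sum Finset.univ fun i => b2 i l j).congr fun p hp => by
      have h1 : pderiv j (fun y => ∑ i, ρb i p.1 y) = fun x => ∑ i, pderiv j (ρb i p.1) x :=
        funext fun x => R1 j (p.1, x) ⟨hp.1, mem_univ x⟩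
      rw [h1]
      exact pderiv_sum fun i _ =>
        ((hf i p hp).pderiv (m := ∞) (by simp) j).differentiable (by simp) _
  have w2 : ∀ l j k, IsBddOn s fun p => pderiv l (pderiv j (fun y => w p.1 y k)) p.2 :=
    fun l j k => (((((m2 l j k).sub ((w1 j k).mul (bR1 l))).sub ((w0 k).mul (bR2 l j))).sub
      ((bR1 j).mul (w1 l k))).congr fun p hp => by
        have e := funext (hprod j k p hp)
        have d1 := ((hwk k p hp).pderiv (m := ∞) (by simp) j).differentiable (by simp) p.2
        have d2 := ((hRs p hp).pderiv (m := ∞) (by simp) j).differentiable (by simp) p.2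
        have d3 := (hRs p hp).differentiable (by simp) p.2
        have d4 := (hwk k p hp).differentiable (by simp) p.2
        rw [e, pderiv_add (f := fun y => (∑ i, ρb i p.1 y) * pderiv j (fun y => w p.1 y k) y)
          (g := fun y => w p.1 y k * pderiv j (fun y => ∑ i, ρb i p.1 y) y) (d3.mul d1)
          (d4.mul d2), pderiv_mul d3 d1, pderiv_mul d4 d2]
        ring).of_mul_left hκ hRlow
  have hdt : ∀ i, ∀ p ∈ s, HasDerivAt (fun t => ρb i t p.2) (deriv (fun t => ρb i t p.2) p.1) p.1 :=
    fun i p hp => (hasDerivAt_time isOpen_Ioo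
      (((hlim.smooth_density i).mono hsub).differentiableOn (by simp))
      hp.1 p.2).differentiableAt.hasDerivAt
  have hwt : ∀ p ∈ s, HasDerivAt (fun t => w t p.2) (deriv (fun t => w t p.2) p.1) p.1 :=
    fun p hp => (hasDerivAt_time isOpen_Ioo
      ((hlim.smooth_velocity.mono hsub).differentiableOn (by simp))
      hp.1 p.2).differentiableAt.hasDerivAt
  have wt : ∀ k, IsBddOn s fun p => deriv (fun t => w t p.2) p.1 k := fun k => by
    have mt : IsBddOn s fun p => deriv (fun t => (∑ i, ρb i t p.2) • w t p.2) p.1 k :=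
      ⟨B, fun p hp => (abs_apply_le_norm _ k).trans (hB p.1 hp.1 p.2).2.1⟩
    refine ((mt.sub ((IsBddOn.sum Finset.univ bt).mul (w0 k))).congr fun p hp => ?_).of_mul_left
      hκ hRlow
    have h1 := ((HasDerivAt.fun_sum (u := Finset.univ) fun i _ => hdt i p hp).smul
      (hwt p hp)).deriv
    have h2 : deriv (fun t => (∑ i, ρb i t p.2) • w t p.2) p.1 = _ := h1
    rw [h2]
    simp [hR]
  have cc : ∀ {g : ℝ → ℝ}, ContinuousOn g (Ioi 0) → ∀ i, IsBddOn s fun p => g (ρb i p.1 p.2) :=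
    fun hg i => (b0 i).comp_pos hg hκ fun p hp => hlow i p.1 hp.1 p.2
  have bμ : ∀ i k, IsBddOn s fun p => pderiv k (potential (h i) (c i) (ρb i p.1)) p.2 := by
    intro i k
    have hh1 : ContDiffOn ℝ 2 (deriv (h i)) (Ioi 0) :=
      (hF.1 i).deriv_of_isOpen isOpen_Ioi (by norm_num)
    have hc1 : ContDiffOn ℝ 2 (deriv (c i)) (Ioi 0) :=
      (hF.2.1 i).deriv_of_isOpen isOpen_Ioi (by norm_num)
    have hh2 := (hh1.deriv_of_isOpen isOpen_Ioi (m := 1) (by norm_num)).continuousOn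
    have hc2 := (hc1.deriv_of_isOpen isOpen_Ioi (m := 1) (by norm_num)).continuousOn
    refine IsBddOn.congr ?_ fun p hp => pderiv_potential (hF.1 i) (hF.2.1 i) (hf i p hp)
      (fun x => hκ.trans_le (hlow i p.1 hp.1 x)) k p.2
    exact (((((cc hh2 i).mul (b1 i k)).sub ((((isBddOn_const _).mul (cc hc2 i)).mul
      (b1 i k)).mul (((b1 i 0).sq.add (b1 i 1).sq).add (b1 i 2).sq))).sub
      ((cc hc1.continuousOn i).mul ((((b1 i 0).mul (b2 i k 0)).add ((b1 i 1).mul (b2 i k 1))).add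
        ((b1 i 2).mul (b2 i k 2))))).sub (((cc hc1.continuousOn i).mul (b1 i k)).mul
        (((b2 i 0 0).add (b2 i 1 1)).add (b2 i 2 2)))).sub
      ((cc (hF.2.1 i).continuousOn i).mul (((b3 i k 0 0).add (b3 i k 1 1)).add (b3 i k 2 2)))
  have bM : ∀ (ik : Fin n × Fin 3), IsBddOn s fun p =>
      momentumDefect (potential (h ik.1) (c ik.1) (ρb ik.1 p.1)) (w p.1)
        (fun y => deriv (fun s => w s y) p.1) p.2 ik.2 := fun ik =>
    ((wt ik.2).add (IsBddOn.sum Finset.univ fun j => (w0 j).mul (w1 j ik.2))).add (bμ ik.1 ik.2)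
  have bdiv : ∀ k, IsBddOn s fun p => pderiv k (divergence (w p.1)) p.2 := fun k =>
    (IsBddOn.sum Finset.univ fun l => w2 k l l).congr fun p hp =>
      pderiv_divergence (contDiff_infty.1 (hw p hp) 2) k p.2
  have hnorm : ∀ (u : E3) (A : ℝ), (∀ k, |u k| ≤ A) → ‖u‖ ≤ 3 * A := by
    intro u A hu
    have hA : 0 ≤ A := (abs_nonneg _).trans (hu 0)
    refine le_of_sq_le_sq ?_ (by positivity)
    rw [norm_sq_eq_sum, Fin.sum_univ_three]
    have := fun k => sq_le_sq' (abs_le.1 (hu k)).1 (abs_le.1 (hu k)).2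
    nlinarith [this 0, this 1, this 2]
  obtain ⟨B₀, h₀, hB₀⟩ := exists_common_bound b0
  obtain ⟨B₁, h₁, hB₁⟩ := exists_common_bound fun ik : Fin n × Fin 3 => b1 ik.1 ik.2
  obtain ⟨B₂, h₂, hB₂⟩ := exists_common_bound fun jk : Fin 3 × Fin 3 => w1 jk.1 jk.2
  obtain ⟨B₃, h₃, hB₃⟩ := exists_common_bound bdiv
  obtain ⟨B₄, h₄, hB₄⟩ := exists_common_bound bM
  refine ⟨B₀ + 3 * B₁ + B₂ + B₃ + 3 * B₄, by positivity, fun t ht x => ?_⟩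
  have hp : ((t, x) : ℝ × E3) ∈ s := ⟨ht, mem_univ x⟩
  refine ⟨fun i => ?_, fun i => ?_, fun j k => ?_, fun k => ?_, fun i => ?_⟩
  · have := (le_abs_self _).trans (hB₀ i _ hp)
    simp only at this
    linarith
  · refine (hnorm _ B₁ fun k => ?_).trans (by linarith)
    rw [gradient_apply]
    exact hB₁ (i, k) _ hp
  · exact (hB₂ (j, k) _ hp).trans (by linarith)
  · exact (hB₃ k _ hp).trans (by linarith)
  · exact (hnorm _ B₄ fun k => hB₄ (i, k) _ hp).trans (by linarith)

/-! ### Integration over space-time slabs -/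

section

variable {ℓ : ℝ} {hℓ : 0 < ℓ} {T A B : ℝ}

/-- The product of a time interval and a periodicity cell. -/
def slab (ℓ : ℝ) (hℓ : 0 < ℓ) (A B : ℝ) : Set (ℝ × E3) := Icc A B ×ˢ (Domain.torus ℓ hℓ).cell

theorem measurableSet_slab : MeasurableSet (slab ℓ hℓ A B) :=
  measurableSet_Icc.prod (measurableSet_cell _)

theorem slab_subset : slab ℓ hℓ A B ⊆ Icc A B ×ˢ closedCell ℓ :=
  prod_mono subset_rfl (cell_subset_closedCell ℓ hℓ)

theorem isCompact_closedSlab : IsCompact (Icc A B ×ˢ closedCell ℓ) :=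
  isCompact_Icc.prod (isCompact_closedCell ℓ)

theorem restrict_slab : (volume : Measure (ℝ × E3)).restrict (slab ℓ hℓ A B)
    = (volume.restrict (Icc A B)).prod (volume.restrict (Domain.torus ℓ hℓ).cell) := by
  rw [Measure.prod_restrict, slab, Measure.volume_eq_prod]

theorem isFiniteMeasure_cell :
    IsFiniteMeasure (volume.restrict (Domain.torus ℓ hℓ).cell) :=
  ⟨by rw [Measure.restrict_apply_univ]; exact volume_cell_lt_top ℓ hℓ⟩

theorem isFiniteMeasure_slab :
    IsFiniteMeasure ((volume : Measure (ℝ × E3)).restrict (slab ℓ hℓ A B)) := by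
  have := isFiniteMeasure_cell (ℓ := ℓ) (hℓ := hℓ)
  rw [restrict_slab]
  infer_instance

theorem integrableOn_slab_of_locL1 {V : Type*} [NormedAddCommGroup V] {f : ℝ → E3 → V}
    (hf : LocL1 f) (hA : 0 < A) :
    IntegrableOn (fun p : ℝ × E3 => f p.1 p.2) (slab ℓ hℓ A B) :=
  (LocallyIntegrableOn.integrableOn_compact_subset hf
    (prod_mono (fun _ ht => hA.le.trans ht.1) (subset_univ _)) isCompact_closedSlab).mono_set
    slab_subset

theorem integrableOn_slab_mul {u g : ℝ × E3 → ℝ} (hu : IntegrableOn u (slab ℓ hℓ A B))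
    (hg : ContinuousOn g (Ioo 0 T ×ˢ univ)) (hA : 0 < A) (hB : B < T) :
    IntegrableOn (fun p => u p * g p) (slab ℓ hℓ A B) :=
  hu.mul_continuousOn_of_subset
    (hg.mono (prod_mono (fun _ ht => ⟨hA.trans_le ht.1, ht.2.trans_lt hB⟩) (subset_univ _)))
    measurableSet_slab isCompact_closedSlab slab_subset

theorem integrableOn_slab_of_continuousOn {g : ℝ × E3 → ℝ}
    (hg : ContinuousOn g (Ioo 0 T ×ˢ univ)) (hA : 0 < A) (hB : B < T) :
    IntegrableOn g (slab ℓ hℓ A B) :=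
  ((hg.mono (prod_mono (fun _ ht => ⟨hA.trans_le ht.1, ht.2.trans_lt hB⟩)
    (subset_univ _))).integrableOn_compact isCompact_closedSlab).mono_set slab_subset

theorem setIntegral_slab {f : ℝ × E3 → ℝ} (hf : IntegrableOn f (slab ℓ hℓ A B)) :
    ∫ p in slab ℓ hℓ A B, f p
      = ∫ t in Icc A B, ∫ x in (Domain.torus ℓ hℓ).cell, f (t, x) := by
  rw [IntegrableOn, restrict_slab] at hf
  rw [restrict_slab]
  exact integral_prod f hf

/-- An integral over all positive times of a function supported in a slab. -/
theorem integral_Ioi_eq_slab {f : ℝ × E3 → ℝ} (hf : IntegrableOn f (slab ℓ hℓ A B)) (hA : 0 < A)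
    (h0 : ∀ t, t ∉ Icc A B → ∀ x, f (t, x) = 0) :
    ∫ t in Ioi 0, ∫ x in (Domain.torus ℓ hℓ).cell, f (t, x) = ∫ p in slab ℓ hℓ A B, f p := by
  rw [setIntegral_slab hf]
  refine setIntegral_eq_of_subset_of_forall_sdiff_eq_zero measurableSet_Ioi
    (fun t ht => hA.trans_le ht.1) fun t ht => ?_
  simp [h0 t ht.2]

/-- Passing from almost every `x` at each time to almost every `(t, x)` needs a measurable
exceptional set, so Fubini is applied to a measurable representative. -/
theorem ae_slab_of_forall_ae {ρ : ℝ → E3 → ℝ} {κ K : ℝ}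
    (hm : AEStronglyMeasurable (fun p : ℝ × E3 => ρ p.1 p.2) (volume.restrict (slab ℓ hℓ A B)))
    (h : ∀ t ∈ Icc A B, ∀ᵐ x, κ ≤ ρ t x ∧ ρ t x ≤ K) :
    ∀ᵐ p ∂volume.restrict (slab ℓ hℓ A B), ρ p.1 p.2 ∈ Icc κ K := by
  have e := hm.ae_eq_mk
  have hs := hm.stronglyMeasurable_mk.measurable (measurableSet_Icc (a := κ) (b := K))
  set r := hm.mk _ with hr
  have h1 : ∀ᵐ p ∂volume.restrict (slab ℓ hℓ A B), r p ∈ Icc κ K := by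
    rw [restrict_slab] at e ⊢
    refine (Measure.ae_prod_iff_ae_ae hs).2 ?_
    filter_upwards [Measure.ae_ae_of_ae_prod e, ae_restrict_mem measurableSet_Icc] with t ht ht'
    filter_upwards [ht, ae_restrict_of_ae (h t ht')] with x hx hx'
    rw [← hx]
    exact hx'
  filter_upwards [e, h1] with p hp hp'
  rw [hp]
  exact hp'

/-- A function on an open slab that vanishes outside a smaller slab is as smooth as it is there. -/
theorem contDiff_of_vanishing {V : Type*} [NormedAddCommGroup V] [NormedSpace ℝ V]
    {n : WithTop ℕ∞} {G : ℝ × E3 → V} {a b : ℝ} (ha : 0 < a) (hb : b < T)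
    (hG : ContDiffOn ℝ n G (Ioo 0 T ×ˢ univ)) (h0 : ∀ t, t ∉ Icc a b → ∀ x, G (t, x) = 0) :
    ContDiff ℝ n G := by
  rw [contDiff_iff_contDiffAt]
  rintro ⟨t, x⟩
  by_cases ht : t ∈ Icc a b
  · exact hG.contDiffAt ((isOpen_Ioo.prod isOpen_univ).mem_nhds
      ⟨⟨ha.trans_le ht.1, ht.2.trans_lt hb⟩, mem_univ x⟩)
  · have h1 : G =ᶠ[𝓝 (t, x)] fun _ => 0 := by
      have h2 : (Icc a b)ᶜ ×ˢ (univ : Set E3) ∈ 𝓝 ((t, x) : ℝ × E3) :=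
        (isClosed_Icc.isOpen_compl.prod isOpen_univ).mem_nhds ⟨ht, mem_univ x⟩
      filter_upwards [h2] with p hp
      exact h0 p.1 hp.1 p.2
    exact contDiffAt_const.congr_of_eventuallyEq h1

theorem deriv_eq_zero_of_vanishing {V : Type*} [NormedAddCommGroup V] [NormedSpace ℝ V]
    {g : ℝ → V} {a b : ℝ} (h0 : ∀ t, t ∉ Icc a b → g t = 0) {t : ℝ} (ht : t ∉ Icc a b) :
    deriv g t = 0 := by
  have h1 : g =ᶠ[𝓝 t] fun _ => 0 := by
    filter_upwards [isClosed_Icc.isOpen_compl.mem_nhds ht] with s hs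
    exact h0 s hs
  rw [h1.deriv_eq, deriv_const]

end

/-! ### Integrability of weak solutions over slabs -/

section

variable {ℓ : ℝ} {hℓ : 0 < ℓ} {T A B κ K : ℝ} {n : ℕ} {b : Fin n → Fin n → ℝ}
  {h c : Fin n → ℝ → ℝ} {ε : ℝ} {ρ : Fin n → ℝ → E3 → ℝ} {q v : Fin n → ℝ → E3 → E3}

theorem slab_subset_Ici (hA : 0 < A) : slab ℓ hℓ A B ⊆ Ici 0 ×ˢ univ :=
  prod_mono (fun _ ht => hA.le.trans ht.1) (subset_univ _)

theorem IsWeakSolution.aestronglyMeasurable_density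
    (sol : IsWeakSolution (Domain.torus ℓ hℓ) b h c ε ρ q v) (hA : 0 < A) (i : Fin n) :
    AEStronglyMeasurable (fun p : ℝ × E3 => ρ i p.1 p.2) (volume.restrict (slab ℓ hℓ A B)) :=
  (sol.measurable_density i).mono_measure (Measure.restrict_mono_set _ (slab_subset_Ici hA))

theorem IsWeakSolution.aestronglyMeasurable_velocity
    (sol : IsWeakSolution (Domain.torus ℓ hℓ) b h c ε ρ q v) (hA : 0 < A) (i : Fin n) :
    AEStronglyMeasurable (fun p : ℝ × E3 => v i p.1 p.2) (volume.restrict (slab ℓ hℓ A B)) :=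
  (sol.measurable_velocity i).mono_measure (Measure.restrict_mono_set _ (slab_subset_Ici hA))

theorem IsWeakSolution.ae_density_mem (sol : IsWeakSolution (Domain.torus ℓ hℓ) b h c ε ρ q v)
    (hρ : DensityBounds T κ K ρ) (hA : 0 < A) (hB : B < T) (i : Fin n) :
    ∀ᵐ p ∂volume.restrict (slab ℓ hℓ A B), ρ i p.1 p.2 ∈ Icc κ K :=
  ae_slab_of_forall_ae (sol.aestronglyMeasurable_density hA i) fun t ht =>
    hρ i t ⟨hA.trans_le ht.1, ht.2.trans_lt hB⟩

theorem IsWeakSolution.integrableOn_comp_density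
    (sol : IsWeakSolution (Domain.torus ℓ hℓ) b h c ε ρ q v) (hρ : DensityBounds T κ K ρ)
    (hκ : 0 < κ) (hA : 0 < A) (hB : B < T) (i : Fin n) {g : ℝ → ℝ} (hg : ContinuousOn g (Ioi 0)) :
    IntegrableOn (fun p : ℝ × E3 => g (ρ i p.1 p.2)) (slab ℓ hℓ A B) := by
  have := isFiniteMeasure_slab (ℓ := ℓ) (hℓ := hℓ) (A := A) (B := B)
  obtain ⟨G, -, hG⟩ := exists_bound_Icc hg hκ K
  have h1 := sol.ae_density_mem hρ hA hB i
  refine Integrable.of_bound (C := G) (aemeasurable_comp_of_mem_Icc hg hκ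
    (sol.aestronglyMeasurable_density hA i) h1) ?_
  filter_upwards [h1] with p hp using hG _ hp

theorem IsWeakSolution.integrableOn_density
    (sol : IsWeakSolution (Domain.torus ℓ hℓ) b h c ε ρ q v) (hρ : DensityBounds T κ K ρ)
    (hκ : 0 < κ) (hA : 0 < A) (hB : B < T) (i : Fin n) :
    IntegrableOn (fun p : ℝ × E3 => ρ i p.1 p.2) (slab ℓ hℓ A B) :=
  sol.integrableOn_comp_density hρ hκ hA hB i (g := fun r => r) continuousOn_id

/-- `ρ |v|²` is the trace of the convection tensor. -/
theorem IsWeakSolution.integrableOn_kinetic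
    (sol : IsWeakSolution (Domain.torus ℓ hℓ) b h c ε ρ q v) (hA : 0 < A) (i : Fin n) :
    IntegrableOn (fun p : ℝ × E3 => ρ i p.1 p.2 * ‖v i p.1 p.2‖ ^ 2) (slab ℓ hℓ A B) := by
  refine (integrable_finsetSum Finset.univ fun k _ =>
    integrableOn_slab_of_locL1 (sol.convection_loc i k k) hA).congr
    (Eventually.of_forall fun p => ?_)
  simp only [norm_sq_eq_sum, Finset.mul_sum, tensorSq, Matrix.of_apply]
  exact Finset.sum_congr rfl fun k _ => by ring

/-- `c |q|²` is the trace of the tensor `H`. -/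
theorem IsWeakSolution.integrableOn_capillary
    (sol : IsWeakSolution (Domain.torus ℓ hℓ) b h c ε ρ q v) (hA : 0 < A) (i : Fin n) :
    IntegrableOn (fun p : ℝ × E3 => c i (ρ i p.1 p.2) * ‖q i p.1 p.2‖ ^ 2) (slab ℓ hℓ A B) := by
  refine (integrable_finsetSum Finset.univ fun k _ =>
    integrableOn_slab_of_locL1 (sol.stressH_loc i k k) hA).congr
    (Eventually.of_forall fun p => ?_)
  simp only [norm_sq_eq_sum, Finset.mul_sum, stressH, tensorSq, Matrix.smul_apply,
    Matrix.of_apply, smul_eq_mul]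
  exact Finset.sum_congr rfl fun k _ => by ring

/-- From `ρ |v| ≤ ρ + ρ |v|²`. -/
theorem IsWeakSolution.integrableOn_momentum
    (sol : IsWeakSolution (Domain.torus ℓ hℓ) b h c ε ρ q v) (hρ : DensityBounds T κ K ρ)
    (hκ : 0 < κ) (hA : 0 < A) (hB : B < T) (i : Fin n) :
    IntegrableOn (fun p : ℝ × E3 => ρ i p.1 p.2 • v i p.1 p.2) (slab ℓ hℓ A B) := by
  refine ((sol.integrableOn_density hρ hκ hA hB i).add (sol.integrableOn_kinetic hA i)).mono'
    ((sol.aestronglyMeasurable_density hA i).smul (sol.aestronglyMeasurable_velocity hA i)) ?_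
  filter_upwards [sol.ae_density_mem hρ hA hB i] with p hp
  have h0 : 0 ≤ ρ i p.1 p.2 := hκ.le.trans hp.1
  rw [norm_smul, Real.norm_of_nonneg h0, Pi.add_apply]
  nlinarith [mul_nonneg h0 (sq_nonneg (‖v i p.1 p.2‖ - 1)),
    mul_nonneg h0 (norm_nonneg (v i p.1 p.2))]

theorem IsWeakSolution.integrableOn_momentum_apply
    (sol : IsWeakSolution (Domain.torus ℓ hℓ) b h c ε ρ q v) (hρ : DensityBounds T κ K ρ)
    (hκ : 0 < κ) (hA : 0 < A) (hB : B < T) (i : Fin n) (k : Fin 3) :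
    IntegrableOn (fun p : ℝ × E3 => (ρ i p.1 p.2 • v i p.1 p.2) k) (slab ℓ hℓ A B) :=
  (EuclideanSpace.proj (𝕜 := ℝ) k).integrable_comp (sol.integrableOn_momentum hρ hκ hA hB i)

theorem IsWeakSolution.integrableOn_energyDensity
    (sol : IsWeakSolution (Domain.torus ℓ hℓ) b h c ε ρ q v) (hF : EnergyHypothesis h c)
    (hρ : DensityBounds T κ K ρ) (hκ : 0 < κ) (hA : 0 < A) (hB : B < T) :
    IntegrableOn (fun p : ℝ × E3 => energyDensity h c ρ q v p.1 p.2) (slab ℓ hℓ A B) := by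
  refine integrable_finsetSum Finset.univ fun i _ => ?_
  refine (((sol.integrableOn_comp_density hρ hκ hA hB i (hF.1 i).continuousOn).add
    ((sol.integrableOn_capillary hA i).const_mul (1 / 2))).add
    ((sol.integrableOn_kinetic hA i).const_mul (1 / 2))).congr (Eventually.of_forall fun p => ?_)
  simp only [energyF, Pi.add_apply]
  ring

theorem integrableOn_slab_inner {m : ℝ × E3 → E3} (hm : IntegrableOn m (slab ℓ hℓ A B))
    {X : ℝ × E3 → E3} (hX : ∀ k, ContinuousOn (fun p => X p k) (Ioo 0 T ×ˢ univ)) (hA : 0 < A)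
    (hB : B < T) : IntegrableOn (fun p => inner ℝ (m p) (X p)) (slab ℓ hℓ A B) := by
  simp only [inner_eq_sum]
  exact integrable_finsetSum Finset.univ fun k _ => integrableOn_slab_mul
    ((EuclideanSpace.proj (𝕜 := ℝ) k).integrable_comp hm) (hX k) hA hB

theorem integrableOn_slab_contractGrad {S : ℝ × E3 → Matrix (Fin 3) (Fin 3) ℝ}
    (hS : ∀ k j, IntegrableOn (fun p => S p k j) (slab ℓ hℓ A B)) {W : ℝ → E3 → E3}
    (hW : ContDiffOn ℝ ∞ (fun p : ℝ × E3 => W p.1 p.2) (Ioo 0 T ×ˢ univ)) (hA : 0 < A)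
    (hB : B < T) : IntegrableOn (fun p => contractGrad (S p) (W p.1) p.2) (slab ℓ hℓ A B) := by
  refine integrable_finsetSum Finset.univ fun k _ => integrable_finsetSum Finset.univ fun j _ =>
    integrableOn_slab_mul (hS k j) ?_ hA hB
  exact (contDiffOn_pderiv isOpen_Ioo.uniqueDiffOn (F := fun t y => W t y k)
    ((EuclideanSpace.proj (𝕜 := ℝ) k).contDiff.comp_contDiffOn hW) (m := ∞) (by simp)
    j).continuousOn

end

/-! ### Testing the equations -/

section

variable {ℓ : ℝ} {hℓ : 0 < ℓ} {T A B κ K : ℝ} {n : ℕ} {b : Fin n → Fin n → ℝ}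
  {h c : Fin n → ℝ → ℝ} {ε : ℝ} {ρ : Fin n → ℝ → E3 → ℝ} {q v : Fin n → ℝ → E3 → E3}

/-- Expresses the integrand through the space-time derivative of the test function, the object that
mollification approximates. -/
theorem massIntegrand_eq {G : ℝ → E3 → ℝ} (hG : ContDiff ℝ 1 fun p : ℝ × E3 => G p.1 p.2)
    (r : ℝ) (m : E3) (p : ℝ × E3) :
    r * deriv (fun s => G s p.2) p.1 + inner ℝ m (gradient (G p.1) p.2)
      = r * fderiv ℝ (fun p : ℝ × E3 => G p.1 p.2) p (1, 0)
        + ∑ k, m k * fderiv ℝ (fun p : ℝ × E3 => G p.1 p.2) p (0, EuclideanSpace.single k 1) := by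
  have hd : DifferentiableOn ℝ (fun p : ℝ × E3 => G p.1 p.2) (univ ×ˢ univ) :=
    (hG.differentiable one_ne_zero).differentiableOn
  have h1 := (hasDerivAt_time isOpen_univ hd (mem_univ p.1) p.2).deriv
  have h2 : ∀ k, pderiv k (G p.1) p.2
      = fderiv ℝ (fun p : ℝ × E3 => G p.1 p.2) p (0, EuclideanSpace.single k 1) := fun k => by
    rw [pderiv_slice hd k ⟨mem_univ _, mem_univ _⟩, univ_prod_univ, fderivWithin_univ]
  rw [h1, inner_eq_sum]
  simp only [gradient_apply, h2]

theorem gradient_eq_zero_of_vanishing {f : E3 → ℝ} (hf : ∀ x, f x = 0) (x : E3) :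
    gradient f x = 0 := by
  have h1 : f = fun _ => 0 := funext hf
  rw [h1, gradient_fun_const]

/-- The mass equation for continuously differentiable test functions supported at positive times. -/
theorem IsWeakSolution.mass_contDiff_one
    (sol : IsWeakSolution (Domain.torus ℓ hℓ) b h c ε ρ q v) (hρ : DensityBounds T κ K ρ)
    (hκ : 0 < κ) (hA : 0 < A) (hB : B < T) {a₁ b₁ : ℝ} (ha : A < a₁) (hb : b₁ < B) (i : Fin n)
    {ψ : ℝ → E3 → ℝ} (hψ : ContDiff ℝ 1 fun p : ℝ × E3 => ψ p.1 p.2)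
    (hper : ∀ t, (Domain.torus ℓ hℓ).IsFunctionOn (ψ t))
    (h0 : ∀ t, t ∉ Icc a₁ b₁ → ∀ x, ψ t x = 0) :
    ∫ p in slab ℓ hℓ A B, (ρ i p.1 p.2 * deriv (fun s => ψ s p.2) p.1
      + inner ℝ (ρ i p.1 p.2 • v i p.1 p.2) (gradient (ψ p.1) p.2)) = 0 := by
  set Ψ : ℝ × E3 → ℝ := fun p => ψ p.1 p.2 with hΨ
  obtain ⟨C, hC⟩ : ∃ C, ∀ p, ‖fderiv ℝ Ψ p‖ ≤ C := by
    -- Global boundedness of the space-time derivative: compactness over the closed cell and `[a₁,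
    -- b₁]`, periodicity in space, and vanishing at all other times.
    obtain ⟨C, hC⟩ := (isCompact_closedSlab (ℓ := ℓ) (A := a₁)
      (B := b₁)).exists_bound_of_continuousOn (hψ.continuous_fderiv one_ne_zero).continuousOn
    refine ⟨max C 0, fun p => ?_⟩
    by_cases hp : p.1 ∈ Icc a₁ b₁
    · have hperd : ∀ (k : Fin 3) x, fderiv ℝ Ψ (p.1, x + EuclideanSpace.single k ℓ)
          = fderiv ℝ Ψ (p.1, x) := by
        intro k x
        have e1 : Ψ = fun z => Ψ (z + (0, EuclideanSpace.single k ℓ)) := by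
          funext z
          simpa [hΨ] using (hper z.1 k z.2).symm
        conv_rhs => rw [e1]
        rw [fderiv_comp_add_right]
        simp
      obtain ⟨y, hy, hy'⟩ := exists_mem_closedCell_eq (V := ℝ × E3 →L[ℝ] ℝ) hℓ p.2
      have e2 := hy' (fun x => fderiv ℝ Ψ (p.1, x)) (isFunctionOn_torus_iff.2 hperd)
      have e3 : fderiv ℝ Ψ p = fderiv ℝ Ψ (p.1, y) := e2
      rw [e3]
      exact (hC (p.1, y) ⟨hp, hy⟩).trans (le_max_left _ _)
    · have h1 : Ψ =ᶠ[𝓝 p] fun _ => 0 := by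
        filter_upwards [(isClosed_Icc.isOpen_compl.prod isOpen_univ).mem_nhds
          (show p ∈ (Icc a₁ b₁)ᶜ ×ˢ (univ : Set E3) from ⟨hp, mem_univ _⟩)] with z hz
        exact h0 z.1 hz.1 z.2
      rw [h1.fderiv_eq, fderiv_fun_const]
      simp
  have hHaar : (volume : Measure (ℝ × E3)).IsAddHaarMeasure := by
    rw [Measure.volume_eq_prod]
    infer_instance
  obtain ⟨F, hFs, -, hF', -, hFC, hFper, hFsupp⟩ :=
    exists_smooth_approximation (volume : Measure (ℝ × E3)) hψ
  set m : ℝ × E3 → E3 := fun p => ρ i p.1 p.2 • v i p.1 p.2 with hm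
  set J : (ℝ × E3 → ℝ) → ℝ × E3 → ℝ := fun G p => ρ i p.1 p.2 * fderiv ℝ G p (1, 0)
    + ∑ k, m p k * fderiv ℝ G p (0, EuclideanSpace.single k 1) with hJ
  have iρ := sol.integrableOn_density hρ hκ hA hB i
  have im := fun k => sol.integrableOn_momentum_apply hρ hκ hA hB i k
  have hJi : ∀ {G : ℝ × E3 → ℝ}, ContDiff ℝ 1 G → IntegrableOn (J G) (slab ℓ hℓ A B) := by
    intro G hG
    have hc : ∀ v, ContinuousOn (fun p => fderiv ℝ G p v) (Ioo 0 T ×ˢ univ) := fun v =>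
      ((hG.continuous_fderiv one_ne_zero).clm_apply continuous_const).continuousOn
    exact (integrableOn_slab_mul iρ (hc _) hA hB).add
      (integrable_finsetSum _ fun k _ => integrableOn_slab_mul (im k) (hc _) hA hB)
  -- Mollification in time enlarges the support. The margins `a₁ - A` and `B - b₁` keep it inside
  -- `[A,B]` for large `N`, away from time zero, so no initial term appears.
  have hzero : ∀ᶠ N : ℕ in atTop, ∫ p in slab ℓ hℓ A B, J (F N) p = 0 := by
    have hδ : 0 < min (a₁ - A) (B - b₁) := lt_min (by linarith) (by linarith)
    obtain ⟨N₀, hN₀⟩ := exists_nat_one_div_lt hδ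
    filter_upwards [eventually_ge_atTop N₀] with N hN
    have hNδ : 1 / ((N : ℝ) + 1) < min (a₁ - A) (B - b₁) :=
      (one_div_le_one_div_of_le (by positivity) (by
        have : (N₀ : ℝ) ≤ N := by exact_mod_cast hN
        linarith)).trans_lt hN₀
    have hF0 : ∀ t, t ∉ Icc A B → ∀ x, F N (t, x) = 0 := by
      intro t ht x
      refine hFsupp N (t, x) fun y hy => ?_
      have hy1 : |y.1| < min (a₁ - A) (B - b₁) := ((norm_fst_le y).trans_lt hy).trans hNδ
      have h1 := hy1.trans_le (min_le_left _ _)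
      have h2 := hy1.trans_le (min_le_right _ _)
      rw [abs_lt] at h1 h2
      refine h0 _ (fun h3 => ht ⟨?_, ?_⟩) _
      · have := h3.1
        simp only [Prod.fst_sub] at this
        linarith
      · have := h3.2
        simp only [Prod.fst_sub] at this
        linarith
    have htest : IsTestFunction (Domain.torus ℓ hℓ) fun t x => F N (t, x) :=
      { smooth := hFs N
        time_support := ⟨B + 1, fun t ht x => hF0 t (fun h3 => by linarith [h3.2]) x⟩
        space_support := fun t k x => by
          have h1 := hFper (0, EuclideanSpace.single k ℓ) (fun z => by
            simpa [hΨ] using hper z.1 k z.2) N (t, x)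
          simpa using h1 }
    have h1 := sol.mass i _ htest
    have hs1 : ContDiff ℝ 1 fun p : ℝ × E3 => F N (p.1, p.2) := contDiff_infty.1 (hFs N) 1
    have hz : ∀ x, F N (0, x) = 0 := hF0 0 fun h3 => by linarith [h3.1]
    simp only [hz, mul_zero, integral_zero, neg_eq_zero] at h1
    have e1 : ∀ t x, ρ i t x * deriv (fun s => F N (s, x)) t
        + inner ℝ (ρ i t x • v i t x) (gradient (fun x => F N (t, x)) x) = J (F N) (t, x) :=
      fun t x => massIntegrand_eq (G := fun t x => F N (t, x)) hs1 _ _ (t, x)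
    rw [← integral_Ioi_eq_slab (hJi (contDiff_infty.1 (hFs N) 1)) hA]
    · simpa only [e1] using h1
    · intro t ht x
      rw [← e1, deriv_eq_zero_of_vanishing (fun s hs => hF0 s hs x) ht,
        gradient_eq_zero_of_vanishing (hF0 t ht)]
      simp
  have hlim : Tendsto (fun N => ∫ p in slab ℓ hℓ A B, J (F N) p) atTop
      (𝓝 (∫ p in slab ℓ hℓ A B, J Ψ p)) := by
    refine tendsto_integral_of_dominated_convergence
      (fun p => |ρ i p.1 p.2| * (C * ‖((1, 0) : ℝ × E3)‖)
        + ∑ k : Fin 3, |m p k| * (C * ‖((0, EuclideanSpace.single k 1) : ℝ × E3)‖))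
      (fun N => (hJi (contDiff_infty.1 (hFs N) 1)).aestronglyMeasurable) ?_ ?_ ?_
    · exact (iρ.abs.mul_const _).add (integrable_finsetSum _ fun k _ => (im k).abs.mul_const _)
    · intro N
      refine Eventually.of_forall fun p => ?_
      have hb : ∀ u, |fderiv ℝ (F N) p u| ≤ C * ‖u‖ := fun u =>
        ((fderiv ℝ (F N) p).le_opNorm u).trans
          (mul_le_mul_of_nonneg_right (hFC C hC N p) (norm_nonneg _))
      refine (norm_add_le _ _).trans (add_le_add ?_ ((norm_sum_le _ _).trans
        (Finset.sum_le_sum fun k _ => ?_)))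
      · rw [Real.norm_eq_abs, abs_mul]
        exact mul_le_mul_of_nonneg_left (hb _) (abs_nonneg _)
      · rw [Real.norm_eq_abs, abs_mul]
        exact mul_le_mul_of_nonneg_left (hb _) (abs_nonneg _)
    · refine Eventually.of_forall fun p => ?_
      have ht : ∀ u, Tendsto (fun N => fderiv ℝ (F N) p u) atTop (𝓝 (fderiv ℝ Ψ p u)) := fun u =>
        ((ContinuousLinearMap.apply ℝ ℝ u).continuous.tendsto _).comp (hF' p)
      exact (tendsto_const_nhds.mul (ht _)).add
        (tendsto_finsetSum _ fun k _ => tendsto_const_nhds.mul (ht _))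
  have h2 : ∫ p in slab ℓ hℓ A B, J Ψ p = 0 :=
    tendsto_nhds_unique hlim (tendsto_const_nhds.congr' (hzero.mono fun N hN => hN.symm))
  rw [← h2]
  exact setIntegral_congr_fun measurableSet_slab fun p _ => massIntegrand_eq hψ _ _ p

end

/-- The power of the momentum flux and stress against the velocity field `W`. -/
def momentumPower (h c : ℝ → ℝ) (W wt : E3 → E3) (ρ : ℝ) (q v x : E3) : ℝ :=
  inner ℝ (ρ • v) (wt x) + contractGrad (ρ • tensorSq v) W x + stressS h c ρ q * divergence W x
    + inner ℝ (stressR c ρ q) (gradient (divergence W) x) + contractGrad (stressH c ρ q) W x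

section

variable {W : E3 → E3} {a : ℝ} {x : E3}

theorem contractGrad_smul (hW : Differentiable ℝ W) (S : Matrix (Fin 3) (Fin 3) ℝ) :
    contractGrad S (fun y => a • W y) x = a * contractGrad S W x := by
  have h1 : ∀ j k, pderiv j (fun y => (a • W y) k) x = a * pderiv j (fun y => W y k) x :=
    fun j k => by
      simp only [PiLp.smul_apply, smul_eq_mul]
      exact pderiv_const_mul (((EuclideanSpace.proj (𝕜 := ℝ) k).differentiable.comp hW) x)
  simp only [contractGrad, h1, Finset.mul_sum]
  exact Finset.sum_congr rfl fun k _ => Finset.sum_congr rfl fun j _ => by ring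

theorem divergence_smul (hW : Differentiable ℝ W) :
    divergence (fun y => a • W y) = fun x => a * divergence W x := by
  funext x
  simp only [divergence, Finset.mul_sum, PiLp.smul_apply, smul_eq_mul]
  exact Finset.sum_congr rfl fun k _ =>
    pderiv_const_mul (((EuclideanSpace.proj (𝕜 := ℝ) k).differentiable.comp hW) x)

theorem gradient_const_mul {f : E3 → ℝ} (hf : DifferentiableAt ℝ f x) :
    gradient (fun y => a * f y) x = a • gradient f x := by
  ext k
  rw [gradient_apply, pderiv_const_mul hf, PiLp.smul_apply, gradient_apply, smul_eq_mul]

theorem contDiff_divergence (hW : ContDiff ℝ ∞ W) : ContDiff ℝ ∞ (divergence W) :=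
  ContDiff.sum fun k _ => (contDiff_apply_of_contDiff hW k).pderiv (by simp) k

end

/-- Exchanging the two indices changes the sign of every pairwise force, so the sum equals its own
negative. -/
theorem sum_frictionForce {n : ℕ} {b : Fin n → Fin n → ℝ} (hb : ∀ i j, b i j = b j i)
    (ρ : Fin n → ℝ → E3 → ℝ) (v : Fin n → ℝ → E3 → E3) (t : ℝ) (x : E3) :
    ∑ i, frictionForce b ρ v i t x = 0 := by
  have h1 : ∑ i, frictionForce b ρ v i t x = -∑ i, frictionForce b ρ v i t x := by
    conv_lhs => simp only [frictionForce]
    rw [Finset.sum_comm, ← Finset.sum_neg_distrib]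
    refine Finset.sum_congr rfl fun i _ => ?_
    rw [frictionForce, ← Finset.sum_neg_distrib]
    refine Finset.sum_congr rfl fun j _ => ?_
    rw [hb j i, ← smul_neg, neg_sub]
    congr 1
    ring
  have h2 : (2 : ℝ) • ∑ i, frictionForce b ρ v i t x = 0 := by
    rw [two_smul]
    exact add_eq_zero_iff_eq_neg.2 h1
  exact (smul_eq_zero.1 h2).resolve_left two_ne_zero

section

variable {ℓ : ℝ} {hℓ : 0 < ℓ} {T A B κ K : ℝ} {n : ℕ} {b : Fin n → Fin n → ℝ}
  {h c : Fin n → ℝ → ℝ} {ε : ℝ} {ρ : Fin n → ℝ → E3 → ℝ} {q v : Fin n → ℝ → E3 → E3}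
  {w : ℝ → E3 → E3}

theorem contDiffOn_apply_slab {I : Set ℝ} {m : WithTop ℕ∞}
    (hw : ContDiffOn ℝ m (fun p : ℝ × E3 => w p.1 p.2) (I ×ˢ univ)) (k : Fin 3) :
    ContDiffOn ℝ m (fun p : ℝ × E3 => w p.1 p.2 k) (I ×ˢ univ) :=
  (EuclideanSpace.proj (𝕜 := ℝ) k).contDiff.comp_contDiffOn hw

theorem contDiffOn_divergence {I : Set ℝ} (hI : UniqueDiffOn ℝ I)
    (hw : ContDiffOn ℝ ∞ (fun p : ℝ × E3 => w p.1 p.2) (I ×ˢ univ)) :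
    ContDiffOn ℝ ∞ (fun p : ℝ × E3 => divergence (w p.1) p.2) (I ×ˢ univ) :=
  ContDiffOn.sum fun k _ => contDiffOn_pderiv hI (F := fun t y => w t y k)
    (contDiffOn_apply_slab hw k) (by simp) k

theorem IsWeakSolution.integrableOn_momentumPower
    (sol : IsWeakSolution (Domain.torus ℓ hℓ) b h c ε ρ q v) (hρ : DensityBounds T κ K ρ)
    (hκ : 0 < κ) (hA : 0 < A) (hB : B < T)
    (hw : ContDiffOn ℝ ∞ (fun p : ℝ × E3 => w p.1 p.2) (Ioo 0 T ×ˢ univ)) (i : Fin n) :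
    IntegrableOn (fun p : ℝ × E3 => momentumPower (h i) (c i) (w p.1)
      (fun y => deriv (fun s => w s y) p.1) (ρ i p.1 p.2) (q i p.1 p.2) (v i p.1 p.2) p.2)
      (slab ℓ hℓ A B) := by
  have hdiv := contDiffOn_divergence isOpen_Ioo.uniqueDiffOn hw
  refine ((((integrableOn_slab_inner (sol.integrableOn_momentum hρ hκ hA hB i) (fun k => ?_) hA
    hB).add (integrableOn_slab_contractGrad (fun k j => ?_) hw hA hB)).add
    (integrableOn_slab_mul (integrableOn_slab_of_locL1 (sol.stressS_loc i) hA)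
      hdiv.continuousOn hA hB)).add (integrableOn_slab_inner (integrableOn_slab_of_locL1
        (sol.stressR_loc i) hA) (fun k => ?_) hA hB)).add
    (integrableOn_slab_contractGrad (fun k j => ?_) hw hA hB)
  · exact (contDiffOn_apply_slab (w := fun t y => deriv (fun s => w s y) t)
      (contDiffOn_deriv_time isOpen_Ioo hw (m := ∞) (by simp)) k).continuousOn
  · exact integrableOn_slab_of_locL1 (sol.convection_loc i k j) hA
  · simp only [gradient_apply]
    exact (contDiffOn_pderiv isOpen_Ioo.uniqueDiffOn (F := fun t => divergence (w t)) hdiv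
      (m := ∞) (by simp) k).continuousOn
  · exact integrableOn_slab_of_locL1 (sol.stressH_loc i k j) hA

theorem continuousOn_time {θ : ℝ → ℝ} (hθ : Continuous θ) {s : Set (ℝ × E3)} :
    ContinuousOn (fun p : ℝ × E3 => θ p.1) s :=
  (hθ.comp continuous_fst).continuousOn

/-- The momentum equation tested with a cut-off of a smooth velocity field. -/
theorem IsWeakSolution.momentum_cutoff
    (sol : IsWeakSolution (Domain.torus ℓ hℓ) b h c ε ρ q v) (hρ : DensityBounds T κ K ρ)
    (hκ : 0 < κ) (hA : 0 < A) (hB : B < T)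
    (hw : ContDiffOn ℝ ∞ (fun p : ℝ × E3 => w p.1 p.2) (Ioo 0 T ×ˢ univ))
    (hper : ∀ t ∈ Ioo 0 T, (Domain.torus ℓ hℓ).IsFunctionOn (w t)) {θ : ℝ → ℝ}
    (hθ : ContDiff ℝ ∞ θ) (h0 : ∀ t, t ∉ Icc A B → θ t = 0) (i : Fin n) :
    ∫ p in slab ℓ hℓ A B, (deriv θ p.1 * inner ℝ (ρ i p.1 p.2 • v i p.1 p.2) (w p.1 p.2)
        + θ p.1 * momentumPower (h i) (c i) (w p.1) (fun y => deriv (fun s => w s y) p.1)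
          (ρ i p.1 p.2) (q i p.1 p.2) (v i p.1 p.2) p.2)
      = 1 / ε * ∫ p in slab ℓ hℓ A B,
          θ p.1 * inner ℝ (frictionForce b ρ v i p.1 p.2) (w p.1 p.2) := by
  have hsub : ∀ t ∈ Icc A B, t ∈ Ioo 0 T := fun t ht => ⟨hA.trans_le ht.1, ht.2.trans_lt hB⟩
  have hφ0 : ∀ t, t ∉ Icc A B → (fun x => θ t • w t x) = fun _ => 0 := fun t ht => by
    funext x
    rw [h0 t ht, zero_smul]
  have hθ' : Continuous (deriv θ) := hθ.continuous_deriv (by simp)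
  have htest : IsTestFunction (Domain.torus ℓ hℓ) fun t x => θ t • w t x :=
    { smooth := contDiff_of_vanishing hA hB ((hθ.comp contDiff_fst).contDiffOn.smul hw)
        fun t ht x => congrFun (hφ0 t ht) x
      time_support := ⟨B + 1, fun t ht x =>
        congrFun (hφ0 t fun h3 => by linarith [h3.2]) x⟩
      space_support := fun t k x => by
        by_cases ht : t ∈ Icc A B
        · have h1 := hper t (hsub t ht) k x
          simp only [h1]
        · simp only [h0 t ht, zero_smul] }
  have hmom := sol.momentum i _ htest
  have hz : ∀ x, θ 0 • w 0 x = 0 := fun x => congrFun (hφ0 0 fun h3 => by linarith [h3.1]) x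
  simp only [hz, inner_zero_right, integral_zero, zero_sub, neg_inj] at hmom
  have hI : IntegrableOn (fun p : ℝ × E3 =>
      deriv θ p.1 * inner ℝ (ρ i p.1 p.2 • v i p.1 p.2) (w p.1 p.2)
        + θ p.1 * momentumPower (h i) (c i) (w p.1) (fun y => deriv (fun s => w s y) p.1)
          (ρ i p.1 p.2) (q i p.1 p.2) (v i p.1 p.2) p.2) (slab ℓ hℓ A B) := by
    have h1 := integrableOn_slab_mul (integrableOn_slab_inner
      (sol.integrableOn_momentum hρ hκ hA hB i)
      (fun k => (contDiffOn_apply_slab hw k).continuousOn) hA hB) (continuousOn_time hθ') hA hB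
    have h2 := integrableOn_slab_mul (sol.integrableOn_momentumPower hρ hκ hA hB hw i)
      (continuousOn_time hθ.continuous) hA hB
    refine (h1.add h2).congr (Eventually.of_forall fun p => ?_)
    simp only [Pi.add_apply]
    ring
  have hIf : IntegrableOn (fun p : ℝ × E3 =>
      θ p.1 * inner ℝ (frictionForce b ρ v i p.1 p.2) (w p.1 p.2)) (slab ℓ hℓ A B) := by
    refine (integrableOn_slab_mul (integrableOn_slab_inner
      (integrableOn_slab_of_locL1 (sol.friction_loc i) hA)
      (fun k => (contDiffOn_apply_slab hw k).continuousOn) hA hB)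
      (continuousOn_time hθ.continuous) hA hB).congr (Eventually.of_forall fun p => ?_)
    exact mul_comm _ _
  -- The cut-off depends on time only, hence commutes with all space derivatives; its own derivative
  -- appears solely beside the momentum.
  have e1 : ∀ t ∈ Icc A B, ∀ x,
      inner ℝ (ρ i t x • v i t x) (deriv (fun s => θ s • w s x) t)
          + contractGrad (ρ i t x • tensorSq (v i t x)) (fun y => θ t • w t y) x
          + stressS (h i) (c i) (ρ i t x) (q i t x) * divergence (fun y => θ t • w t y) x
          + inner ℝ (stressR (c i) (ρ i t x) (q i t x))
            (gradient (divergence (fun y => θ t • w t y)) x)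
          + contractGrad (stressH (c i) (ρ i t x) (q i t x)) (fun y => θ t • w t y) x
        = deriv θ t * inner ℝ (ρ i t x • v i t x) (w t x)
          + θ t * momentumPower (h i) (c i) (w t) (fun y => deriv (fun s => w s y) t)
          (ρ i t x) (q i t x) (v i t x) x := by
    intro t ht x
    have hws : ContDiff ℝ ∞ (w t) := contDiff_slice hw (hsub t ht)
    have hwd := hws.differentiable (by simp)
    have hwt : HasDerivAt (fun s => w s x) (deriv (fun s => w s x) t) t :=
      (hasDerivAt_time isOpen_Ioo (hw.differentiableOn (by simp))
        (hsub t ht) x).differentiableAt.hasDerivAt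
    have hθt : HasDerivAt θ (deriv θ t) t := (hθ.differentiable (by simp) t).hasDerivAt
    have hder : deriv (fun s => θ s • w s x) t = _ := (hθt.smul hwt).deriv
    rw [hder, contractGrad_smul hwd, contractGrad_smul hwd, divergence_smul hwd,
      gradient_const_mul ((contDiff_divergence hws).differentiable (by simp) x)]
    simp only [inner_add_right, inner_smul_right, momentumPower]
    ring
  have key : ∫ p in slab ℓ hℓ A B,
      (inner ℝ (ρ i p.1 p.2 • v i p.1 p.2) (deriv (fun s => θ s • w s p.2) p.1)
          + contractGrad (ρ i p.1 p.2 • tensorSq (v i p.1 p.2)) (fun y => θ p.1 • w p.1 y) p.2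
          + stressS (h i) (c i) (ρ i p.1 p.2) (q i p.1 p.2)
            * divergence (fun y => θ p.1 • w p.1 y) p.2
          + inner ℝ (stressR (c i) (ρ i p.1 p.2) (q i p.1 p.2))
            (gradient (divergence (fun y => θ p.1 • w p.1 y)) p.2)
          + contractGrad (stressH (c i) (ρ i p.1 p.2) (q i p.1 p.2))
            (fun y => θ p.1 • w p.1 y) p.2)
      = 1 / ε * ∫ p in slab ℓ hℓ A B,
          θ p.1 * inner ℝ (frictionForce b ρ v i p.1 p.2) (w p.1 p.2) := by
    rw [← integral_Ioi_eq_slab (hI.congr_fun (fun p hp => (e1 p.1 hp.1 p.2).symm)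
      measurableSet_slab) hA, ← integral_Ioi_eq_slab hIf hA]
    · simpa only [inner_smul_right] using hmom
    · intro t ht x
      simp [h0 t ht]
    · intro t ht x
      have hder : deriv (fun s => θ s • w s x) t = 0 :=
        deriv_eq_zero_of_vanishing (fun s hs => congrFun (hφ0 s hs) x) ht
      have hdiv : divergence (fun _ : E3 => (0 : E3)) = fun _ => 0 := by
        funext y
        simp [divergence, pderiv_const]
      simp only [hder, hφ0 t ht, hdiv, gradient_fun_const]
      simp [contractGrad, pderiv_const]
  rw [← key]
  exact setIntegral_congr_fun measurableSet_slab fun p hp => (e1 p.1 hp.1 p.2).symm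

/-- The sum over all components of the momentum equations tested with a cut-off of a smooth
velocity field: the friction forces cancel. -/
theorem IsWeakSolution.sum_momentum_cutoff
    (sol : IsWeakSolution (Domain.torus ℓ hℓ) b h c ε ρ q v) (hb : ∀ i j, b i j = b j i)
    (hρ : DensityBounds T κ K ρ) (hκ : 0 < κ) (hA : 0 < A) (hB : B < T)
    (hw : ContDiffOn ℝ ∞ (fun p : ℝ × E3 => w p.1 p.2) (Ioo 0 T ×ˢ univ))
    (hper : ∀ t ∈ Ioo 0 T, (Domain.torus ℓ hℓ).IsFunctionOn (w t)) {θ : ℝ → ℝ}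
    (hθ : ContDiff ℝ ∞ θ) (h0 : ∀ t, t ∉ Icc A B → θ t = 0) :
    ∑ i, ∫ p in slab ℓ hℓ A B, (deriv θ p.1 * inner ℝ (ρ i p.1 p.2 • v i p.1 p.2) (w p.1 p.2)
        + θ p.1 * momentumPower (h i) (c i) (w p.1) (fun y => deriv (fun s => w s y) p.1)
          (ρ i p.1 p.2) (q i p.1 p.2) (v i p.1 p.2) p.2) = 0 := by
  simp only [sol.momentum_cutoff hρ hκ hA hB hw hper hθ h0]
  rw [← Finset.mul_sum, ← integral_finsetSum]
  · simp only [← Finset.mul_sum, ← sum_inner, sum_frictionForce hb]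
    simp
  · intro i _
    refine (integrableOn_slab_mul (integrableOn_slab_inner
      (integrableOn_slab_of_locL1 (sol.friction_loc i) hA)
      (fun k => (contDiffOn_apply_slab hw k).continuousOn) hA hB)
      (continuousOn_time hθ.continuous) hA hB).congr (Eventually.of_forall fun p => ?_)
    exact mul_comm _ _

end

/-! ### The relative energy balance -/

section

variable {ℓ : ℝ} {hℓ : 0 < ℓ} {T A B κ K : ℝ} {n : ℕ} {b : Fin n → Fin n → ℝ}
  {h c : Fin n → ℝ → ℝ} {ε : ℝ} {ρ : Fin n → ℝ → E3 → ℝ} {q v : Fin n → ℝ → E3 → E3}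
  {ρb : Fin n → ℝ → E3 → ℝ} {w : ℝ → E3 → E3}

/-- A smooth cut-off with compact support is Lipschitz, hence admissible in the energy inequality;
since it vanishes at time zero the initial energy drops out. -/
theorem IsDissipativeWeakSolution.energy_cutoff
    (sol : IsDissipativeWeakSolution (Domain.torus ℓ hℓ) b h c ε ρ q v)
    (hF : EnergyHypothesis h c) (hρ : DensityBounds T κ K ρ)
    (hκ : 0 < κ) (hA : 0 < A) (hB : B < T) {θ : ℝ → ℝ} (hθ : ContDiff ℝ ∞ θ)
    (hθ0 : ∀ t, 0 ≤ θ t) (h0 : ∀ t, t ∉ Icc A B → θ t = 0) :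
    IntegrableOn (fun p : ℝ × E3 => dissipation b ρ v p.1 p.2) (slab ℓ hℓ A B) ∧
    1 / (2 * ε) * ∫ p in slab ℓ hℓ A B, dissipation b ρ v p.1 p.2 * θ p.1
      ≤ ∫ p in slab ℓ hℓ A B, energyDensity h c ρ q v p.1 p.2 * deriv θ p.1 := by
  have hdiss : IntegrableOn (fun p : ℝ × E3 => dissipation b ρ v p.1 p.2) (slab ℓ hℓ A B) :=
    (sol.dissipation_integrable B).mono_set (prod_mono (Icc_subset_Icc_left hA.le) subset_rfl)
  have hθ' : Continuous (deriv θ) := hθ.continuous_deriv (by simp)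
  have hsupp : HasCompactSupport θ := HasCompactSupport.intro isCompact_Icc h0
  have h1 := sol.energy_ineq θ (hθ.lipschitzWith_of_hasCompactSupport (𝕂 := ℝ) hsupp (by simp)) hθ0
    ⟨B + 1, fun t ht => h0 t fun h3 => by linarith [h3.2]⟩
  rw [h0 0 fun h3 => by linarith [h3.1], mul_zero] at h1
  refine ⟨hdiss, ?_⟩
  rw [← integral_Ioi_eq_slab (integrableOn_slab_mul hdiss (continuousOn_time hθ.continuous) hA hB)
    hA (fun t ht x => by simp [h0 t ht]), ← integral_Ioi_eq_slab (integrableOn_slab_mul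
      (sol.integrableOn_energyDensity hF hρ hκ hA hB) (continuousOn_time hθ') hA hB) hA
      (fun t ht x => by simp [deriv_eq_zero_of_vanishing h0 ht])]
  simp only [integral_mul_const] at h1 ⊢
  simp only [totalEnergy] at h1
  linarith

/-- The integral over a slab of a time derivative vanishes. -/
theorem integral_slab_deriv_cutoff (hAB : A ≤ B) (hA : 0 < A) (hB : B < T) {G : ℝ → E3 → ℝ}
    (hG : ContDiffOn ℝ 1 (fun p : ℝ × E3 => G p.1 p.2) (Ioo 0 T ×ˢ univ)) {θ : ℝ → ℝ}
    (hθ : ContDiff ℝ ∞ θ) (hθA : θ A = 0) (hθB : θ B = 0) :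
    ∫ p in slab ℓ hℓ A B, (deriv θ p.1 * G p.1 p.2
      + θ p.1 * deriv (fun s => G s p.2) p.1) = 0 := by
  have hθ' : Continuous (deriv θ) := hθ.continuous_deriv (by simp)
  have hGt : ContinuousOn (fun p : ℝ × E3 => deriv (fun s => G s p.2) p.1) (Ioo 0 T ×ˢ univ) :=
    (contDiffOn_deriv_time isOpen_Ioo hG (m := 0) (by norm_num)).continuousOn
  have hcont : ContinuousOn (fun p : ℝ × E3 => deriv θ p.1 * G p.1 p.2
      + θ p.1 * deriv (fun s => G s p.2) p.1) (Ioo 0 T ×ˢ univ) :=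
    ((continuousOn_time hθ').mul hG.continuousOn).add
      ((continuousOn_time hθ.continuous).mul hGt)
  have hint := integrableOn_slab_of_continuousOn (ℓ := ℓ) (hℓ := hℓ) hcont hA hB
  have hsub : ∀ t ∈ Icc A B, t ∈ Ioo 0 T := fun t ht => ⟨hA.trans_le ht.1, ht.2.trans_lt hB⟩
  rw [IntegrableOn, restrict_slab] at hint
  -- Integrate in time first: for fixed `x` the integrand is the derivative of `θ G`, which vanishes
  -- at both ends.
  rw [restrict_slab, integral_prod_symm _ hint]
  refine integral_eq_zero_of_ae (Eventually.of_forall fun x => ?_)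
  have hder : ∀ t ∈ uIcc A B, HasDerivAt (fun s => θ s * G s x)
      (deriv θ t * G t x + θ t * deriv (fun s => G s x) t) t := by
    intro t ht
    rw [uIcc_of_le hAB] at ht
    exact (hθ.differentiable (by simp) t).hasDerivAt.mul (hasDerivAt_time isOpen_Ioo
      (hG.differentiableOn one_ne_zero) (hsub t ht) x).differentiableAt.hasDerivAt
  have hci : IntervalIntegrable (fun t => deriv θ t * G t x + θ t * deriv (fun s => G s x) t)
      volume A B := by
    refine ContinuousOn.intervalIntegrable ?_
    rw [uIcc_of_le hAB]
    exact hcont.comp (f := fun t => (t, x)) (by fun_prop) fun t ht => ⟨hsub t ht, mem_univ x⟩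
  have h1 := intervalIntegral.integral_eq_sub_of_hasDerivAt hder hci
  rw [hθA, hθB, zero_mul, zero_mul, sub_zero, intervalIntegral.integral_of_le hAB,
    ← integral_Icc_eq_integral_Ioc] at h1
  exact h1

theorem integral_sub_sub_sub_add {X : Type*} [MeasurableSpace X] {μ : Measure X}
    {f₁ f₂ f₃ f₄ f₅ : X → ℝ} (h₁ : Integrable f₁ μ) (h₂ : Integrable f₂ μ) (h₃ : Integrable f₃ μ)
    (h₄ : Integrable f₄ μ) (h₅ : Integrable f₅ μ) :
    ∫ x, (f₁ x - f₂ x - f₃ x - f₄ x + f₅ x) ∂μ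
      = ∫ x, f₁ x ∂μ - ∫ x, f₂ x ∂μ - ∫ x, f₃ x ∂μ - ∫ x, f₄ x ∂μ + ∫ x, f₅ x ∂μ := by
  rw [← integral_sub' h₁ h₂, ← integral_sub' (h₁.sub h₂) h₃,
    ← integral_sub' ((h₁.sub h₂).sub h₃) h₄, ← integral_add' (((h₁.sub h₂).sub h₃).sub h₄) h₅]
  rfl

/-- The weak form of the relative energy balance. -/
theorem IsDissipativeWeakSolution.relativeEnergy_cutoff
    (sol : IsDissipativeWeakSolution (Domain.torus ℓ hℓ) b h c ε ρ q v)
    (hb : ∀ i j, b i j = b j i) (hF : EnergyHypothesis h c) (hρ : DensityBounds T κ K ρ)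
    (hκ : 0 < κ) (hlim : IsSmoothLimitSolution (Domain.torus ℓ hℓ) h c T ρb w)
    (hpos : ∀ i, ∀ t ∈ Ioo 0 T, ∀ x, 0 < ρb i t x) (hA : 0 < A) (hB : B < T) :
    IntegrableOn (fun p : ℝ × E3 => ∑ i, relativeEnergyComponent (h i) (c i) (ρb i p.1) (w p.1)
      (ρ i p.1 p.2) (q i p.1 p.2) (v i p.1 p.2) p.2) (slab ℓ hℓ A B) ∧
    IntegrableOn (fun p : ℝ × E3 => ∑ i, componentRate (h i) (c i) (ρb i p.1)
        (fun x => -divergence (fun y => ρb i p.1 y • w p.1 y) x) (w p.1)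
        (fun y => deriv (fun s => w s y) p.1) (ρ i p.1 p.2) (q i p.1 p.2) (v i p.1 p.2) p.2
      - 1 / (2 * ε) * dissipation b ρ v p.1 p.2) (slab ℓ hℓ A B) ∧
    ∀ θ : ℝ → ℝ, ContDiff ℝ ∞ θ → (∀ t, 0 ≤ θ t) → ∀ a₁ b₁, A < a₁ → b₁ < B →
      (∀ t, t ∉ Icc a₁ b₁ → θ t = 0) →
      0 ≤ ∫ p in slab ℓ hℓ A B,
        (deriv θ p.1 * (∑ i, relativeEnergyComponent (h i) (c i) (ρb i p.1) (w p.1)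
          (ρ i p.1 p.2) (q i p.1 p.2) (v i p.1 p.2) p.2)
        + θ p.1 * (∑ i, componentRate (h i) (c i) (ρb i p.1)
            (fun x => -divergence (fun y => ρb i p.1 y • w p.1 y) x) (w p.1)
            (fun y => deriv (fun s => w s y) p.1) (ρ i p.1 p.2) (q i p.1 p.2) (v i p.1 p.2) p.2
          - 1 / (2 * ε) * dissipation b ρ v p.1 p.2)) := by
  have hsubI : Ioo (0 : ℝ) T ×ˢ (univ : Set E3) ⊆ Ico 0 T ×ˢ univ :=
    prod_mono Ioo_subset_Ico_self subset_rfl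
  have hf := fun i => (hlim.smooth_density i).mono hsubI
  have hw := hlim.smooth_velocity.mono hsubI
  have hsub : ∀ t ∈ Icc A B, t ∈ Ioo 0 T := fun t ht => ⟨hA.trans_le ht.1, ht.2.trans_lt hB⟩
  have hu : UniqueDiffOn ℝ (Ioo (0 : ℝ) T) := isOpen_Ioo.uniqueDiffOn
  set ft : Fin n → ℝ → E3 → ℝ := fun i t x => -divergence (fun y => ρb i t y • w t y) x with hft
  set wt : ℝ → E3 → E3 := fun t y => deriv (fun s => w s y) t with hwt
  set μ : Fin n → ℝ → E3 → ℝ := fun i t x => potential (h i) (c i) (ρb i t) x with hμ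
  set μt : Fin n → ℝ → E3 → ℝ := fun i t x => potentialLin (h i) (c i) (ρb i t) (ft i t) x with hμt
  set ψ : Fin n → ℝ → E3 → ℝ := fun i t x => μ i t x - 1 / 2 * ‖w t x‖ ^ 2 with hψ
  set g : Fin n → ℝ → E3 → ℝ := fun i t x =>
    μ i t x * ρb i t x - energyF (h i) (c i) (ρb i t x) (gradient (ρb i t) x) with hg
  set gt : Fin n → ℝ → E3 → ℝ := fun i t x => μ i t x * ft i t x + ρb i t x * μt i t x
    - energyLin (h i) (c i) (ρb i t) (ft i t) x with hgt
  -- The limit mass equation identifies the time derivative of the density with the spatial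
  -- expression used in the fixed-time identities.
  have hftd : ∀ i, ∀ t ∈ Ioo 0 T, (fun y => deriv (fun s => ρb i s y) t) = ft i t :=
    fun i t ht => funext fun y => eq_neg_of_add_eq_zero_left (hlim.mass i t ht y)
  have cμ : ∀ i, ContDiffOn ℝ 1 (fun p : ℝ × E3 => μ i p.1 p.2) (Ioo 0 T ×ˢ univ) := fun i =>
    contDiffOn_potential hu (hF.1 i) (hF.2.1 i) (hf i) (hpos i)
  have cψ : ∀ i, ContDiffOn ℝ 1 (fun p : ℝ × E3 => ψ i p.1 p.2) (Ioo 0 T ×ˢ univ) := fun i =>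
    (cμ i).sub (contDiffOn_const.mul ((contDiffOn_infty.1 hw 1).norm_sq ℝ))
  have cg : ∀ i, ContDiffOn ℝ 1 (fun p : ℝ × E3 => g i p.1 p.2) (Ioo 0 T ×ˢ univ) := fun i =>
    ((cμ i).mul (contDiffOn_infty.1 (hf i) 1)).sub
      (contDiffOn_energyF hu (hF.1 i) (hF.2.1 i) (hf i) (hpos i))
  have dμ : ∀ i, ∀ t ∈ Ioo 0 T, ∀ x, HasDerivAt (fun s => μ i s x) (μt i t x) t := by
    intro i t ht x
    have h1 := hasDerivAt_potential_time isOpen_Ioo (hF.1 i) (hF.2.1 i) (hf i) (hpos i) ht x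
    rwa [hftd i t ht] at h1
  have dw : ∀ t ∈ Ioo 0 T, ∀ x, HasDerivAt (fun s => w s x) (wt t x) t := fun t ht x =>
    (hasDerivAt_time isOpen_Ioo (hw.differentiableOn (by simp)) ht x).differentiableAt.hasDerivAt
  have dψ : ∀ i, ∀ t ∈ Ioo 0 T, ∀ x,
      HasDerivAt (fun s => ψ i s x) (μt i t x - inner ℝ (w t x) (wt t x)) t := by
    intro i t ht x
    refine ((dμ i t ht x).sub ((dw t ht x).norm_sq.const_mul (1 / 2))).congr_deriv ?_
    ring
  have dg : ∀ i, ∀ t ∈ Ioo 0 T, ∀ x, HasDerivAt (fun s => g i s x) (gt i t x) t := by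
    intro i t ht x
    have h1 := hasDerivAt_energyF_time isOpen_Ioo (hF.1 i) (hF.2.1 i) (hf i) (hpos i) ht x
    have h2 : HasDerivAt (fun s => ρb i s x) (ft i t x) t := by
      rw [← hftd i t ht]
      exact (hasDerivAt_time isOpen_Ioo ((hf i).differentiableOn (by simp))
        ht x).differentiableAt.hasDerivAt
    rw [hftd i t ht] at h1
    refine (((dμ i t ht x).mul h2).sub h1).congr_deriv ?_
    simp only [hgt]
    ring
  have iρ := fun i => sol.integrableOn_density hρ hκ hA hB i
  have im := fun i => sol.integrableOn_momentum hρ hκ hA hB i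
  have iX1 : ∀ i, IntegrableOn (fun p : ℝ × E3 => ρ i p.1 p.2 * ψ i p.1 p.2) (slab ℓ hℓ A B) :=
    fun i => integrableOn_slab_mul (iρ i) (cψ i).continuousOn hA hB
  have iY1 : ∀ i, IntegrableOn (fun p : ℝ × E3 =>
      ρ i p.1 p.2 * (μt i p.1 p.2 - inner ℝ (w p.1 p.2) (wt p.1 p.2))
        + inner ℝ (ρ i p.1 p.2 • v i p.1 p.2) (gradient (ψ i p.1) p.2)) (slab ℓ hℓ A B) := by
    intro i
    refine (integrableOn_slab_mul (iρ i) (T := T) ?_ hA hB).add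
      (integrableOn_slab_inner (im i) (T := T) (fun k => ?_) hA hB)
    · refine ((contDiffOn_deriv_time isOpen_Ioo (cψ i) (m := 0)
        (by norm_num)).continuousOn).congr fun p hp => ?_
      exact (dψ i p.1 hp.1 p.2).deriv.symm
    · simp only [gradient_apply]
      exact (contDiffOn_pderiv hu (F := ψ i) (cψ i) (m := 0) (by norm_num) k).continuousOn
  have iX2 : ∀ i, IntegrableOn (fun p : ℝ × E3 =>
      inner ℝ (ρ i p.1 p.2 • v i p.1 p.2) (w p.1 p.2)) (slab ℓ hℓ A B) := fun i =>
    integrableOn_slab_inner (im i) (fun k => (contDiffOn_apply_slab hw k).continuousOn) hA hB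
  have iY2 := fun i => sol.integrableOn_momentumPower hρ hκ hA hB hw i
  have iX3 : ∀ i, IntegrableOn (fun p : ℝ × E3 => g i p.1 p.2) (slab ℓ hℓ A B) := fun i =>
    integrableOn_slab_of_continuousOn (cg i).continuousOn hA hB
  have iY3 : ∀ i, IntegrableOn (fun p : ℝ × E3 => gt i p.1 p.2) (slab ℓ hℓ A B) := fun i =>
    integrableOn_slab_of_continuousOn (((contDiffOn_deriv_time isOpen_Ioo (cg i) (m := 0)
        (by norm_num)).continuousOn).congr fun p hp => (dg i p.1 hp.1 p.2).deriv.symm) hA hB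
  have ie := sol.integrableOn_energyDensity hF hρ hκ hA hB
  -- The integrability statement does not depend on the cut-off, so the zero function serves.
  have idiss := (sol.energy_cutoff hF hρ hκ hA hB (θ := fun _ => 0) contDiff_const
    (fun _ => le_rfl) (fun _ _ => rfl)).1
  -- The relative energy as energy, minus mass tested with `ψ`, minus momentum tested with `w`, plus
  -- a smooth remainder; `eR` splits the rate accordingly.
  have eE : ∀ p : ℝ × E3, ∑ i, relativeEnergyComponent (h i) (c i) (ρb i p.1) (w p.1)
      (ρ i p.1 p.2) (q i p.1 p.2) (v i p.1 p.2) p.2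
      = energyDensity h c ρ q v p.1 p.2 - ∑ i, ρ i p.1 p.2 * ψ i p.1 p.2
        - ∑ i, inner ℝ (ρ i p.1 p.2 • v i p.1 p.2) (w p.1 p.2) + ∑ i, g i p.1 p.2 := by
    intro p
    simp only [energyDensity, ← Finset.sum_sub_distrib, ← Finset.sum_add_distrib]
    refine Finset.sum_congr rfl fun i _ => ?_
    simp only [relativeEnergyComponent, hψ, hg, hμ]
    ring
  have eR : ∀ p : ℝ × E3, ∑ i, componentRate (h i) (c i) (ρb i p.1) (ft i p.1) (w p.1) (wt p.1)
        (ρ i p.1 p.2) (q i p.1 p.2) (v i p.1 p.2) p.2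
      = ∑ i, gt i p.1 p.2 - ∑ i, (ρ i p.1 p.2 * (μt i p.1 p.2 - inner ℝ (w p.1 p.2) (wt p.1 p.2))
        + inner ℝ (ρ i p.1 p.2 • v i p.1 p.2) (gradient (ψ i p.1) p.2))
        - ∑ i, momentumPower (h i) (c i) (w p.1) (wt p.1) (ρ i p.1 p.2) (q i p.1 p.2)
          (v i p.1 p.2) p.2 := by
    intro p
    simp only [← Finset.sum_sub_distrib]
    rfl
  have iE : IntegrableOn (fun p : ℝ × E3 => ∑ i, relativeEnergyComponent (h i) (c i) (ρb i p.1)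
      (w p.1) (ρ i p.1 p.2) (q i p.1 p.2) (v i p.1 p.2) p.2) (slab ℓ hℓ A B) := by
    simp only [eE]
    exact ((ie.sub (integrable_finsetSum _ fun i _ => iX1 i)).sub
      (integrable_finsetSum _ fun i _ => iX2 i)).add (integrable_finsetSum _ fun i _ => iX3 i)
  have iR : IntegrableOn (fun p : ℝ × E3 => ∑ i, componentRate (h i) (c i) (ρb i p.1) (ft i p.1)
        (w p.1) (wt p.1) (ρ i p.1 p.2) (q i p.1 p.2) (v i p.1 p.2) p.2
      - 1 / (2 * ε) * dissipation b ρ v p.1 p.2) (slab ℓ hℓ A B) := by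
    simp only [eR]
    exact (((integrable_finsetSum _ fun i _ => iY3 i).sub
      (integrable_finsetSum _ fun i _ => iY1 i)).sub
      (integrable_finsetSum _ fun i _ => iY2 i)).sub (idiss.const_mul _)
  refine ⟨iE, iR, fun θ hθ hθ0 a₁ b₁ ha₁ hb₁ h0 => ?_⟩
  have hθc := continuousOn_time hθ.continuous (s := Ioo 0 T ×ˢ (univ : Set E3))
  have hθ'c := continuousOn_time (hθ.continuous_deriv (by simp)) (s := Ioo 0 T ×ˢ (univ : Set E3))
  have h0' : ∀ t, t ∉ Icc A B → θ t = 0 := fun t ht => h0 t fun h3 =>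
    ht (Icc_subset_Icc ha₁.le hb₁.le h3)
  have hcomb : ∀ {X Y : ℝ × E3 → ℝ}, IntegrableOn X (slab ℓ hℓ A B) →
      IntegrableOn Y (slab ℓ hℓ A B) →
      IntegrableOn (fun p => deriv θ p.1 * X p + θ p.1 * Y p) (slab ℓ hℓ A B) := by
    intro X Y hX hY
    refine ((integrableOn_slab_mul hX hθ'c hA hB).add
      (integrableOn_slab_mul hY hθc hA hB)).congr (Eventually.of_forall fun p => ?_)
    simp only [Pi.add_apply]
    ring
  -- The test function `θ ψ` is treated as `C¹`, which is why the mass equation had to be extended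
  -- to such functions.
  have z1 : ∀ i, ∫ p in slab ℓ hℓ A B, (deriv θ p.1 * (ρ i p.1 p.2 * ψ i p.1 p.2)
      + θ p.1 * (ρ i p.1 p.2 * (μt i p.1 p.2 - inner ℝ (w p.1 p.2) (wt p.1 p.2))
        + inner ℝ (ρ i p.1 p.2 • v i p.1 p.2) (gradient (ψ i p.1) p.2))) = 0 := by
    intro i
    have htest := sol.mass_contDiff_one hρ hκ hA hB ha₁ hb₁ i (ψ := fun t x => θ t * ψ i t x)
      (contDiff_of_vanishing (ha₁.trans' hA) (hb₁.trans hB)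
        (((contDiff_infty.1 hθ 1).comp contDiff_fst).contDiffOn.mul (cψ i))
        fun t ht x => by simp [h0 t ht])
      (fun t k x => by
        by_cases ht : t ∈ Icc A B
        · have h1 := hlim.on_domain_density i t (Ioo_subset_Ico_self (hsub t ht))
          have h2 := hlim.on_domain_velocity t (Ioo_subset_Ico_self (hsub t ht)) k x
          have h3 := h1 k x
          have h4 := fun j => h1.pderiv j k x
          have h5 := fun j => (h1.pderiv j).pderiv j k x
          simp only [hψ, hμ, potential, h2, h3, h4, h5]
        · simp only [h0' t ht, zero_mul])
      (fun t ht x => by simp [h0 t ht])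
    rw [← htest]
    refine setIntegral_congr_fun measurableSet_slab fun p hp => ?_
    have ht := hsub p.1 hp.1
    have d1 : deriv (fun s => θ s * ψ i s p.2) p.1 = _ :=
      ((hθ.differentiable (by simp) p.1).hasDerivAt.mul (dψ i p.1 ht p.2)).deriv
    have d2 : DifferentiableAt ℝ (ψ i p.1) p.2 :=
      (contDiff_slice (cψ i) ht).differentiable one_ne_zero p.2
    simp only [d1, gradient_const_mul d2, inner_smul_right]
    ring
  have z2 := sol.sum_momentum_cutoff hb hρ hκ hA hB hw
    (fun t ht => hlim.on_domain_velocity t (Ioo_subset_Ico_self ht)) hθ h0'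
  have z4 := (sol.energy_cutoff hF hρ hκ hA hB hθ hθ0 h0').2
  have iθe := integrableOn_slab_mul ie hθ'c hA hB
  have iθd := integrableOn_slab_mul idiss hθc hA hB
  have z3 : ∀ i, ∫ p in slab ℓ hℓ A B, (deriv θ p.1 * g i p.1 p.2 + θ p.1 * gt i p.1 p.2) = 0 := by
    intro i
    by_cases hAB : A ≤ B
    · rw [← integral_slab_deriv_cutoff (ℓ := ℓ) (hℓ := hℓ) hAB hA hB (cg i) hθ
        (h0 A fun h3 => by linarith [h3.1]) (h0 B fun h3 => by linarith [h3.2])]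
      exact setIntegral_congr_fun measurableSet_slab fun p hp => by
        simp only [(dg i p.1 (hsub p.1 hp.1) p.2).deriv]
    · simp [slab, Icc_eq_empty hAB]
  have hfinal : ∫ p in slab ℓ hℓ A B,
        (deriv θ p.1 * (∑ i, relativeEnergyComponent (h i) (c i) (ρb i p.1) (w p.1)
          (ρ i p.1 p.2) (q i p.1 p.2) (v i p.1 p.2) p.2)
        + θ p.1 * (∑ i, componentRate (h i) (c i) (ρb i p.1) (ft i p.1) (w p.1)
            (wt p.1) (ρ i p.1 p.2) (q i p.1 p.2) (v i p.1 p.2) p.2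
          - 1 / (2 * ε) * dissipation b ρ v p.1 p.2))
      = ((∫ p in slab ℓ hℓ A B, energyDensity h c ρ q v p.1 p.2 * deriv θ p.1)
        - 1 / (2 * ε) * ∫ p in slab ℓ hℓ A B, dissipation b ρ v p.1 p.2 * θ p.1)
        - (∑ i, ∫ p in slab ℓ hℓ A B, (deriv θ p.1 * (ρ i p.1 p.2 * ψ i p.1 p.2)
      + θ p.1 * (ρ i p.1 p.2 * (μt i p.1 p.2 - inner ℝ (w p.1 p.2) (wt p.1 p.2))
        + inner ℝ (ρ i p.1 p.2 • v i p.1 p.2) (gradient (ψ i p.1) p.2))))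
        - (∑ i, ∫ p in slab ℓ hℓ A B,
          (deriv θ p.1 * inner ℝ (ρ i p.1 p.2 • v i p.1 p.2) (w p.1 p.2)
          + θ p.1 * momentumPower (h i) (c i) (w p.1) (wt p.1)
          (ρ i p.1 p.2) (q i p.1 p.2) (v i p.1 p.2) p.2))
        + ∑ i, ∫ p in slab ℓ hℓ A B, (deriv θ p.1 * g i p.1 p.2 + θ p.1 * gt i p.1 p.2) := by
    rw [← integral_const_mul,
      ← integral_finsetSum _ fun i _ => hcomb (iX1 i) (iY1 i),
      ← integral_finsetSum _ fun i _ => hcomb (iX2 i) (iY2 i),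
      ← integral_finsetSum _ fun i _ => hcomb (iX3 i) (iY3 i),
      ← integral_sub_sub_sub_add iθe (iθd.const_mul _)
        (integrable_finsetSum _ fun i _ => hcomb (iX1 i) (iY1 i))
        (integrable_finsetSum _ fun i _ => hcomb (iX2 i) (iY2 i))
        (integrable_finsetSum _ fun i _ => hcomb (iX3 i) (iY3 i))]
    refine integral_congr_ae (Eventually.of_forall fun p => ?_)
    simp only [eE, eR]
    rw [Finset.sum_add_distrib (f := fun i => deriv θ p.1 * (ρ i p.1 p.2 * ψ i p.1 p.2)),
      Finset.sum_add_distrib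
        (f := fun i => deriv θ p.1 * inner ℝ (ρ i p.1 p.2 • v i p.1 p.2) (w p.1 p.2)),
      Finset.sum_add_distrib (f := fun i => deriv θ p.1 * g i p.1 p.2)]
    simp only [← Finset.mul_sum]
    ring
  -- The mass, momentum and smooth parts contribute zero, and the energy inequality gives the sign.
  rw [hfinal, z2, Finset.sum_eq_zero fun i _ => z1 i, Finset.sum_eq_zero fun i _ => z3 i]
  linarith

end

/-! ### Continuity in time and the Gronwall argument -/

section

variable {ℓ : ℝ} {hℓ : 0 < ℓ} {T : ℝ}

theorem exists_bound_closedSlab {F : ℝ → E3 → ℝ}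
    (hF : ContinuousOn (fun p : ℝ × E3 => F p.1 p.2) (Ico 0 T ×ˢ univ)) (ℓ : ℝ) {b : ℝ}
    (hb : b < T) : ∃ C, 0 ≤ C ∧ ∀ t ∈ Icc 0 b, ∀ x ∈ closedCell ℓ, |F t x| ≤ C := by
  obtain ⟨C, hC⟩ := (isCompact_closedSlab (ℓ := ℓ) (A := 0) (B := b)).exists_bound_of_continuousOn
    (hF.mono (prod_mono (fun t ht => ⟨ht.1, ht.2.trans_lt hb⟩) (subset_univ _)))
  exact ⟨max C 0, le_max_right _ _, fun t ht x hx =>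
    (hC (t, x) ⟨ht, hx⟩).trans (le_max_left _ _)⟩

theorem continuous_slice {V : Type*} [TopologicalSpace V] {I : Set ℝ} {F : ℝ → E3 → V}
    (hF : ContinuousOn (fun p : ℝ × E3 => F p.1 p.2) (I ×ˢ univ)) {t : ℝ} (ht : t ∈ I) :
    Continuous (F t) :=
  hF.comp_continuous (f := fun x : E3 => (t, x)) (by fun_prop) fun x => ⟨ht, mem_univ x⟩

theorem integrableOn_mul_slice {u : E3 → ℝ} {F : ℝ → E3 → ℝ}
    (hu : IntegrableOn u (Domain.torus ℓ hℓ).cell)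
    (hF : ContinuousOn (fun p : ℝ × E3 => F p.1 p.2) (Ico 0 T ×ˢ univ)) {t : ℝ}
    (ht : t ∈ Ico 0 T) : IntegrableOn (fun x => u x * F t x) (Domain.torus ℓ hℓ).cell :=
  hu.mul_continuousOn_of_subset (continuous_slice hF ht).continuousOn (measurableSet_cell _)
    (isCompact_closedCell ℓ) (cell_subset_closedCell ℓ hℓ)

/-- Split `u t F t` as `(u t - u t₀) F t + u t₀ F t`: the first integral tends to zero by `L¹`
continuity and local boundedness of `F`, the second converges by dominated convergence. -/
theorem continuousOn_integral_mul {u F : ℝ → E3 → ℝ}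
    (hu : ContinuousInL1 (Domain.torus ℓ hℓ) u)
    (hF : ContinuousOn (fun p : ℝ × E3 => F p.1 p.2) (Ico 0 T ×ˢ univ)) :
    ContinuousOn (fun t => ∫ x in (Domain.torus ℓ hℓ).cell, u t x * F t x) (Ico 0 T) := by
  intro t₀ ht₀
  obtain ⟨C, hC0, hC⟩ := exists_bound_closedSlab hF ℓ (b := (t₀ + T) / 2) (by linarith [ht₀.2])
  have hev : ∀ᶠ t in 𝓝[Ico 0 T] t₀, t ∈ Ico 0 T ∧ t ∈ Icc 0 ((t₀ + T) / 2) := by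
    filter_upwards [self_mem_nhdsWithin, mem_nhdsWithin_of_mem_nhds
      (Iio_mem_nhds (show t₀ < (t₀ + T) / 2 by linarith [ht₀.2]))] with t h1 h2
    exact ⟨h1, h1.1, le_of_lt h2⟩
  have hcell : ∀ᵐ x ∂volume.restrict (Domain.torus ℓ hℓ).cell, x ∈ closedCell ℓ :=
    (ae_restrict_mem (measurableSet_cell _)).mono fun x hx => cell_subset_closedCell ℓ hℓ hx
  have h1 : Tendsto (fun t => ∫ x in (Domain.torus ℓ hℓ).cell, (u t x - u t₀ x) * F t x)
      (𝓝[Ico 0 T] t₀) (𝓝 0) := by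
    have h2 := (hu.2 t₀ ht₀.1).mono_left (nhdsWithin_mono t₀
      (show Ico 0 T ⊆ Ici 0 from fun t ht => ht.1))
    have h3 := ENNReal.Tendsto.const_mul (a := ENNReal.ofReal C) h2 (Or.inr ENNReal.ofReal_ne_top)
    rw [mul_zero] at h3
    refine tendsto_zero_iff_enorm_tendsto_zero.2 (tendsto_of_tendsto_of_tendsto_of_le_of_le'
      tendsto_const_nhds h3 (Eventually.of_forall fun _ => bot_le) ?_)
    filter_upwards [hev] with t ht
    refine (enorm_integral_le_lintegral_enorm _).trans ?_
    rw [← lintegral_const_mul' _ _ ENNReal.ofReal_ne_top]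
    refine lintegral_mono_ae ?_
    filter_upwards [hcell] with x hx
    rw [enorm_mul, mul_comm]
    refine mul_le_mul_left ?_ _
    rw [Real.enorm_eq_ofReal_abs]
    exact ENNReal.ofReal_le_ofReal (hC t ht.2 x hx)
  have h2 : Tendsto (fun t => ∫ x in (Domain.torus ℓ hℓ).cell, u t₀ x * F t x)
      (𝓝[Ico 0 T] t₀) (𝓝 (∫ x in (Domain.torus ℓ hℓ).cell, u t₀ x * F t₀ x)) := by
    refine tendsto_integral_filter_of_dominated_convergence (fun x => |u t₀ x| * C) ?_ ?_ ?_ ?_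
    · filter_upwards [hev] with t ht
      exact (integrableOn_mul_slice (hu.1 t₀ ht₀.1) hF ht.1).aestronglyMeasurable
    · filter_upwards [hev] with t ht
      filter_upwards [hcell] with x hx
      rw [Real.norm_eq_abs, abs_mul]
      exact mul_le_mul_of_nonneg_left (hC t ht.2 x hx) (abs_nonneg _)
    · exact (hu.1 t₀ ht₀.1).abs.mul_const C
    · refine Eventually.of_forall fun x => ?_
      have h3 : ContinuousOn (fun t => F t x) (Ico 0 T) :=
        hF.comp (f := fun t => (t, x)) (by fun_prop) fun t ht => ⟨ht, mem_univ x⟩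
      exact (h3 t₀ ht₀).tendsto.const_mul _
  have h3 := h1.add h2
  rw [zero_add] at h3
  refine h3.congr' ?_
  filter_upwards [hev] with t ht
  have i1 : IntegrableOn (fun x => (u t x - u t₀ x) * F t x) (Domain.torus ℓ hℓ).cell :=
    integrableOn_mul_slice ((hu.1 t ht.1.1).sub (hu.1 t₀ ht₀.1)) hF ht.1
  rw [← integral_add i1 (integrableOn_mul_slice (hu.1 t₀ ht₀.1) hF ht.1)]
  refine integral_congr_ae (Eventually.of_forall fun x => ?_)
  simp only
  ring

theorem ContinuousInL1.apply {D : Domain} {m : ℝ → E3 → E3} (hm : ContinuousInL1 D m)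
    (k : Fin 3) : ContinuousInL1 D fun t x => m t x k := by
  refine ⟨fun t ht => (EuclideanSpace.proj (𝕜 := ℝ) k).integrable_comp (hm.1 t ht),
    fun t₀ ht₀ => ?_⟩
  refine tendsto_of_tendsto_of_tendsto_of_le_of_le tendsto_const_nhds (hm.2 t₀ ht₀)
    (fun _ => bot_le) fun t => lintegral_mono fun x => ?_
  rw [enorm_le_iff_norm_le, Real.norm_eq_abs]
  exact abs_apply_le_norm (m t x - m t₀ x) k

theorem continuousInL1_one : ContinuousInL1 (Domain.torus ℓ hℓ) fun _ _ => (1 : ℝ) :=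
  ⟨fun _ _ => integrableOn_cell_of_continuous hℓ continuous_const,
    fun t₀ _ => by simp [tendsto_const_nhds]⟩

/-- An integrable limit of functions with values in an interval takes values in that interval. -/
theorem ContinuousInL1.ae_mem_Icc {D : Domain} {u : ℝ → E3 → ℝ} (hu : ContinuousInL1 D u)
    {κ K : ℝ} (hκ : κ ≤ K) (hT : 0 < T)
    (h : ∀ t ∈ Ioo 0 T, ∀ᵐ x ∂volume.restrict D.cell, u t x ∈ Icc κ K) :
    ∀ᵐ x ∂volume.restrict D.cell, u 0 x ∈ Icc κ K := by
  have hm : AEMeasurable (fun x => ‖u 0 x - max κ (min (u 0 x) K)‖ₑ) (volume.restrict D.cell) := by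
    have h1 := (hu.1 0 le_rfl).aestronglyMeasurable.aemeasurable
    exact (h1.sub (aemeasurable_const.max (h1.min aemeasurable_const))).enorm
  -- The integrand is the distance of `u 0 x` to `[κ,K]`, at most `|u t x - u 0 x|` for every small
  -- positive `t`.
  have h0 : ∫⁻ x in D.cell, ‖u 0 x - max κ (min (u 0 x) K)‖ₑ = 0 := by
    refine le_antisymm ?_ bot_le
    have h2 := (hu.2 0 le_rfl).mono_left (nhdsWithin_mono 0 Ioi_subset_Ici_self)
    refine ge_of_tendsto h2 ?_
    filter_upwards [Ioo_mem_nhdsGT hT] with t ht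
    refine lintegral_mono_ae ?_
    filter_upwards [h t ht] with x hx
    rw [enorm_le_iff_norm_le, Real.norm_eq_abs, Real.norm_eq_abs]
    obtain ⟨h3, h4⟩ := hx
    rcases le_total (u 0 x) K with h5 | h5
    · rw [min_eq_left h5]
      rcases le_total (u 0 x) κ with h6 | h6
      · rw [max_eq_left h6, abs_sub_comm, abs_of_nonneg (by linarith), abs_of_nonneg (by linarith)]
        linarith
      · rw [max_eq_right h6, sub_self, abs_zero]
        exact abs_nonneg _
    · rw [min_eq_right h5, max_eq_right hκ, abs_of_nonneg (by linarith), abs_sub_comm,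
        abs_of_nonneg (by linarith)]
      linarith
  rw [lintegral_eq_zero_iff' hm] at h0
  filter_upwards [h0] with x hx
  have h1 : u 0 x = max κ (min (u 0 x) K) := by
    simpa [sub_eq_zero] using hx
  rw [h1]
  exact ⟨le_max_left _ _, max_le hκ (min_le_right _ _)⟩

/-- The bounds on the limit solution are given for positive times; continuity extends them to time
zero, where `χ` is also evaluated. -/
theorem le_on_Ico_of_le_on_Ioo (hT : 0 < T) {F : ℝ → E3 → ℝ} {B : ℝ}
    (hF : ContinuousOn (fun p : ℝ × E3 => F p.1 p.2) (Ico 0 T ×ˢ univ))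
    (h : ∀ t ∈ Ioo 0 T, ∀ x, F t x ≤ B) : ∀ t ∈ Ico 0 T, ∀ x, F t x ≤ B := by
  intro t ht x
  rcases ht.1.eq_or_lt with h0 | h0
  · subst h0
    have h3 : ContinuousOn (fun t => F t x) (Ico 0 T) :=
      hF.comp (f := fun t => (t, x)) (by fun_prop) fun t ht => ⟨ht, mem_univ x⟩
    have h4 := (h3 0 ht).tendsto.mono_left
      (nhdsWithin_mono 0 (Ioo_subset_Ico_self (a := (0 : ℝ)) (b := T)))
    have : (𝓝[Ioo 0 T] (0 : ℝ)).NeBot := by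
      rw [nhdsWithin_Ioo_eq_nhdsGT hT]
      infer_instance
    exact le_of_tendsto h4 (by filter_upwards [self_mem_nhdsWithin] with t ht using h t ht x)
  · exact h t ⟨h0, ht.2⟩ x

end

/-- A Gronwall inequality for continuous functions, with the differential inequality in the sense
of distributions. -/
theorem le_exp_mul_of_distributional {E : ℝ → ℝ} {T C ε : ℝ} (hE : ContinuousOn E (Ico 0 T))
    (H : ∀ θ : ℝ → ℝ, ContDiff ℝ ∞ θ → (∀ t, 0 ≤ θ t) → ∀ a b, 0 < a → b < T →
      (∀ t, t ∉ Icc a b → θ t = 0) →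
      0 ≤ ∫ t in Icc a b, (deriv θ t * E t + θ t * (C * E t + C * ε))) :
    ∀ t ∈ Ioo 0 T, E t ≤ Real.exp (C * t) * (E 0 + ε) - ε := by
  have hexp : ContDiff ℝ ∞ fun t => Real.exp (-(C * t)) :=
    Real.contDiff_exp.comp (contDiff_const.mul contDiff_id).neg
  have h1 := le_initial_of_distributional_deriv_nonpos (T := T)
    (f := fun t => Real.exp (-(C * t)) * (E t + ε))
    (hexp.continuous.continuousOn.mul (hE.add continuousOn_const)) ?_
  · intro t ht
    have h2 := h1 t ht
    simp only [mul_zero, neg_zero, Real.exp_zero, one_mul] at h2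
    rw [Real.exp_neg, inv_mul_le_iff₀ (Real.exp_pos _)] at h2
    linarith
  · intro θ hθ hθ0 a b ha hb h0
    rcases lt_or_ge b a with hab | hab
    · simp [Icc_eq_empty (not_le.2 hab)]
    -- The integrating factor goes into the test function: `θ' e^{-Ct} = η' + C η`. The extra term
    -- `ε η'` integrates to zero because `η` vanishes at both endpoints.
    set η : ℝ → ℝ := fun t => θ t * Real.exp (-(C * t)) with hη
    have hηs : ContDiff ℝ ∞ η := hθ.mul hexp
    have hη0 : ∀ t, t ∉ Icc a b → η t = 0 := fun t ht => by simp [hη, h0 t ht]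
    have h2 := H η hηs (fun t => mul_nonneg (hθ0 t) (Real.exp_pos _).le) a b ha hb hη0
    have hd : ∀ t, deriv η t = Real.exp (-(C * t)) * (deriv θ t - C * θ t) := by
      intro t
      have h3 : HasDerivAt (fun t => Real.exp (-(C * t))) (Real.exp (-(C * t)) * (-(C * 1))) t :=
        (((hasDerivAt_id t).const_mul C).neg).exp
      have h4 : deriv η t = _ := ((hθ.differentiable (by simp) t).hasDerivAt.mul h3).deriv
      rw [h4]
      ring
    have hcl : IsClosed {t | η t = 0} := isClosed_eq hηs.continuous continuous_const
    -- The hypothesis gives vanishing only outside `[a,b]`; continuity adds the endpoints.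
    have ha0 : η a = 0 := by
      have h3 : closure (Iio a) ⊆ {t | η t = 0} :=
        closure_minimal (fun t ht => hη0 t fun h4 => not_lt.2 h4.1 ht) hcl
      rw [closure_Iio] at h3
      exact h3 self_mem_Iic
    have hb0 : η b = 0 := by
      have h3 : closure (Ioi b) ⊆ {t | η t = 0} :=
        closure_minimal (fun t ht => hη0 t fun h4 => not_lt.2 h4.2 ht) hcl
      rw [closure_Ioi] at h3
      exact h3 self_mem_Ici
    have hηc : Continuous (deriv η) := hηs.continuous_deriv (by simp)
    have hint0 : ∫ t in Icc a b, ε * deriv η t = 0 := by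
      rw [integral_const_mul, integral_Icc_eq_integral_Ioc,
        ← intervalIntegral.integral_of_le hab, intervalIntegral.integral_deriv_eq_sub
          (fun t _ => hηs.differentiable (by simp) t) (hηc.intervalIntegrable _ _), ha0, hb0]
      simp
    have hEc : ContinuousOn E (Icc a b) := hE.mono fun t ht => ⟨ha.le.trans ht.1, ht.2.trans_lt hb⟩
    have hI1 : IntegrableOn (fun t => deriv η t * E t + η t * (C * E t + C * ε)) (Icc a b) :=
      ((hηc.continuousOn.mul hEc).add (hηs.continuous.continuousOn.mul
        ((continuousOn_const.mul hEc).add continuousOn_const))).integrableOn_compact isCompact_Icc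
    have hI2 : IntegrableOn (fun t => ε * deriv η t) (Icc a b) :=
      (continuous_const.mul hηc).continuousOn.integrableOn_compact isCompact_Icc
    have h5 : ∫ t in Icc a b, deriv θ t * (Real.exp (-(C * t)) * (E t + ε))
        = ∫ t in Icc a b, ((deriv η t * E t + η t * (C * E t + C * ε)) + ε * deriv η t) := by
      refine integral_congr_ae (Eventually.of_forall fun t => ?_)
      simp only [hd]
      simp only [hη]
      ring
    rw [h5, integral_add hI1 hI2, hint0, add_zero]
    exact h2

/-! ### The stability estimate -/

section

variable {ℓ : ℝ} {hℓ : 0 < ℓ} {T κ K : ℝ} {n : ℕ} {b : Fin n → Fin n → ℝ}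
  {h c : Fin n → ℝ → ℝ} {ε : ℝ} {ρ : Fin n → ℝ → E3 → ℝ} {q v : Fin n → ℝ → E3 → E3}
  {ρb : Fin n → ℝ → E3 → ℝ} {w : ℝ → E3 → E3}

/-- The relative energy is continuous in time. -/
theorem IsDissipativeWeakSolution.continuousOn_relativeEnergy
    (sol : IsDissipativeWeakSolution (Domain.torus ℓ hℓ) b h c ε ρ q v)
    (hF : EnergyHypothesis h c)
    (hlim : IsSmoothLimitSolution (Domain.torus ℓ hℓ) h c T ρb w)
    (hpos : ∀ i, ∀ t ∈ Ico 0 T, ∀ x, 0 < ρb i t x) :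
    (∀ t ∈ Ico 0 T, IntegrableOn (fun x => ∑ i, relativeEnergyComponent (h i) (c i) (ρb i t) (w t)
      (ρ i t x) (q i t x) (v i t x) x) (Domain.torus ℓ hℓ).cell) ∧
    ContinuousOn (fun t => ∫ x in (Domain.torus ℓ hℓ).cell, ∑ i, relativeEnergyComponent (h i)
      (c i) (ρb i t) (w t) (ρ i t x) (q i t x) (v i t x) x) (Ico 0 T) := by
  have hu : UniqueDiffOn ℝ (Ico 0 T) := uniqueDiffOn_Ico 0 T
  set ψ : Fin n → ℝ → E3 → ℝ := fun i t x =>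
    potential (h i) (c i) (ρb i t) x - 1 / 2 * ‖w t x‖ ^ 2 with hψ
  set g : Fin n → ℝ → E3 → ℝ := fun i t x => potential (h i) (c i) (ρb i t) x * ρb i t x
    - energyF (h i) (c i) (ρb i t x) (gradient (ρb i t) x) with hg
  have cμ := fun i => contDiffOn_potential hu (hF.1 i) (hF.2.1 i) (hlim.smooth_density i) (hpos i)
  have cψ : ∀ i, ContinuousOn (fun p : ℝ × E3 => ψ i p.1 p.2) (Ico 0 T ×ˢ univ) := fun i =>
    (cμ i).continuousOn.sub
      (continuousOn_const.mul (hlim.smooth_velocity.continuousOn.norm.pow 2))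
  have cg : ∀ i, ContinuousOn (fun p : ℝ × E3 => g i p.1 p.2) (Ico 0 T ×ˢ univ) := fun i =>
    ((cμ i).continuousOn.mul (hlim.smooth_density i).continuousOn).sub
      (contDiffOn_energyF hu (hF.1 i) (hF.2.1 i) (hlim.smooth_density i) (hpos i)).continuousOn
  have cw : ∀ k, ContinuousOn (fun p : ℝ × E3 => w p.1 p.2 k) (Ico 0 T ×ˢ univ) := fun k =>
    (contDiffOn_apply_slab hlim.smooth_velocity k).continuousOn
  have hm := fun i k => (sol.momentum_cont i).apply k
  -- The zero and the factor one fit the shapes required by `integral_sub_sub_sub_add` and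
  -- `continuousOn_integral_mul`.
  have e1 : ∀ t x, ∑ i, relativeEnergyComponent (h i) (c i) (ρb i t) (w t)
      (ρ i t x) (q i t x) (v i t x) x
      = energyDensity h c ρ q v t x - ∑ i, ρ i t x * ψ i t x
        - ∑ i, ∑ k, (ρ i t x • v i t x) k * w t x k - 0 + ∑ i, 1 * g i t x := by
    intro t x
    rw [sub_zero]
    simp only [energyDensity, ← Finset.sum_sub_distrib, ← Finset.sum_add_distrib]
    refine Finset.sum_congr rfl fun i _ => ?_
    rw [← inner_eq_sum]
    simp only [relativeEnergyComponent, hψ, hg]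
    ring
  have i1 : ∀ t ∈ Ico 0 T, IntegrableOn (energyDensity h c ρ q v t) (Domain.torus ℓ hℓ).cell :=
    fun t ht => sol.energy_cont.1 t ht.1
  have i2 : ∀ t ∈ Ico 0 T, ∀ i, IntegrableOn (fun x => ρ i t x * ψ i t x)
      (Domain.torus ℓ hℓ).cell := fun t ht i =>
    integrableOn_mul_slice ((sol.density_cont i).1 t ht.1) (cψ i) ht
  have i3 : ∀ t ∈ Ico 0 T, ∀ i k, IntegrableOn (fun x => (ρ i t x • v i t x) k * w t x k)
      (Domain.torus ℓ hℓ).cell := fun t ht i k =>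
    integrableOn_mul_slice (F := fun t x => w t x k) ((hm i k).1 t ht.1) (cw k) ht
  have i4 : ∀ t ∈ Ico 0 T, ∀ i, IntegrableOn (fun x => 1 * g i t x)
      (Domain.torus ℓ hℓ).cell := fun t ht i =>
    integrableOn_mul_slice (continuousInL1_one.1 t ht.1) (cg i) ht
  have i3' : ∀ t ∈ Ico 0 T, IntegrableOn (fun x => ∑ i, ∑ k, (ρ i t x • v i t x) k * w t x k)
      (Domain.torus ℓ hℓ).cell := fun t ht =>
    integrable_finsetSum _ fun i _ => integrable_finsetSum _ fun k _ => i3 t ht i k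
  simp only [e1]
  refine ⟨fun t ht => ((((i1 t ht).sub (integrable_finsetSum _ fun i _ => i2 t ht i)).sub
    (i3' t ht)).sub (integrable_zero _ _ _)).add (integrable_finsetSum _ fun i _ => i4 t ht i), ?_⟩
  have c1 : ContinuousOn (fun t => ∫ x in (Domain.torus ℓ hℓ).cell,
      energyDensity h c ρ q v t x * 1) (Ico 0 T) :=
    continuousOn_integral_mul sol.energy_cont (F := fun _ _ => 1) continuousOn_const
  have c2 := continuousOn_finsetSum (Finset.univ : Finset (Fin n)) fun i _ =>
    continuousOn_integral_mul (sol.density_cont i) (cψ i)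
  have c3 := continuousOn_finsetSum (Finset.univ : Finset (Fin n)) fun i _ =>
    continuousOn_finsetSum (Finset.univ : Finset (Fin 3)) fun k _ =>
      continuousOn_integral_mul (hm i k) (F := fun t x => w t x k) (cw k)
  have c4 := continuousOn_finsetSum (Finset.univ : Finset (Fin n)) fun i _ =>
    continuousOn_integral_mul (continuousInL1_one (ℓ := ℓ) (hℓ := hℓ)) (cg i)
  refine (((c1.sub c2).sub c3).add c4).congr fun t ht => ?_
  simp only [mul_one, Pi.sub_apply, Pi.add_apply]
  rw [integral_sub_sub_sub_add (f₄ := fun _ => 0) (i1 t ht)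
    (integrable_finsetSum _ fun i _ => i2 t ht i)
    (i3' t ht) (integrable_zero _ _ _)
    (integrable_finsetSum _ fun i _ => i4 t ht i),
    integral_finsetSum _ fun i _ => i2 t ht i, integral_finsetSum _ fun i _ => i4 t ht i,
    integral_finsetSum _ fun i _ => integrable_finsetSum _ fun k _ => i3 t ht i k, integral_zero,
    sub_zero]
  simp only [integral_finsetSum _ fun k _ => i3 t ht _ k]

/-- The stability estimate on the torus. -/
theorem exists_chi_estimate_torus (hn : 0 < n) (hN : FrictionHypothesis b)
    (hF : EnergyHypothesis h c) (hT : 0 < T) (hκ : 0 < κ) (hK : κ < K)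
    (hlim : IsSmoothLimitSolution (Domain.torus ℓ hℓ) h c T ρb w)
    (hbd : LimitBounds T ρb w) (hlow : ∀ i, ∀ t ∈ Ioo 0 T, ∀ x, κ ≤ ρb i t x) :
    ∃ C : ℝ, 0 < C ∧ ∀ ε : ℝ, 0 < ε → ∀ (ρ : Fin n → ℝ → E3 → ℝ) (q v : Fin n → ℝ → E3 → E3),
      IsDissipativeWeakSolution (Domain.torus ℓ hℓ) b h c ε ρ q v → DensityBounds T κ K ρ →
      ∀ t ∈ Ioo 0 T, chi (Domain.torus ℓ hℓ) c ρ q v ρb w t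
        ≤ ENNReal.ofReal C * (chi (Domain.torus ℓ hℓ) c ρ q v ρb w 0 + ENNReal.ofReal ε) := by
  obtain ⟨B, hB0, hB⟩ := exists_limit_bounds hn hF hκ hlim hbd hlow
  -- A common upper bound for both densities: `K` for the weak solutions, `B` for the limit.
  set K' : ℝ := max K B with hK'
  obtain ⟨C₁, hC₁, hrate⟩ := exists_rate_estimate hN hF hκ K' B hB0 hℓ
  obtain ⟨a, C₂, ha, hC₂, hcomp⟩ := exists_relativeEnergy_comparison hF hκ K' B hℓ
  have hu : UniqueDiffOn ℝ (Ico 0 T) := uniqueDiffOn_Ico 0 T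
  have hsmooth : ∀ i, ∀ t ∈ Ico 0 T, ContDiff ℝ ∞ (ρb i t) := fun i t ht =>
    contDiff_slice (hlim.smooth_density i) ht
  have hlow' : ∀ i, ∀ t ∈ Ico 0 T, ∀ x, κ ≤ ρb i t x := fun i t ht x => by
    have h1 := le_on_Ico_of_le_on_Ioo hT (F := fun t x => -ρb i t x) (B := -κ)
      (hlim.smooth_density i).continuousOn.neg (fun t ht x => neg_le_neg (hlow i t ht x)) t ht x
    exact neg_le_neg_iff.1 h1
  have hup : ∀ i, ∀ t ∈ Ico 0 T, ∀ x, ρb i t x ≤ B := fun i =>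
    le_on_Ico_of_le_on_Ioo hT (hlim.smooth_density i).continuousOn
      fun t ht x => (hB t ht x).1 i
  have hgrad : ∀ i, ∀ t ∈ Ico 0 T, ∀ x, ‖gradient (ρb i t) x‖ ≤ B := fun i t ht x => by
    have hc : ContinuousOn (fun p : ℝ × E3 => ‖gradient (ρb i p.1) p.2‖ ^ 2) (Ico 0 T ×ˢ univ) := by
      simp only [norm_sq_eq_sum, gradient_apply]
      exact continuousOn_finsetSum _ fun k _ => (contDiffOn_pderiv hu (hlim.smooth_density i)
        (m := ∞) (by simp) k).continuousOn.pow 2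
    have h1 := le_on_Ico_of_le_on_Ioo hT (F := fun t x => ‖gradient (ρb i t) x‖ ^ 2) hc
      (fun t ht x => pow_le_pow_left₀ (norm_nonneg _) ((hB t ht x).2.1 i) 2) t ht x
    exact le_of_sq_le_sq h1 hB0
  have hmem : ∀ i, ∀ t ∈ Ico 0 T, ∀ x, ρb i t x ∈ Icc κ K' := fun i t ht x =>
    ⟨hlow' i t ht x, (hup i t ht x).trans (le_max_right _ _)⟩
  have hc0 : ∀ i r, 0 < r → 0 < c i r := fun i r hr => by
    obtain ⟨-, -, α, -, hα⟩ := hF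
    exact (hα i r hr).2.2
  -- The rate is at most `C₁ χ + C₁ ε` and `χ ≤ E / a`; the Gronwall lemma takes one constant for
  -- both terms.
  set C₀ : ℝ := C₁ / a + C₁ with hC₀
  have hC₀0 : 0 ≤ C₀ := by positivity
  -- `C₂ + 1` bounds `E 0 + ε` by `χ(0) + ε`, the exponential is the Gronwall factor, and `1/a`
  -- returns from `E` to `χ`.
  refine ⟨Real.exp (C₀ * T) * (C₂ + 1) / a, by positivity, ?_⟩
  intro ε hε ρ q v sol hρ t ht
  set E : ℝ → ℝ := fun t => ∫ x in (Domain.torus ℓ hℓ).cell, ∑ i, relativeEnergyComponent (h i)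
      (c i) (ρb i t) (w t) (ρ i t x) (q i t x) (v i t x) x with hE
  set X : ℝ → ℝ := fun t => ∫ x in (Domain.torus ℓ hℓ).cell, ∑ i, chiComponent (c i) (ρ i t x)
      (ρb i t x) (q i t x) (gradient (ρb i t) x) (v i t x) (w t x) with hX
  obtain ⟨hEi, hEc⟩ := sol.continuousOn_relativeEnergy hF hlim
    fun i t ht x => hκ.trans_le (hlow' i t ht x)
  have hρI : ∀ i, ∀ t ∈ Ico 0 T, ∀ᵐ x ∂volume.restrict (Domain.torus ℓ hℓ).cell,
      ρ i t x ∈ Icc κ K := by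
    intro i t ht
    rcases ht.1.eq_or_lt with h0 | h0
    · subst h0
      -- The density bounds are assumed only for positive times; at time zero they follow from `L¹`
      -- continuity.
      exact (sol.density_cont i).ae_mem_Icc hK.le hT fun s hs => ae_restrict_of_ae (hρ i s hs)
    · exact ae_restrict_of_ae (hρ i t ⟨h0, ht.2⟩)
  have hρK : ∀ i, ∀ t ∈ Ico 0 T, ∀ᵐ x ∂volume.restrict (Domain.torus ℓ hℓ).cell,
      ρ i t x ∈ Icc κ K' := fun i t ht => (hρI i t ht).mono fun x hx =>
    ⟨hx.1, hx.2.trans (le_max_left _ _)⟩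
  have hXE : ∀ t ∈ Ico 0 T, IntegrableOn (fun x => ∑ i, chiComponent (c i) (ρ i t x) (ρb i t x)
      (q i t x) (gradient (ρb i t) x) (v i t x) (w t x)) (Domain.torus ℓ hℓ).cell ∧
      a * X t ≤ E t ∧ E t ≤ C₂ * X t := fun t ht =>
    hcomp (fun i => ρb i t) (w t) (fun i => ρ i t) (fun i => q i t) (fun i => v i t)
      (fun i => hsmooth i t ht) (fun i => hlim.on_domain_density i t ht)
      (contDiff_slice hlim.smooth_velocity ht).continuous (hlim.on_domain_velocity t ht)
      (fun i x => hmem i t ht x) (fun i x => hgrad i t ht x) (fun i => sol.gradient_eq i t ht.1)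
      (fun i => hρK i t ht) (fun i => (sol.momentum_cont i).1 t ht.1) (hEi t ht)
  have hnn : ∀ t ∈ Ico 0 T, ∀ᵐ x ∂volume.restrict (Domain.torus ℓ hℓ).cell,
      0 ≤ ∑ i, chiComponent (c i) (ρ i t x) (ρb i t x)
      (q i t x) (gradient (ρb i t) x) (v i t x) (w t x) := by
    intro t ht
    filter_upwards [ae_all_iff.2 fun i => hρI i t ht] with x hx
    exact Finset.sum_nonneg fun i _ => chiComponent_nonneg (hκ.le.trans (hx i).1)
      (hc0 i _ (hκ.trans_le (hx i).1)) _ _ _ _ _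
  have hX0 : ∀ t ∈ Ico 0 T, 0 ≤ X t := fun t ht => integral_nonneg_of_ae (hnn t ht)
  have hchi : ∀ t ∈ Ico 0 T, chi (Domain.torus ℓ hℓ) c ρ q v ρb w t = ENNReal.ofReal (X t) := by
    intro t ht
    rw [hX, ofReal_integral_eq_lintegral_ofReal (hXE t ht).1 (hnn t ht)]
    simp only [chi, chiComponent, chiPotential, add_assoc]
  have hEle : ∀ t ∈ Ioo 0 T, E t ≤ Real.exp (C₀ * t) * (E 0 + ε) - ε := by
    refine le_exp_mul_of_distributional hEc fun θ hθ hθ0 a₁ b₁ ha₁ hb₁ h0 => ?_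
    -- A slightly larger slab, leaving the room in time that mollification needs.
    have hA : 0 < a₁ / 2 := by linarith
    have hBT : (b₁ + T) / 2 < T := by linarith
    obtain ⟨iE, iR, hcut⟩ := sol.relativeEnergy_cutoff hN.1 hF hρ hκ hlim
      (fun i t ht x => hκ.trans_le (hlow i t ht x)) hA hBT
    have h1 := hcut θ hθ hθ0 a₁ b₁ (by linarith) (by linarith) h0
    have hθ' : Continuous (deriv θ) := hθ.continuous_deriv (by simp)
    have hint := (integrableOn_slab_mul iE (T := T) (continuousOn_time hθ') hA hBT).add
      (integrableOn_slab_mul iR (T := T) (continuousOn_time hθ.continuous) hA hBT)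
    have hint' : IntegrableOn (fun p : ℝ × E3 =>
        deriv θ p.1 * (∑ i, relativeEnergyComponent (h i) (c i) (ρb i p.1) (w p.1)
          (ρ i p.1 p.2) (q i p.1 p.2) (v i p.1 p.2) p.2)
        + θ p.1 * (∑ i, componentRate (h i) (c i) (ρb i p.1)
            (fun x => -divergence (fun y => ρb i p.1 y • w p.1 y) x) (w p.1)
            (fun y => deriv (fun s => w s y) p.1) (ρ i p.1 p.2) (q i p.1 p.2) (v i p.1 p.2) p.2
          - 1 / (2 * ε) * dissipation b ρ v p.1 p.2))
        (slab ℓ hℓ (a₁ / 2) ((b₁ + T) / 2)) := by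
      refine hint.congr (Eventually.of_forall fun p => ?_)
      simp only [Pi.add_apply]
      ring
    rw [setIntegral_slab hint'] at h1
    have hsub : ∀ t ∈ Icc (a₁ / 2) ((b₁ + T) / 2), t ∈ Ioo 0 T := fun t ht =>
      ⟨hA.trans_le ht.1, ht.2.trans_lt hBT⟩
    have hEc' : ContinuousOn E (Icc (a₁ / 2) ((b₁ + T) / 2)) :=
      hEc.mono fun t ht => Ioo_subset_Ico_self (hsub t ht)
    have h2 : ∫ t in Icc (a₁ / 2) ((b₁ + T) / 2), (deriv θ t * E t + θ t * (C₀ * E t + C₀ * ε))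
        = ∫ t in Icc a₁ b₁, (deriv θ t * E t + θ t * (C₀ * E t + C₀ * ε)) := by
      refine setIntegral_eq_of_subset_of_forall_sdiff_eq_zero measurableSet_Icc
        (Icc_subset_Icc (by linarith) (by linarith)) fun t ht => ?_
      rw [h0 t ht.2, deriv_eq_zero_of_vanishing h0 ht.2, zero_mul, zero_mul, add_zero]
    rw [← h2]
    refine h1.trans (integral_mono_ae ?_ ?_ ?_)
    · rw [IntegrableOn, restrict_slab] at hint'
      exact hint'.integral_prod_left
    · exact ((hθ'.continuousOn.mul hEc').add (hθ.continuous.continuousOn.mul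
        ((continuousOn_const.mul hEc').add continuousOn_const))).integrableOn_compact isCompact_Icc
    · rw [IntegrableOn, restrict_slab] at iR
      filter_upwards [iR.prod_right_ae, ae_restrict_mem measurableSet_Icc] with t hRt htI
      have ht := hsub t htI
      have ht' := Ioo_subset_Ico_self ht
      have h3 := hrate ε hε (fun i => ρb i t) (w t) (fun y => deriv (fun s => w s y) t)
        (fun i => ρ i t) (fun i => q i t) (fun i => v i t) (fun i => hsmooth i t ht')
        (fun i => hlim.on_domain_density i t ht') (contDiff_slice hlim.smooth_velocity ht')
        (hlim.on_domain_velocity t ht') (fun i x => hmem i t ht' x) (fun i x => hgrad i t ht' x)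
        (fun j k x => (hB t ht x).2.2.1 j k) (fun k x => (hB t ht x).2.2.2.1 k)
        (fun i x => (hB t ht x).2.2.2.2 i)
        (fun x => sum_smul_momentumDefect_eq_zero hF hlim ht
          (fun i x => hκ.trans_le (hlow i t ht x)) x)
        (fun i => sol.gradient_eq i t ht'.1) (fun i => hρK i t ht') (hXE t ht').1 hRt
      have h4 : C₁ * X t + C₁ * ε ≤ C₀ * E t + C₀ * ε := by
        have h5 := (hXE t ht').2.1
        have h6 : C₁ * X t ≤ C₁ / a * E t := by
          rw [div_mul_eq_mul_div, le_div_iff₀ ha]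
          nlinarith
        have h7 : 0 ≤ E t := (mul_nonneg ha.le (hX0 t ht')).trans h5
        have h8 : 0 ≤ C₁ / a * ε := by positivity
        rw [hC₀]
        nlinarith [mul_nonneg hC₁ h7]
      have h5 := mul_le_mul_of_nonneg_left (h3.trans h4) (hθ0 t)
      rw [integral_add ((hEi t ht').const_mul _) (hRt.const_mul _), integral_const_mul,
        integral_const_mul]
      exact add_le_add_right h5 _
  have ht' := Ioo_subset_Ico_self ht
  have h00 : (0 : ℝ) ∈ Ico 0 T := ⟨le_rfl, hT⟩
  rw [hchi t ht', hchi 0 h00, ← ENNReal.ofReal_add (hX0 0 h00) hε.le,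
    ← ENNReal.ofReal_mul (by positivity)]
  refine ENNReal.ofReal_le_ofReal ?_
  have h1 := hEle t ht
  have h2 := (hXE t ht').2.1
  have h3 := (hXE 0 h00).2.2
  have h4 := hX0 0 h00
  rw [div_mul_eq_mul_div, le_div_iff₀ ha]
  have h5 : Real.exp (C₀ * t) * (E 0 + ε) ≤ Real.exp (C₀ * T) * ((C₂ + 1) * (X 0 + ε)) := by
    refine mul_le_mul (Real.exp_le_exp.2 (mul_le_mul_of_nonneg_left ht.2.le hC₀0)) ?_ ?_
      (Real.exp_pos _).le
    · nlinarith [mul_nonneg hC₂ hε.le]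
    · have := mul_nonneg ha.le h4
      linarith [(hXE 0 h00).2.1]
  linarith

end

/-! ### Degenerate cases and conclusion -/

theorem chi_eq_zero_of_isEmpty {n : ℕ} (hn : n = 0) (D : Domain) (c : Fin n → ℝ → ℝ)
    (ρ : Fin n → ℝ → E3 → ℝ) (q v : Fin n → ℝ → E3 → E3) (ρb : Fin n → ℝ → E3 → ℝ)
    (w : ℝ → E3 → E3) (t : ℝ) : chi D c ρ q v ρb w t = 0 := by
  subst hn
  simp [chi]

/-- On the whole space a positive lower bound is incompatible with integrability. -/
theorem not_densityBounds_space {n : ℕ} (hn : 0 < n) {b : Fin n → Fin n → ℝ}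
    {h c : Fin n → ℝ → ℝ} {ε T κ K : ℝ} (hT : 0 < T) (hκ : 0 < κ) {ρ : Fin n → ℝ → E3 → ℝ}
    {q v : Fin n → ℝ → E3 → E3} (sol : IsDissipativeWeakSolution Domain.space b h c ε ρ q v) :
    ¬ DensityBounds T κ K ρ := by
  intro hρ
  have h1 := (sol.density_cont ⟨0, hn⟩).1 (T / 2) (by linarith)
  have h2 := hρ ⟨0, hn⟩ (T / 2) ⟨by linarith, by linarith⟩
  simp only [Domain.cell, integrableOn_univ] at h1
  have h3 : Integrable (fun _ : E3 => κ) volume := by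
    refine h1.mono' aestronglyMeasurable_const ?_
    filter_upwards [h2] with x hx
    rw [Real.norm_of_nonneg hκ.le]
    exact hx.1
  rw [integrable_const_iff_isFiniteMeasure hκ.ne'] at h3
  have h4 := h3.measure_univ_lt_top
  simp at h4

/-- The stability estimate on an arbitrary domain. -/
theorem exists_chi_estimate (n : ℕ) (D : Domain) (b : Fin n → Fin n → ℝ)
    (hN : FrictionHypothesis b) (h c : Fin n → ℝ → ℝ) (hF : EnergyHypothesis h c) (T κ K : ℝ)
    (hT : 0 < T) (hκ : 0 < κ) (hK : κ < K) (ρb : Fin n → ℝ → E3 → ℝ) (w : ℝ → E3 → E3)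
    (hlim : IsSmoothLimitSolution D h c T ρb w) (hbd : LimitBounds T ρb w)
    (hlow : ∀ i, ∀ t ∈ Ioo 0 T, ∀ x, κ ≤ ρb i t x) :
    ∃ C : ℝ, 0 < C ∧ ∀ ε : ℝ, 0 < ε → ∀ (ρ : Fin n → ℝ → E3 → ℝ) (q v : Fin n → ℝ → E3 → E3),
      IsDissipativeWeakSolution D b h c ε ρ q v → DensityBounds T κ K ρ →
      ∀ t ∈ Ioo 0 T, chi D c ρ q v ρb w t
        ≤ ENNReal.ofReal C * (chi D c ρ q v ρb w 0 + ENNReal.ofReal ε) := by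
  rcases Nat.eq_zero_or_pos n with hn | hn
  · refine ⟨1, one_pos, fun ε _ ρ q v _ _ t _ => ?_⟩
    rw [chi_eq_zero_of_isEmpty hn]
    exact bot_le
  cases D with
  | space =>
    exact ⟨1, one_pos, fun ε _ ρ q v sol hρ =>
      absurd hρ (not_densityBounds_space hn hT hκ sol)⟩
  | torus ℓ hℓ => exact exists_chi_estimate_torus hn hN hF hT hκ hK hlim hbd hlow

end EulerKorteweg

end

theorem mainTheorem3 (n : ℕ) (D : Domain) (b : Fin n → Fin n → ℝ) (hN : FrictionHypothesis b)
    (h c : Fin n → ℝ → ℝ) (hF : EnergyHypothesis h c)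
    (T κ K M : ℝ) (hT : 0 < T) (hκ : 0 < κ) (hK : κ < K)
    (ρb : Fin n → ℝ → E3 → ℝ) (w : ℝ → E3 → E3)
    (hlim : IsSmoothLimitSolution D h c T ρb w)
    (hbd : LimitBounds T ρb w)
    (hlow : ∀ i, ∀ t ∈ Ioo 0 T, ∀ x, κ ≤ ρb i t x) :
    ∃ C : ℝ, 0 < C ∧
      (∀ ε : ℝ, 0 < ε → ∀ (ρ : Fin n → ℝ → E3 → ℝ) (q v : Fin n → ℝ → E3 → E3),
        IsDissipativeWeakSolution D b h c ε ρ q v →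
        FiniteMassEnergy D h c T M ρ q v →
        DensityBounds T κ K ρ →
        ∀ t ∈ Ioo 0 T,
          chi D c ρ q v ρb w t
            ≤ ENNReal.ofReal C * (chi D c ρ q v ρb w 0 + ENNReal.ofReal ε)) ∧
      (∀ (ρ : ℝ → Fin n → ℝ → E3 → ℝ) (q v : ℝ → Fin n → ℝ → E3 → E3),
        (∀ ε : ℝ, 0 < ε →
          IsDissipativeWeakSolution D b h c ε (ρ ε) (q ε) (v ε) ∧
          FiniteMassEnergy D h c T M (ρ ε) (q ε) (v ε) ∧
          DensityBounds T κ K (ρ ε)) →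
        Tendsto (fun ε => chi D c (ρ ε) (q ε) (v ε) ρb w 0) (𝓝[>] 0) (𝓝 0) →
        Tendsto (fun ε => ⨆ t ∈ Ioo 0 T, chi D c (ρ ε) (q ε) (v ε) ρb w t) (𝓝[>] 0) (𝓝 0)) := by
  obtain ⟨C, hC, hmain⟩ := exists_chi_estimate n D b hN h c hF T κ K hT hκ hK ρb w hlim hbd hlow
  refine ⟨C, hC, fun ε hε ρ q v sol _ hρ => hmain ε hε ρ q v sol hρ, fun ρ q v hsol h0 => ?_⟩
  have hε : Tendsto (fun ε : ℝ => ENNReal.ofReal ε) (𝓝[>] 0) (𝓝 0) := by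
    have h1 := (ENNReal.continuous_ofReal.tendsto 0).mono_left (nhdsWithin_le_nhds (s := Ioi 0))
    rwa [ENNReal.ofReal_zero] at h1
  have h1 := ENNReal.Tendsto.const_mul (a := ENNReal.ofReal C) (h0.add hε)
    (Or.inr ENNReal.ofReal_ne_top)
  rw [add_zero, mul_zero] at h1
  -- The constant does not depend on `t`, so the supremum obeys the same bound and is squeezed to
  -- zero.
  refine tendsto_of_tendsto_of_tendsto_of_le_of_le' tendsto_const_nhds h1
    (Eventually.of_forall fun _ => bot_le) ?_
  filter_upwards [self_mem_nhdsWithin] with ε hε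
  exact iSup₂_le fun t ht => hmain ε hε _ _ _ (hsol ε hε).1 (hsol ε hε).2.2 t ht
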